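/- Let $n\ge 1$ and let $\Omega\subset\mathbb R^n$ be a bounded Lipschitz domain. A function $M:\Omega\times\mathbb R^{\ell}\to[0,\infty)$ is a weak $N$-function if it is Carathéodory (measurable in $x$, continuous in $\xi$), and for a.a. $x\in\Omega$: $M(x,0)=0$, $\xi\mapsto M(x,\xi)$ is convex and even, and $m_1(|\xi|)\le M(x,\xi)\le m_2(|\xi|)$ for all $\xi$, with two convex functions $m_1,m_2:[0,\infty)\to[0,\infty)$ independent of $x$ such that $m_1(0)=0$ and $m_1(s)>0$ for $s>0$. Let $M:\Omega\times\mathbb R^n\to[0,\infty)$ be a weak $N$-function that is continuous on $\Omega\times\mathbb R^n$; no $\Delta_2$ (doubling) condition is assumed. Let $F:\Omega\times\mathbb R\times\mathbb R^n\to\mathbb R$ be measurable in the first variable and continuous in the second and third variables, and suppose there are constants $0<\nu,\beta<1<L$ with $$\nu M(x,\beta\xi)\le F(x,z,\xi)\le L\,(M(x,\xi)+1)\qquad\text{for all }x\in\Omega,\ z\in\mathbb R,\ \xi\in\mathbb R^n .$$ Put $\mathcal F[u]=\int_\Omega F(x,u,\nabla u)\,dx$. Let $\|\xi\|_{L_M}=\inf\{\lambda>0:\int_\Omega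 M(x,\xi(x)/\lambda)\,dx\le 1\}$, let $E_M(\Omega;\mathbb R^n)$ be the closure of the bounded measurable functions in this norm, and let $V^1E_M(\Omega)=\{f\in W^{1,1}(\Omega):\nabla f\in E_M\}$ and $V^1_0E_M(\Omega)=\{f\in W^{1,1}_0(\Omega):\nabla f\in E_M\}$, where $\nabla$ is the distributional gradient and $W^{1,1}_0(\Omega)$ is the closure of $C_c^\infty(\Omega)$ in $W^{1,1}(\Omega)$. For $\gamma\in(0,1]$, $C^{0,\gamma}(\Omega)$ is the space of functions on $\Omega$ with $\sup_{x\ne y}|u(x)-u(y)|/|x-y|^\gamma<\infty$. For $\gamma\in[0,1]$, $M$ satisfies condition $(\mathsf{B}^{\mathsf{gen}}_{\gamma+})$ if $$M(x,\xi)=\sum_{j=1}^{N}M_j(x,\xi_j),\qquad x\in\Omega,\ \xi\in\mathbb R^n,$$ where $N\ge1$, the components $\xi_j=P_j\xi\in\mathbb R^{\ell_j}$ are given by surjective linear maps $P_j:\mathbb R^n\to\mathbb R^{\ell_j}$ with $\bigcap_j\ker P_j=\{0\}$, each $M_j:\Omega\times\mathbb R^{\ell_j}\to[0,\infty)$ is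 a weak $N$-function, and there are a constant $C>1$ and a function $\vartheta:(0,1]\to(0,\infty)$ with $1/\vartheta(r)=o(r^{1-\gamma})$ as $r\to0^+$ such that for every ball $B\subset\mathbb R^n$ of radius $r\le1$ meeting $\Omega$, every $j$, and every $\xi_j\in\mathbb R^{\ell_j}$, $$(M_j)^-_B(C\xi_j)\le\sup_{|\eta_j|=1}(M_j)^-_B(\vartheta(r)\eta_j)\quad\Longrightarrow\quad (M_j)^+_B(\xi_j)\le (M_j)^-_B(C\xi_j)+1 .$$ Here $(M_j)^-_B(\xi_j)$ and $(M_j)^+_B(\xi_j)$ denote the essential infimum and the essential supremum of $M_j(y,\xi_j)$ over $y\in B\cap\Omega$. Then: (i) If $u_0\in V^1E_M(\Omega)$ and $M$ satisfies $(\mathsf{B}^{\mathsf{gen}}_{\gamma+})$ with $\gamma=0$, then $$\inf_{u\in u_0+V^1_0E_M(\Omega)}\mathcal F[u]=\inf_{u\in u_0+C_c^\infty(\Omega)}\mathcal F[u].$$ (ii) If $\gamma\in(0,1]$, $u_0\in V^1E_M(\Omega)\cap C^{0,\gamma}(\Omega)$ and $M$ satisfies $(\mathsf{B}^{\mathsf{gen}}_{\gamma+})$,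 then $$\inf_{u\in u_0+(V^1_0E_M(\Omega)\cap C^{0,\gamma}(\Omega))}\mathcal F[u]=\inf_{u\in u_0+C_c^\infty(\Omega)}\mathcal F[u].$$ -/

import Mathlib

open MeasureTheory Set Topology Asymptotics
open scoped NNReal ENNReal ContDiff

noncomputable section

namespace Lavrentiev

/-- `ℝⁿ` with the Euclidean norm. -/
abbrev Eucl (n : ℕ) : Type := EuclideanSpace ℝ (Fin n)

/-- A bounded Lipschitz domain: a bounded, open, connected, nonempty set whose boundary is locally
the graph of a Lipschitz function with the set lying on one side of it. In the direction of the
unit vector `e`, a function of the `n - 1` coordinates orthogonal to `e` is written as a function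
`g` on `ℝⁿ` that is constant along `e`. -/
def IsBoundedLipschitzDomain {n : ℕ} (Ω : Set (Eucl n)) : Prop :=
  IsOpen Ω ∧ IsConnected Ω ∧ Bornology.IsBounded Ω ∧
    ∀ p ∈ frontier Ω, ∃ (e : Eucl n) (g : Eucl n → ℝ) (K : ℝ≥0) (r : ℝ),
      ‖e‖ = 1 ∧ LipschitzWith K g ∧ (∀ (x : Eucl n) (t : ℝ), g (x + t • e) = g x) ∧ 0 < r ∧
      Ω ∩ Metric.ball p r = {x | g x < inner ℝ x e} ∩ Metric.ball p r

/-- `C_c^∞(Ω)`. -/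
def IsTestFunction {n : ℕ} (Ω : Set (Eucl n)) (φ : Eucl n → ℝ) : Prop :=
  ContDiff ℝ ∞ φ ∧ HasCompactSupport φ ∧ tsupport φ ⊆ Ω

/-- `G ∈ L¹(Ω; ℝⁿ)` is the distributional gradient of `u` on `Ω`. -/
def HasWeakGradient {n : ℕ} (Ω : Set (Eucl n)) (u : Eucl n → ℝ) (G : Eucl n → Eucl n) : Prop :=
  IntegrableOn G Ω ∧ ∀ φ : Eucl n → ℝ, IsTestFunction Ω φ →
    (∫ x in Ω, u x • gradient φ x) = -(∫ x in Ω, φ x • G x)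

/-- Distributional gradients on an open set are unique up to null sets. -/
theorem HasWeakGradient.ae_eq {n : ℕ} {Ω : Set (Eucl n)} (hΩ : IsOpen Ω) {u : Eucl n → ℝ}
    {G H : Eucl n → Eucl n} (hG : HasWeakGradient Ω u G) (hH : HasWeakGradient Ω u H) :
    G =ᵐ[volume.restrict Ω] H := by
  have key := hΩ.ae_eq_zero_of_integral_contDiff_smul_eq_zero (f := fun x => G x - H x)
    (μ := volume) (hG.1.sub hH.1).locallyIntegrableOn ?_
  · rw [Filter.EventuallyEq, ae_restrict_iff' hΩ.measurableSet]
    filter_upwards [key] with x hx hxΩ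
    exact sub_eq_zero.1 (hx hxΩ)
  · intro φ hφ hφc hφs
    have ht : IsTestFunction Ω φ := ⟨hφ, hφc, hφs⟩
    have e : ∫ x in Ω, φ x • G x = ∫ x in Ω, φ x • H x :=
      neg_injective ((hG.2 φ ht).symm.trans (hH.2 φ ht))
    obtain ⟨C, hC⟩ := hφ.continuous.bounded_above_of_compact_support hφc
    have hi : ∀ K : Eucl n → Eucl n, IntegrableOn K Ω → IntegrableOn (fun x => φ x • K x) Ω :=
      fun K hK => Integrable.bdd_smul hK C
        hφ.continuous.aestronglyMeasurable (Filter.Eventually.of_forall hC)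
    have h0 : ∫ x in Ω, φ x • (G x - H x) = 0 := by
      simp only [smul_sub]
      rw [integral_sub (hi G hG.1) (hi H hH.1), e, sub_self]
    rw [← h0]
    refine (setIntegral_eq_integral_of_forall_compl_eq_zero fun x hx => ?_).symm
    rw [image_eq_zero_of_notMem_tsupport fun h => hx (hφs h), zero_smul]

open Classical in
/-- The distributional gradient on `Ω` (determined up to null sets; `0` if there is none in
`L¹`). -/
def weakGradient {n : ℕ} (Ω : Set (Eucl n)) (u : Eucl n → ℝ) : Eucl n → Eucl n :=
  if h : ∃ G, HasWeakGradient Ω u G then h.choose else 0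

/-- `W^{1,1}(Ω)`. -/
def MemW11 {n : ℕ} (Ω : Set (Eucl n)) (u : Eucl n → ℝ) : Prop :=
  IntegrableOn u Ω ∧ ∃ G, HasWeakGradient Ω u G

/-- `W_0^{1,1}(Ω)`, the closure of `C_c^∞(Ω)` in `W^{1,1}(Ω)`. -/
def MemW110 {n : ℕ} (Ω : Set (Eucl n)) (u : Eucl n → ℝ) : Prop :=
  MemW11 Ω u ∧ ∀ ε : ℝ≥0∞, 0 < ε → ∃ φ : Eucl n → ℝ, IsTestFunction Ω φ ∧
    (∫⁻ x in Ω, ‖u x - φ x‖ₑ) + (∫⁻ x in Ω, ‖weakGradient Ω u x - gradient φ x‖ₑ) < ε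

/-- Weak `N`-functions `M : Ω × ℝ^ℓ → [0, ∞)`. -/
structure IsWeakNFunction {n ℓ : ℕ} (Ω : Set (Eucl n)) (M : Eucl n → Eucl ℓ → ℝ) : Prop where
  nonneg : ∀ x ∈ Ω, ∀ ξ, 0 ≤ M x ξ
  measurable : ∀ ξ, AEMeasurable (fun x => M x ξ) (volume.restrict Ω)
  continuous : ∀ᵐ x ∂(volume.restrict Ω), Continuous (M x)
  zero : ∀ᵐ x ∂(volume.restrict Ω), M x 0 = 0
  convex : ∀ᵐ x ∂(volume.restrict Ω), ConvexOn ℝ univ (M x)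
  even : ∀ᵐ x ∂(volume.restrict Ω), ∀ ξ, M x (-ξ) = M x ξ
  bounds : ∃ m₁ m₂ : ℝ → ℝ, ConvexOn ℝ (Ici 0) m₁ ∧ ConvexOn ℝ (Ici 0) m₂ ∧
    m₁ 0 = 0 ∧ (∀ s, 0 < s → 0 < m₁ s) ∧ (∀ s, 0 ≤ s → 0 ≤ m₂ s) ∧
    ∀ᵐ x ∂(volume.restrict Ω), ∀ ξ, m₁ ‖ξ‖ ≤ M x ξ ∧ M x ξ ≤ m₂ ‖ξ‖

/-- The modular `∫_Ω M(x, ξ(x)) dx`. -/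
def modular {n : ℕ} (Ω : Set (Eucl n)) (M : Eucl n → Eucl n → ℝ) (ξ : Eucl n → Eucl n) : ℝ≥0∞ :=
  ∫⁻ x in Ω, ENNReal.ofReal (M x (ξ x))

/-- The Luxemburg norm of `L_M(Ω; ℝⁿ)`, equal to `∞` for measurable functions outside `L_M`. -/
def luxemburgNorm {n : ℕ} (Ω : Set (Eucl n)) (M : Eucl n → Eucl n → ℝ)
    (ξ : Eucl n → Eucl n) : ℝ≥0∞ :=
  ⨅ (c : ℝ) (_ : 0 < c) (_ : modular Ω M (fun x => c⁻¹ • ξ x) ≤ 1), ENNReal.ofReal c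

/-- `E_M(Ω; ℝⁿ)`, the closure of the bounded measurable functions in the Luxemburg norm. -/
def MemEM {n : ℕ} (Ω : Set (Eucl n)) (M : Eucl n → Eucl n → ℝ) (ξ : Eucl n → Eucl n) : Prop :=
  AEStronglyMeasurable ξ (volume.restrict Ω) ∧
    ∀ ε : ℝ≥0∞, 0 < ε → ∃ η : Eucl n → Eucl n, AEStronglyMeasurable η (volume.restrict Ω) ∧
      (∃ C : ℝ, ∀ᵐ x ∂(volume.restrict Ω), ‖η x‖ ≤ C) ∧
      luxemburgNorm Ω M (fun x => ξ x - η x) < ε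

/-- `V¹E_M(Ω)`. -/
def V1E {n : ℕ} (Ω : Set (Eucl n)) (M : Eucl n → Eucl n → ℝ) : Set (Eucl n → ℝ) :=
  {u | MemW11 Ω u ∧ MemEM Ω M (weakGradient Ω u)}

/-- `V¹₀E_M(Ω)`. -/
def V10E {n : ℕ} (Ω : Set (Eucl n)) (M : Eucl n → Eucl n → ℝ) : Set (Eucl n → ℝ) :=
  {u | MemW110 Ω u ∧ MemEM Ω M (weakGradient Ω u)}

/-- The Hölder space `C^{0,γ}(Ω)`. -/
def HolderSpace {n : ℕ} (Ω : Set (Eucl n)) (γ : ℝ≥0) : Set (Eucl n → ℝ) :=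
  {u | ∃ C : ℝ≥0, HolderOnWith C γ u Ω}

/-- `M_B^-(ξ)`, the essential infimum over the part of `B` in `Ω`. -/
def lowerEnv {n ℓ : ℕ} (Ω B : Set (Eucl n)) (M : Eucl n → Eucl ℓ → ℝ) (ξ : Eucl ℓ) : ℝ :=
  essInf (fun y => M y ξ) (volume.restrict (B ∩ Ω))

/-- `M_B^+(ξ)`, the essential supremum over the part of `B` in `Ω`. -/
def upperEnv {n ℓ : ℕ} (Ω B : Set (Eucl n)) (M : Eucl n → Eucl ℓ → ℝ) (ξ : Eucl ℓ) : ℝ :=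
  essSup (fun y => M y ξ) (volume.restrict (B ∩ Ω))

/-- The balance condition `(B^gen_{γ+})`. The components `ξ_j ∈ ℝ^{ℓ_j}` of `ξ ∈ ℝⁿ` are the images
of `ξ` under surjective linear maps `P j`, which together determine `ξ`. -/
def BGenPlus {n : ℕ} (Ω : Set (Eucl n)) (M : Eucl n → Eucl n → ℝ) (γ : ℝ≥0) : Prop :=
  ∃ (N : ℕ) (ℓ : Fin N → ℕ) (P : (j : Fin N) → Eucl n →ₗ[ℝ] Eucl (ℓ j))
    (m : (j : Fin N) → Eucl n → Eucl (ℓ j) → ℝ) (C : ℝ) (ϑ : ℝ → ℝ),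
    0 < N ∧
    (∀ j, Function.Surjective (P j)) ∧
    (∀ ξ, (∀ j, P j ξ = 0) → ξ = 0) ∧
    (∀ j, IsWeakNFunction Ω (m j)) ∧
    (∀ x ∈ Ω, ∀ ξ, M x ξ = ∑ j, m j x (P j ξ)) ∧
    1 < C ∧
    (∀ r ∈ Ioc (0 : ℝ) 1, 0 < ϑ r) ∧
    ((fun r => (ϑ r)⁻¹) =o[𝓝[>] (0 : ℝ)] fun r => r ^ (1 - (γ : ℝ))) ∧
    ∀ (z : Eucl n) (r : ℝ), 0 < r → r ≤ 1 → (Metric.ball z r ∩ Ω).Nonempty →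
      ∀ (j : Fin N) (ξ : Eucl (ℓ j)),
        lowerEnv Ω (Metric.ball z r) (m j) (C • ξ) ≤
            ⨆ η : Metric.sphere (0 : Eucl (ℓ j)) 1,
              lowerEnv Ω (Metric.ball z r) (m j) (ϑ r • (η : Eucl (ℓ j))) →
          upperEnv Ω (Metric.ball z r) (m j) ξ ≤
            lowerEnv Ω (Metric.ball z r) (m j) (C • ξ) + 1

/-- The functional `∫_Ω F(x, u, ∇u) dx` for a nonnegative integrand `F`. -/
def energy {n : ℕ} (Ω : Set (Eucl n)) (F : Eucl n → ℝ → Eucl n → ℝ) (u : Eucl n → ℝ) : ℝ≥0∞ :=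
  ∫⁻ x in Ω, ENNReal.ofReal (F x (u x) (weakGradient Ω u x))

end Lavrentiev

end

open Lavrentiev

namespace Lavrentiev

open Filter

/-! ### Carathéodory functions and dominated convergence -/

/-! Test functions are admissible competitors, so the infimum over them is at least the other one.
The content is the reverse inequality: for each admissible `v` there are test functions whose
energies, added to `u₀`, do not exceed that of `u₀ + v` in the limit.

Without a doubling condition, norm convergence is replaced by convergence of all modulars. A field
in E_M has finite modular after multiplication by any constant (`MemEM.finiteModulars`), so
constants lost through convexity do no harm. If φₖ → v in L¹ and ∫ M(x, 2(∇v - ∇φₖ)) → 0, the growth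
bound F ≤ L(M + 1) gives a majorant consisting of a fixed integrable function plus a sequence
tending to zero in L¹. Generalized dominated convergence then yields limsup 𝓕[u₀ + φₖ] ≤ 𝓕[u₀ + v]
(`iInf_energy_le`). What remains is the density statement `ApproxByTest`.

The approximants are mollifications. Convexity alone does not control M(x, ∇v_s(x)) by the average
of M(y, ∇v(y)), since M depends on x. The balance condition supplies a Jensen inequality with a
constant factor and an additive constant, as long as the averaged vector stays below a threshold
Θ(r) (`BGenPlus.exists_jensen`). If the zero extension of v is γ-Hölder, then |∇v_s| is of order
s^(γ-1), and 1/Θ(r) = o(r^(1-γ)) puts this below the threshold for small s. Hence M(x, ∇v_s) is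
bounded by a constant plus the mollification of the L¹ function M(·, λ∇v), which converges in L¹
(`HasZeroExtGradient.approxByTest`).

Two points concern the boundary. Mollified functions must have compact support in Ω: after a
partition of unity, the kernel in each boundary chart is centred at a vector pointing into Ω, so
mass moves inwards. And the zero extension must be Hölder on ℝⁿ: a Poincaré inequality on thin
boundary layers shows that a Hölder function in W₀^{1,1} vanishes at the boundary. For γ = 0
boundedness suffices, and it is obtained from the smooth truncation m sin(v/m). -/

theorem aemeasurable_caratheodory {α E : Type*} [MeasurableSpace α] {μ : Measure α}
    [TopologicalSpace E] [TopologicalSpace.PseudoMetrizableSpace E] [SecondCountableTopology E]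
    [MeasurableSpace E] [BorelSpace E] {f : α → E → ℝ}
    (hm : ∀ ξ, AEMeasurable (fun x => f x ξ) μ) (hc : ∀ᵐ x ∂μ, Continuous (f x))
    {g : α → E} (hg : AEMeasurable g μ) : AEMeasurable (fun x => f x (g x)) μ := by
  have hg' : StronglyMeasurable (hg.mk g) := hg.measurable_mk.stronglyMeasurable
  -- Along a simple function the composition is a finite sum of sections `f · c` restricted to level
  -- sets. Continuity in the second variable carries measurability to the limit.
  have hs : ∀ s : SimpleFunc α E, AEMeasurable (fun x => f x (s x)) μ := by
    intro s
    have : (fun x => f x (s x)) =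
        fun x => ∑ c ∈ s.range, (s ⁻¹' {c}).indicator (fun x => f x c) x := by
      ext x
      rw [Finset.sum_eq_single (s x)]
      · simp
      · intro c _ hc
        simp [indicator, hc.symm]
      · intro h
        exact absurd (s.mem_range_self x) h
    rw [this]
    exact Finset.aemeasurable_fun_sum _ fun c _ => (hm c).indicator (s.measurableSet_fiber c)
  refine aemeasurable_of_tendsto_metrizable_ae atTop (fun k => hs (hg'.approx k)) ?_
  filter_upwards [hc, hg.ae_eq_mk] with x hx hgx
  rw [hgx]
  exact (hx.tendsto _).comp (hg'.tendsto_approx x)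

/-- Dominated convergence with a majorant of the form `a + bₖ`, where `bₖ → 0`. -/
theorem tendsto_lintegral_of_le_add {α : Type*} [MeasurableSpace α] {μ : Measure α}
    {f b : ℕ → α → ℝ≥0∞} {g a : α → ℝ≥0∞}
    (hf : ∀ k, AEMeasurable (f k) μ) (hb : ∀ k, AEMeasurable (b k) μ)
    (hle : ∀ k, ∀ᵐ x ∂μ, f k x ≤ a x + b k x) (ha : ∫⁻ x, a x ∂μ ≠ ⊤)
    (hlim : ∀ᵐ x ∂μ, Tendsto (fun k => f k x) atTop (𝓝 (g x)))
    (hb0 : ∀ᵐ x ∂μ, Tendsto (fun k => b k x) atTop (𝓝 0))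
    (hbi : Tendsto (fun k => ∫⁻ x, b k x ∂μ) atTop (𝓝 0)) :
    limsup (fun k => ∫⁻ x, f k x ∂μ) atTop ≤ ∫⁻ x, g x ∂μ := by
  -- The truncated differences `f k - b k` have the fixed majorant `a`, so ordinary dominated
  -- convergence applies to them; adding `b k` back costs an integral that tends to zero.
  have h1 : Tendsto (fun k => ∫⁻ x, (f k x - b k x) ∂μ) atTop (𝓝 (∫⁻ x, g x ∂μ)) := by
    refine tendsto_lintegral_of_dominated_convergence' a (fun k => (hf k).sub (hb k))
      (fun k => ?_) ha ?_
    · filter_upwards [hle k] with x hx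
      exact tsub_le_iff_right.2 hx
    · filter_upwards [hlim, hb0] with x h1 h2
      have := ENNReal.Tendsto.sub h1 h2 (Or.inr ENNReal.zero_ne_top)
      simpa using this
  have h2 := h1.add hbi
  rw [add_zero] at h2
  rw [← h2.limsup_eq]
  refine limsup_le_limsup (Eventually.of_forall fun k => ?_)
  dsimp only
  rw [← lintegral_add_right' _ (hb k)]
  exact lintegral_mono fun x => le_tsub_add

/-- Choosing the integrals at most 2⁻ᵏ makes the sum of the series integrable, hence finite almost
everywhere, and the terms of a convergent series tend to zero. -/
theorem exists_subseq_ae_tendsto_zero {α : Type*} [MeasurableSpace α] {μ : Measure α}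
    {b : ℕ → α → ℝ≥0∞} (hb : ∀ k, AEMeasurable (b k) μ)
    (hbi : Tendsto (fun k => ∫⁻ x, b k x ∂μ) atTop (𝓝 0)) :
    ∃ σ : ℕ → ℕ, StrictMono σ ∧ ∀ᵐ x ∂μ, Tendsto (fun k => b (σ k) x) atTop (𝓝 0) := by
  have hex : ∀ k : ℕ, ∀ᶠ j in atTop, ∫⁻ x, b j x ∂μ ≤ 2⁻¹ ^ k := by
    intro k
    exact (hbi.eventually_lt_const (ENNReal.pow_pos (by simp) k)).mono fun _ h => le_of_lt h
  obtain ⟨σ, hσ, hσb⟩ := extraction_forall_of_eventually hex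
  refine ⟨σ, hσ, ?_⟩
  have hsum : ∫⁻ x, ∑' k, b (σ k) x ∂μ ≠ ⊤ := by
    rw [lintegral_tsum fun k => hb _]
    refine ne_top_of_le_ne_top ?_ (ENNReal.tsum_le_tsum hσb)
    rw [ENNReal.tsum_geometric, ENNReal.one_sub_inv_two, inv_inv]
    exact ENNReal.ofNat_ne_top
  have := ae_lt_top' (AEMeasurable.tsum fun k => hb (σ k)) hsum
  filter_upwards [this] with x hx
  exact ENNReal.tendsto_atTop_zero_of_tsum_ne_top hx.ne

/-! ### Young functions -/

/-- Finite, even, convex functions vanishing at the origin. -/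
structure IsYoung {E : Type*} [NormedAddCommGroup E] [NormedSpace ℝ E] (f : E → ℝ) : Prop where
  nonneg : ∀ ξ, 0 ≤ f ξ
  continuous : Continuous f
  zero : f 0 = 0
  convex : ConvexOn ℝ univ f
  even : ∀ ξ, f (-ξ) = f ξ

namespace IsYoung

variable {E : Type*} [NormedAddCommGroup E] [NormedSpace ℝ E] {f : E → ℝ}

theorem smul_le (hf : IsYoung f) {t : ℝ} (h0 : 0 ≤ t) (h1 : t ≤ 1) (ξ : E) :
    f (t • ξ) ≤ t * f ξ := by
  have := hf.convex.2 (mem_univ ξ) (mem_univ 0) h0 (sub_nonneg.2 h1) (by ring)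
  simpa [hf.zero] using this

theorem smul_mono (hf : IsYoung f) {s t : ℝ} (hs : |s| ≤ t) (ξ : E) :
    f (s • ξ) ≤ f (t • ξ) := by
  have habs : f (s • ξ) = f (|s| • ξ) := by
    rcases abs_choice s with h | h <;> rw [h]
    rw [neg_smul, hf.even]
  rw [habs]
  rcases (abs_nonneg s).trans hs |>.eq_or_lt with h | h
  · have : |s| = t := le_antisymm hs (h ▸ abs_nonneg s)
    rw [this]
  · have h2 := hf.smul_le (t := |s| / t) (by positivity) ((div_le_one h).2 hs) (t • ξ)
    rw [smul_smul, div_mul_cancel₀ _ h.ne'] at h2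
    refine h2.trans (mul_le_of_le_one_left (hf.nonneg _) ((div_le_one h).2 hs))

theorem add_le (hf : IsYoung f) (a b : E) :
    f (a + b) ≤ f ((2 : ℝ) • a) / 2 + f ((2 : ℝ) • b) / 2 := by
  have := hf.convex.2 (mem_univ ((2 : ℝ) • a)) (mem_univ ((2 : ℝ) • b))
    (by norm_num : (0 : ℝ) ≤ 1 / 2) (by norm_num : (0 : ℝ) ≤ 1 / 2) (by norm_num)
  simp only [smul_smul, smul_eq_mul] at this
  norm_num at this
  linarith

theorem add_le' (hf : IsYoung f) (a b : E) :
    f (a + b) ≤ f ((2 : ℝ) • a) + f ((2 : ℝ) • b) := by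
  have := hf.add_le a b
  linarith [hf.nonneg ((2 : ℝ) • a), hf.nonneg ((2 : ℝ) • b)]

theorem ofReal_add_le (hf : IsYoung f) (a b : E) :
    ENNReal.ofReal (f (a + b)) ≤
      ENNReal.ofReal (f ((2 : ℝ) • a)) + ENNReal.ofReal (f ((2 : ℝ) • b)) := by
  rw [← ENNReal.ofReal_add (hf.nonneg _) (hf.nonneg _)]
  exact ENNReal.ofReal_le_ofReal (hf.add_le' a b)

end IsYoung

section

variable {n ℓ : ℕ} {Ω : Set (Eucl n)} {M : Eucl n → Eucl ℓ → ℝ}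

theorem IsWeakNFunction.ae_isYoung (hΩ : IsOpen Ω) (hM : IsWeakNFunction Ω M) :
    ∀ᵐ x ∂(volume.restrict Ω), IsYoung (M x) := by
  filter_upwards [hM.continuous, hM.zero, hM.convex, hM.even,
    ae_restrict_mem hΩ.measurableSet] with x h1 h2 h3 h4 h5
  exact ⟨hM.nonneg x h5, h1, h2, h3, h4⟩

theorem IsWeakNFunction.aemeasurable_comp (hM : IsWeakNFunction Ω M) {G : Eucl n → Eucl ℓ}
    (hG : AEStronglyMeasurable G (volume.restrict Ω)) :
    AEMeasurable (fun x => ENNReal.ofReal (M x (G x))) (volume.restrict Ω) :=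
  (aemeasurable_caratheodory hM.measurable hM.continuous hG.aemeasurable).ennreal_ofReal

/-- A weak `N`-function is bounded on bounded sets. -/
theorem IsWeakNFunction.exists_bound (hΩ : IsOpen Ω) (hM : IsWeakNFunction Ω M) (R : ℝ) :
    ∃ K : ℝ, 0 ≤ K ∧ ∀ᵐ x ∂(volume.restrict Ω), ∀ ξ, ‖ξ‖ ≤ R → M x ξ ≤ K := by
  obtain ⟨m₁, m₂, -, -, -, -, h2, hb⟩ := hM.bounds
  refine ⟨max (m₂ (max R 0)) 0, le_max_right _ _, ?_⟩
  filter_upwards [hb, hM.ae_isYoung hΩ] with x hx hy ξ hξ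
  rcases eq_or_ne ξ 0 with rfl | h0
  · rw [hy.zero]
    exact le_max_right _ _
  · have hp : 0 < ‖ξ‖ := norm_pos_iff.2 h0
    -- The majorant `m₂` need not be monotone, so it is evaluated only at radius `R`: the vector is
    -- first stretched to norm exactly `R`, which can only increase `M x`.
    have e : ξ = (1 : ℝ) • ξ := (one_smul _ _).symm
    rw [e]
    have hR : 0 < R := hp.trans_le hξ
    refine (hy.smul_mono (t := R / ‖ξ‖) ?_ ξ).trans ?_
    · rw [abs_one]
      exact (one_le_div hp).2 hξ
    · refine ((hx _).2.trans_eq ?_).trans (le_max_left _ _)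
      rw [norm_smul, Real.norm_of_nonneg (by positivity), div_mul_cancel₀ _ hp.ne',
        max_eq_left hR.le]

/-- A weak `N`-function that tends to zero along a sequence forces the sequence to zero. -/
theorem IsWeakNFunction.ae_tendsto_zero (hM : IsWeakNFunction Ω M) :
    ∀ᵐ x ∂(volume.restrict Ω), ∀ ξ : ℕ → Eucl ℓ,
      Tendsto (fun k => ENNReal.ofReal (M x (ξ k))) atTop (𝓝 0) →
        Tendsto ξ atTop (𝓝 0) := by
  obtain ⟨m₁, m₂, hc, -, h0, hpos, -, hb⟩ := hM.bounds
  filter_upwards [hb] with x hx ξ hξ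
  rw [Metric.tendsto_atTop]
  intro ε hε
  have hev := hξ.eventually_lt_const (ENNReal.ofReal_pos.2 (hpos ε hε))
  obtain ⟨k₀, hk₀⟩ := eventually_atTop.1 hev
  refine ⟨k₀, fun k hk => ?_⟩
  rw [dist_zero_right]
  by_contra! hcon
  have h1 := (ENNReal.ofReal_lt_ofReal_iff (hpos ε hε)).1 (hk₀ k hk)
  have h2 := (hx (ξ k)).1
  have hp : 0 < ‖ξ k‖ := hε.trans_le hcon
  -- Monotonicity of `m₁` is extracted from convexity and `m₁ 0 = 0`: m₁(ε) ≤ (ε/‖ξ‖) m₁(‖ξ‖).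
  have h3 := hc.2 (mem_Ici.2 hp.le) (mem_Ici.2 le_rfl) (show 0 ≤ ε / ‖ξ k‖ by positivity)
    (sub_nonneg.2 ((div_le_one hp).2 hcon)) (by ring)
  simp only [smul_eq_mul, h0, mul_zero, add_zero, div_mul_cancel₀ _ hp.ne'] at h3
  have h4 : ε / ‖ξ k‖ * m₁ ‖ξ k‖ ≤ m₁ ‖ξ k‖ :=
    mul_le_of_le_one_left (hpos _ hp).le ((div_le_one hp).2 hcon)
  linarith

end

/-! ### Functions all of whose multiples have finite modular -/

section

variable {n : ℕ} {Ω : Set (Eucl n)} {M : Eucl n → Eucl n → ℝ}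

/-- Measurable fields `G` with `∫_Ω M(x, λ G) dx < ∞` for all `λ`. -/
def FiniteModulars (Ω : Set (Eucl n)) (M : Eucl n → Eucl n → ℝ) (G : Eucl n → Eucl n) : Prop :=
  AEStronglyMeasurable G (volume.restrict Ω) ∧
    ∀ c : ℝ, ∫⁻ x in Ω, ENNReal.ofReal (M x (c • G x)) ≠ ⊤

/-- Midpoint convexity. This replaces the triangle inequality throughout: each splitting doubles the
multiple of the field, which is harmless when all multiples are controlled. -/
theorem lintegral_modular_add_le (hΩ : IsOpen Ω) (hM : IsWeakNFunction Ω M)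
    {G H : Eucl n → Eucl n} (hG : AEStronglyMeasurable G (volume.restrict Ω)) :
    ∫⁻ x in Ω, ENNReal.ofReal (M x (G x + H x)) ≤
      (∫⁻ x in Ω, ENNReal.ofReal (M x ((2 : ℝ) • G x))) +
        ∫⁻ x in Ω, ENNReal.ofReal (M x ((2 : ℝ) • H x)) := by
  have h2 : AEMeasurable (fun x => ENNReal.ofReal (M x ((2 : ℝ) • G x))) (volume.restrict Ω) :=
    hM.aemeasurable_comp (hG.const_smul (2 : ℝ))
  rw [← lintegral_add_left' h2]
  refine lintegral_mono_ae ?_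
  filter_upwards [hM.ae_isYoung hΩ] with x hx
  exact hx.ofReal_add_le _ _

theorem FiniteModulars.add (hΩ : IsOpen Ω) (hM : IsWeakNFunction Ω M) {G H : Eucl n → Eucl n}
    (hG : FiniteModulars Ω M G) (hH : FiniteModulars Ω M H) :
    FiniteModulars Ω M (fun x => G x + H x) := by
  refine ⟨hG.1.add hH.1, fun c => ?_⟩
  have := lintegral_modular_add_le hΩ hM (G := fun x => c • G x) (H := fun x => c • H x)
    (hG.1.const_smul c)
  simp only [smul_smul] at this
  refine ne_top_of_le_ne_top (ENNReal.add_ne_top.2 ⟨hG.2 (2 * c), hH.2 (2 * c)⟩) ?_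
  simpa only [smul_add] using this

theorem FiniteModulars.of_bounded (hΩ : IsOpen Ω) (hb : Bornology.IsBounded Ω)
    (hM : IsWeakNFunction Ω M) {G : Eucl n → Eucl n}
    (hG : AEStronglyMeasurable G (volume.restrict Ω)) {C : ℝ}
    (hC : ∀ᵐ x ∂(volume.restrict Ω), ‖G x‖ ≤ C) : FiniteModulars Ω M G := by
  refine ⟨hG, fun c => ?_⟩
  obtain ⟨K, -, hK⟩ := hM.exists_bound hΩ (|c| * C)
  refine ne_top_of_le_ne_top (b := ∫⁻ x in Ω, ENNReal.ofReal K) ?_ (lintegral_mono_ae ?_)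
  · rw [lintegral_const, Measure.restrict_apply_univ]
    exact ENNReal.mul_ne_top ENNReal.ofReal_ne_top hb.measure_lt_top.ne
  · filter_upwards [hK, hC] with x h1 h2
    refine ENNReal.ofReal_le_ofReal (h1 _ ?_)
    rw [norm_smul, Real.norm_eq_abs]
    gcongr

/-- Multiplication by a bounded function. -/
theorem FiniteModulars.bdd_smul (hΩ : IsOpen Ω) (hM : IsWeakNFunction Ω M) {G : Eucl n → Eucl n}
    (hG : FiniteModulars Ω M G) {ζ : Eucl n → ℝ}
    (hζ : AEStronglyMeasurable ζ (volume.restrict Ω)) {C : ℝ} (hC : ∀ x, |ζ x| ≤ C) :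
    FiniteModulars Ω M (fun x => ζ x • G x) := by
  refine ⟨hζ.smul hG.1, fun c => ?_⟩
  refine ne_top_of_le_ne_top (hG.2 (|c| * C)) (lintegral_mono_ae ?_)
  filter_upwards [hM.ae_isYoung hΩ] with x hx
  refine ENNReal.ofReal_le_ofReal ?_
  rw [smul_smul]
  refine hx.smul_mono ?_ _
  rw [abs_mul]
  exact mul_le_mul_of_nonneg_left (hC x) (abs_nonneg c)

/-- A bounded field close to `G` in norm leaves a remainder whose dilation by `2 * c` still has
modular at most one, and the bounded part has finite modulars because Ω has finite measure. Being in
the closure of the bounded fields thus does the work of a doubling condition. -/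
theorem MemEM.finiteModulars (hΩ : IsOpen Ω) (hb : Bornology.IsBounded Ω)
    (hM : IsWeakNFunction Ω M) {G : Eucl n → Eucl n} (hG : MemEM Ω M G) :
    FiniteModulars Ω M G := by
  refine ⟨hG.1, fun c => ?_⟩
  obtain ⟨η, hη, ⟨C, hC⟩, hlt⟩ := hG.2 (ENNReal.ofReal (2 * (|c| + 1))⁻¹)
    (ENNReal.ofReal_pos.2 (by positivity))
  simp only [luxemburgNorm, iInf_lt_iff] at hlt
  obtain ⟨d, hd, hmod, hdlt⟩ := hlt
  have hdlt' := (ENNReal.ofReal_lt_ofReal_iff (by positivity)).1 hdlt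
  have key := lintegral_modular_add_le hΩ hM (G := fun x => c • (G x - η x))
    (H := fun x => c • η x) ((hG.1.sub hη).const_smul c)
  have e : ∀ x, c • (G x - η x) + c • η x = c • G x := fun x => by
    rw [← smul_add, sub_add_cancel]
  simp only [e] at key
  refine ne_top_of_le_ne_top (ENNReal.add_ne_top.2 ⟨?_, ?_⟩) key
  · refine ne_top_of_le_ne_top ENNReal.one_ne_top (le_trans (lintegral_mono_ae ?_) hmod)
    filter_upwards [hM.ae_isYoung hΩ] with x hx
    refine ENNReal.ofReal_le_ofReal ?_
    rw [smul_smul]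
    refine hx.smul_mono ?_ _
    rw [abs_mul, abs_two]
    have h3 : 2 * (|c| + 1) < d⁻¹ := by
      rw [lt_inv_comm₀ (by positivity) hd]
      exact hdlt'
    linarith
  · have := (FiniteModulars.of_bounded hΩ hb hM hη hC).2 (2 * c)
    simpa only [smul_smul] using this

theorem MemEM.of_bounded (hM : IsWeakNFunction Ω M) {G : Eucl n → Eucl n}
    (hG : AEStronglyMeasurable G (volume.restrict Ω)) {C : ℝ}
    (hC : ∀ᵐ x ∂(volume.restrict Ω), ‖G x‖ ≤ C) : MemEM Ω M G := by
  refine ⟨hG, fun ε hε => ⟨G, hG, ⟨C, hC⟩, ?_⟩⟩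
  obtain ⟨d, hd0, hd⟩ := ENNReal.lt_iff_exists_nnreal_btwn.1 hε
  simp only [luxemburgNorm, iInf_lt_iff]
  refine ⟨d, by exact_mod_cast hd0, ?_, by simpa using hd⟩
  have : modular Ω M (fun x => (d : ℝ)⁻¹ • (G x - G x)) = ∫⁻ x in Ω, 0 := by
    refine lintegral_congr_ae ?_
    filter_upwards [hM.zero] with x hx
    simp [hx]
  rw [this]
  simp

end

end Lavrentiev

namespace Lavrentiev

open Filter

variable {n : ℕ} {Ω : Set (Eucl n)}

/-! ### Test functions and weak gradients -/

theorem gradient_eq_toDual_symm (φ : Eucl n → ℝ) :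
    gradient φ = fun x => (InnerProductSpace.toDual ℝ (Eucl n)).symm (fderiv ℝ φ x) := rfl

theorem norm_gradient (φ : Eucl n → ℝ) (x : Eucl n) : ‖gradient φ x‖ = ‖fderiv ℝ φ x‖ := by
  rw [gradient_eq_toDual_symm, LinearIsometryEquiv.norm_map]

theorem gradient_add' {φ ψ : Eucl n → ℝ} {x : Eucl n} (hφ : DifferentiableAt ℝ φ x)
    (hψ : DifferentiableAt ℝ ψ x) :
    gradient (fun y => φ y + ψ y) x = gradient φ x + gradient ψ x := by
  simp only [gradient_eq_toDual_symm]
  rw [fderiv_fun_add hφ hψ, map_add]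

theorem gradient_mul' {φ ψ : Eucl n → ℝ} {x : Eucl n} (hφ : DifferentiableAt ℝ φ x)
    (hψ : DifferentiableAt ℝ ψ x) :
    gradient (fun y => φ y * ψ y) x = φ x • gradient ψ x + ψ x • gradient φ x := by
  simp only [gradient_eq_toDual_symm]
  rw [fderiv_fun_mul hφ hψ, map_add, LinearIsometryEquiv.map_smul, LinearIsometryEquiv.map_smul]

theorem IsTestFunction.mono {U V : Set (Eucl n)} {φ : Eucl n → ℝ} (h : IsTestFunction U φ)
    (hUV : U ⊆ V) : IsTestFunction V φ := ⟨h.1, h.2.1, h.2.2.trans hUV⟩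

namespace IsTestFunction

variable {φ ψ : Eucl n → ℝ}

theorem differentiable (h : IsTestFunction Ω φ) : Differentiable ℝ φ :=
  h.1.differentiable (by simp)

theorem continuous_gradient (h : IsTestFunction Ω φ) : Continuous (gradient φ) := by
  rw [gradient_eq_toDual_symm]
  exact (LinearIsometryEquiv.continuous _).comp (h.1.continuous_fderiv (by simp))

theorem tsupport_gradient_subset (φ : Eucl n → ℝ) : tsupport (gradient φ) ⊆ tsupport φ := by
  refine closure_minimal (fun x hx => ?_) (isClosed_tsupport φ)
  refine support_fderiv_subset ℝ (f := φ) ?_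
  rw [Function.mem_support] at hx ⊢
  intro h
  exact hx (by simp [gradient_eq_toDual_symm, h])

theorem hasCompactSupport_gradient (h : IsTestFunction Ω φ) : HasCompactSupport (gradient φ) :=
  h.2.1.of_isClosed_subset (isClosed_tsupport _) (tsupport_gradient_subset φ)

theorem exists_bound (h : IsTestFunction Ω φ) : ∃ C, ∀ x, ‖φ x‖ ≤ C :=
  h.2.1.exists_bound_of_continuous h.1.continuous

theorem exists_bound_gradient (h : IsTestFunction Ω φ) : ∃ C, ∀ x, ‖gradient φ x‖ ≤ C :=
  h.hasCompactSupport_gradient.exists_bound_of_continuous h.continuous_gradient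

theorem integrable (h : IsTestFunction Ω φ) : Integrable φ :=
  h.1.continuous.integrable_of_hasCompactSupport h.2.1

theorem integrable_gradient (h : IsTestFunction Ω φ) : Integrable (gradient φ) :=
  h.continuous_gradient.integrable_of_hasCompactSupport h.hasCompactSupport_gradient

theorem eq_zero (h : IsTestFunction Ω φ) {x : Eucl n} (hx : x ∉ Ω) : φ x = 0 :=
  image_eq_zero_of_notMem_tsupport fun h' => hx (h.2.2 h')

theorem gradient_eq_zero (h : IsTestFunction Ω φ) {x : Eucl n} (hx : x ∉ Ω) :
    gradient φ x = 0 :=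
  image_eq_zero_of_notMem_tsupport fun h' => hx (h.2.2 (tsupport_gradient_subset φ h'))

theorem add (h : IsTestFunction Ω φ) (h' : IsTestFunction Ω ψ) :
    IsTestFunction Ω (fun x => φ x + ψ x) :=
  ⟨h.1.add h'.1, h.2.1.add h'.2.1,
    (tsupport_add φ ψ).trans (union_subset h.2.2 h'.2.2)⟩

theorem mul (h : IsTestFunction Ω φ) (h' : IsTestFunction univ ψ) :
    IsTestFunction Ω (fun x => φ x * ψ x) :=
  ⟨h.1.mul h'.1, h.2.1.mul_right, (tsupport_mul_subset_left (f := φ) (g := ψ)).trans h.2.2⟩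

end IsTestFunction

theorem integrableOn_smul_of_bound {E : Type*} [NormedAddCommGroup E] [NormedSpace ℝ E]
    {f : Eucl n → ℝ} {K : Eucl n → E} {S : Set (Eucl n)}
    (hK : IntegrableOn K S) (hf : Continuous f) (hb : ∃ C, ∀ x, ‖f x‖ ≤ C) :
    IntegrableOn (fun x => f x • K x) S := by
  obtain ⟨C, hC⟩ := hb
  exact Integrable.bdd_smul hK C hf.aestronglyMeasurable (Filter.Eventually.of_forall hC)

theorem integrableOn_smul_of_bound' {E : Type*} [NormedAddCommGroup E] [NormedSpace ℝ E]
    {f : Eucl n → ℝ} {K : Eucl n → E} {S : Set (Eucl n)}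
    (hf : IntegrableOn f S) (hK : Continuous K) (hb : ∃ C, ∀ x, ‖K x‖ ≤ C) :
    IntegrableOn (fun x => f x • K x) S := by
  obtain ⟨C, hC⟩ := hb
  exact Integrable.smul_bdd hf C hK.aestronglyMeasurable (Filter.Eventually.of_forall hC)

/-- Integration by parts for test functions. -/
theorem IsTestFunction.integral_smul_gradient {U V : Set (Eucl n)} {φ ψ : Eucl n → ℝ}
    (hφ : IsTestFunction U φ) (hψ : IsTestFunction V ψ) :
    ∫ x, φ x • gradient ψ x = -∫ x, ψ x • gradient φ x := by
  have i1 : Integrable fun x => φ x • gradient ψ x := by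
    simpa using integrableOn_smul_of_bound (S := univ)
      hψ.integrable_gradient.integrableOn hφ.1.continuous hφ.exists_bound
  have i2 : Integrable fun x => ψ x • gradient φ x := by
    simpa using integrableOn_smul_of_bound (S := univ)
      hφ.integrable_gradient.integrableOn hψ.1.continuous hψ.exists_bound
  have i3 : Integrable fun x => φ x * ψ x := by
    simpa using integrableOn_smul_of_bound (S := univ)
      hψ.integrable.integrableOn hφ.1.continuous hφ.exists_bound
  refine ext_inner_left ℝ fun v => ?_
  rw [inner_neg_right, ← integral_inner i1, ← integral_inner i2]
  have e1 : ∀ x, inner ℝ v (φ x • gradient ψ x) = φ x * fderiv ℝ ψ x v := fun x => by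
    rw [inner_smul_right, inner_gradient_right]; simp
  have e2 : ∀ x, inner ℝ v (ψ x • gradient φ x) = fderiv ℝ φ x v * ψ x := fun x => by
    rw [inner_smul_right, inner_gradient_right]; simp [mul_comm]
  have j1 := i1.const_inner (𝕜 := ℝ) v
  have j2 := i2.const_inner (𝕜 := ℝ) v
  simp only [e1, e2] at j1 j2 ⊢
  exact integral_mul_fderiv_eq_neg_fderiv_mul_of_integrable j2 j1 i3
    (fun x _ => hφ.differentiable x) (fun x _ => hψ.differentiable x)

/-- `G` is the distributional gradient on `ℝⁿ` of the extension of `v` by zero outside `Ω`. -/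
def HasZeroExtGradient (Ω : Set (Eucl n)) (v : Eucl n → ℝ) (G : Eucl n → Eucl n) : Prop :=
  IntegrableOn v Ω ∧ IntegrableOn G Ω ∧ ∀ ψ : Eucl n → ℝ, IsTestFunction univ ψ →
    (∫ x in Ω, v x • gradient ψ x) = -(∫ x in Ω, ψ x • G x)

theorem HasZeroExtGradient.hasWeakGradient {v : Eucl n → ℝ} {G : Eucl n → Eucl n}
    (h : HasZeroExtGradient Ω v G) : HasWeakGradient Ω v G :=
  ⟨h.2.1, fun φ hφ => h.2.2 φ (hφ.mono (subset_univ _))⟩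

theorem IsTestFunction.hasZeroExtGradient {φ : Eucl n → ℝ} (hφ : IsTestFunction Ω φ) :
    HasZeroExtGradient Ω φ (gradient φ) := by
  refine ⟨hφ.integrable.integrableOn, hφ.integrable_gradient.integrableOn, fun ψ hψ => ?_⟩
  rw [setIntegral_eq_integral_of_forall_compl_eq_zero,
    setIntegral_eq_integral_of_forall_compl_eq_zero]
  · exact hφ.integral_smul_gradient hψ
  · intro x hx
    rw [hφ.gradient_eq_zero hx, smul_zero]
  · intro x hx
    rw [hφ.eq_zero hx, zero_smul]

theorem HasWeakGradient.weakGradient_ae_eq (hΩ : IsOpen Ω) {u : Eucl n → ℝ} {G : Eucl n → Eucl n}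
    (h : HasWeakGradient Ω u G) : weakGradient Ω u =ᵐ[volume.restrict Ω] G := by
  have hex : ∃ G, HasWeakGradient Ω u G := ⟨G, h⟩
  rw [weakGradient, dif_pos hex]
  exact hex.choose_spec.ae_eq hΩ h

theorem MemW11.hasWeakGradient {u : Eucl n → ℝ} (h : MemW11 Ω u) :
    HasWeakGradient Ω u (weakGradient Ω u) := by
  rw [weakGradient, dif_pos h.2]
  exact h.2.choose_spec

theorem HasWeakGradient.add {u v : Eucl n → ℝ} {G H : Eucl n → Eucl n}
    (hu : IntegrableOn u Ω) (hv : IntegrableOn v Ω)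
    (h : HasWeakGradient Ω u G) (h' : HasWeakGradient Ω v H) :
    HasWeakGradient Ω (u + v) (fun x => G x + H x) := by
  refine ⟨h.1.add h'.1, fun φ hφ => ?_⟩
  simp only [Pi.add_apply, add_smul, smul_add]
  rw [integral_add, integral_add, h.2 φ hφ, h'.2 φ hφ, neg_add]
  · exact integrableOn_smul_of_bound h.1 hφ.1.continuous hφ.exists_bound
  · exact integrableOn_smul_of_bound h'.1 hφ.1.continuous hφ.exists_bound
  · exact integrableOn_smul_of_bound' hu hφ.continuous_gradient hφ.exists_bound_gradient
  · exact integrableOn_smul_of_bound' hv hφ.continuous_gradient hφ.exists_bound_gradient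

/-- `v` is a limit of test functions in `W^{1,1}(Ω)`, with gradient `G`. -/
def HasZeroTraceGradient (Ω : Set (Eucl n)) (v : Eucl n → ℝ) (G : Eucl n → Eucl n) : Prop :=
  IntegrableOn v Ω ∧ IntegrableOn G Ω ∧ ∃ φ : ℕ → Eucl n → ℝ, (∀ k, IsTestFunction Ω (φ k)) ∧
    Tendsto (fun k => ∫⁻ x in Ω, ‖φ k x - v x‖ₑ) atTop (𝓝 0) ∧
    Tendsto (fun k => ∫⁻ x in Ω, ‖gradient (φ k) x - G x‖ₑ) atTop (𝓝 0)

theorem MemW110.hasZeroTraceGradient {v : Eucl n → ℝ} (h : MemW110 Ω v) :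
    HasZeroTraceGradient Ω v (weakGradient Ω v) := by
  refine ⟨h.1.1, h.1.hasWeakGradient.1, ?_⟩
  choose φ hφ hlt using fun k : ℕ => h.2 ((k : ℝ≥0∞) + 1)⁻¹ (by simp)
  have h0 : Tendsto (fun k : ℕ => ((k : ℝ≥0∞) + 1)⁻¹) atTop (𝓝 0) := by
    have := (tendsto_add_atTop_iff_nat 1).2 ENNReal.tendsto_inv_nat_nhds_zero
    simpa using this
  refine ⟨φ, hφ, ?_, ?_⟩
  · refine tendsto_of_tendsto_of_tendsto_of_le_of_le tendsto_const_nhds h0 (fun _ => zero_le)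
      fun k => ?_
    refine le_trans (le_trans (le_of_eq ?_) le_self_add) (hlt k).le
    exact lintegral_congr fun x => enorm_sub_rev _ _
  · refine tendsto_of_tendsto_of_tendsto_of_le_of_le tendsto_const_nhds h0 (fun _ => zero_le)
      fun k => ?_
    refine le_trans (le_trans (le_of_eq ?_) le_add_self) (hlt k).le
    exact lintegral_congr fun x => enorm_sub_rev _ _

theorem tendsto_setIntegral_of_tendsto_lintegral {E : Type*} [NormedAddCommGroup E]
    [NormedSpace ℝ E] [CompleteSpace E] {S : Set (Eucl n)} {f : ℕ → Eucl n → E} {g : Eucl n → E}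
    (hg : IntegrableOn g S) (hf : ∀ k, IntegrableOn (f k) S)
    (h : Tendsto (fun k => ∫⁻ x in S, ‖f k x - g x‖ₑ) atTop (𝓝 0)) :
    Tendsto (fun k => ∫ x in S, f k x) atTop (𝓝 (∫ x in S, g x)) :=
  tendsto_integral_of_L1 g hg.aestronglyMeasurable (Eventually.of_forall hf) h

/-- The approximating test functions vanish near the boundary, so integration by parts against any
smooth `ψ` on ℝⁿ has no boundary term, and both sides pass to the L¹ limit. -/
theorem HasZeroTraceGradient.hasZeroExtGradient {v : Eucl n → ℝ} {G : Eucl n → Eucl n}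
    (h : HasZeroTraceGradient Ω v G) : HasZeroExtGradient Ω v G := by
  obtain ⟨hv, hG, φ, hφ, h1, h2⟩ := h
  refine ⟨hv, hG, fun ψ hψ => ?_⟩
  obtain ⟨C, hC⟩ := hψ.exists_bound
  obtain ⟨D, hD⟩ := hψ.exists_bound_gradient
  have l1 : Tendsto (fun k => ∫ x in Ω, φ k x • gradient ψ x) atTop
      (𝓝 (∫ x in Ω, v x • gradient ψ x)) := by
    refine tendsto_setIntegral_of_tendsto_lintegral
      (integrableOn_smul_of_bound' hv hψ.continuous_gradient ⟨D, hD⟩)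
      (fun k => integrableOn_smul_of_bound' (hφ k).integrable.integrableOn
        hψ.continuous_gradient ⟨D, hD⟩) ?_
    have := ENNReal.Tendsto.mul_const (b := ENNReal.ofReal D) h1 (Or.inr ENNReal.ofReal_ne_top)
    rw [zero_mul] at this
    refine tendsto_of_tendsto_of_tendsto_of_le_of_le tendsto_const_nhds this (fun _ => zero_le)
      fun k => ?_
    dsimp only
    rw [← lintegral_mul_const' _ _ ENNReal.ofReal_ne_top]
    refine lintegral_mono fun x => ?_
    rw [← sub_smul, enorm_smul]
    gcongr
    rw [← ofReal_norm]
    exact ENNReal.ofReal_le_ofReal (hD x)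
  have l2 : Tendsto (fun k => ∫ x in Ω, ψ x • gradient (φ k) x) atTop
      (𝓝 (∫ x in Ω, ψ x • G x)) := by
    refine tendsto_setIntegral_of_tendsto_lintegral
      (integrableOn_smul_of_bound hG hψ.1.continuous ⟨C, hC⟩)
      (fun k => integrableOn_smul_of_bound (hφ k).integrable_gradient.integrableOn
        hψ.1.continuous ⟨C, hC⟩) ?_
    have := ENNReal.Tendsto.const_mul (a := ENNReal.ofReal C) h2 (Or.inr ENNReal.ofReal_ne_top)
    rw [mul_zero] at this
    refine tendsto_of_tendsto_of_tendsto_of_le_of_le tendsto_const_nhds this (fun _ => zero_le)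
      fun k => ?_
    dsimp only
    rw [← lintegral_const_mul' _ _ ENNReal.ofReal_ne_top]
    refine lintegral_mono fun x => ?_
    rw [← smul_sub, enorm_smul]
    gcongr
    rw [← ofReal_norm]
    exact ENNReal.ofReal_le_ofReal (hC x)
  refine tendsto_nhds_unique l1 ?_
  have : ∀ k, ∫ x in Ω, φ k x • gradient ψ x = -∫ x in Ω, ψ x • gradient (φ k) x :=
    fun k => (hφ k).hasZeroExtGradient.2.2 ψ hψ
  simp only [this]
  exact l2.neg

/-! ### Approximation by test functions -/

variable {M : Eucl n → Eucl n → ℝ}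

/-- `v` can be approximated by test functions, in `L¹` and with all modulars of the error of the
gradient tending to zero. -/
def ApproxByTest (Ω : Set (Eucl n)) (M : Eucl n → Eucl n → ℝ) (v : Eucl n → ℝ)
    (G : Eucl n → Eucl n) : Prop :=
  ∀ (c : ℝ) (ε : ℝ≥0∞), 0 < ε → ∃ φ : Eucl n → ℝ, IsTestFunction Ω φ ∧
    ∫⁻ x in Ω, ‖v x - φ x‖ₑ < ε ∧
    ∫⁻ x in Ω, ENNReal.ofReal (M x (c • (G x - gradient φ x))) < ε

/-- The approximable functions are closed under modular convergence. Both approximations are taken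
at the constant `2 * c` to pay for splitting the error. -/
theorem ApproxByTest.of_approx (hΩ : IsOpen Ω) (hM : IsWeakNFunction Ω M) {v : Eucl n → ℝ}
    {G : Eucl n → Eucl n} (hv : AEStronglyMeasurable v (volume.restrict Ω))
    (hG : AEStronglyMeasurable G (volume.restrict Ω))
    (h : ∀ (c : ℝ) (ε : ℝ≥0∞), 0 < ε → ∃ (w : Eucl n → ℝ) (H : Eucl n → Eucl n),
      AEStronglyMeasurable w (volume.restrict Ω) ∧ AEStronglyMeasurable H (volume.restrict Ω) ∧
      ApproxByTest Ω M w H ∧ ∫⁻ x in Ω, ‖v x - w x‖ₑ < ε ∧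
      ∫⁻ x in Ω, ENNReal.ofReal (M x (c • (G x - H x))) < ε) : ApproxByTest Ω M v G := by
  intro c ε hε
  have hε2 : 0 < ε / 2 := ENNReal.half_pos hε.ne'
  obtain ⟨w, H, hwm, hHm, hw, h1, h2⟩ := h (2 * c) (ε / 2) hε2
  obtain ⟨φ, hφ, h3, h4⟩ := hw (2 * c) (ε / 2) hε2
  refine ⟨φ, hφ, ?_, ?_⟩
  · rw [← ENNReal.add_halves ε]
    refine lt_of_le_of_lt ?_ (ENNReal.add_lt_add h1 h3)
    have hm : AEMeasurable (fun x => ‖v x - w x‖ₑ) (volume.restrict Ω) := (hv.sub hwm).enorm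
    rw [← lintegral_add_left' hm]
    refine lintegral_mono fun x => ?_
    have : v x - φ x = (v x - w x) + (w x - φ x) := by ring
    rw [this]
    exact enorm_add_le _ _
  · rw [← ENNReal.add_halves ε]
    refine lt_of_le_of_lt ?_ (ENNReal.add_lt_add h2 h4)
    have := lintegral_modular_add_le hΩ hM (G := fun x => c • (G x - H x))
      (H := fun x => c • (H x - gradient φ x)) ((hG.sub hHm).const_smul c)
    simp only [smul_smul, ← smul_add, sub_add_sub_cancel] at this
    exact this

theorem ApproxByTest.add (hΩ : IsOpen Ω) (hM : IsWeakNFunction Ω M) {v w : Eucl n → ℝ}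
    {G H : Eucl n → Eucl n} (hv : AEStronglyMeasurable v (volume.restrict Ω))
    (hG : AEStronglyMeasurable G (volume.restrict Ω))
    (h : ApproxByTest Ω M v G) (h' : ApproxByTest Ω M w H) :
    ApproxByTest Ω M (fun x => v x + w x) (fun x => G x + H x) := by
  intro c ε hε
  have hε2 : 0 < ε / 2 := ENNReal.half_pos hε.ne'
  obtain ⟨φ, hφ, h1, h2⟩ := h (2 * c) (ε / 2) hε2
  obtain ⟨ψ, hψ, h3, h4⟩ := h' (2 * c) (ε / 2) hε2
  refine ⟨_, hφ.add hψ, ?_, ?_⟩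
  · rw [← ENNReal.add_halves ε]
    refine lt_of_le_of_lt ?_ (ENNReal.add_lt_add h1 h3)
    have hm : AEMeasurable (fun x => ‖v x - φ x‖ₑ) (volume.restrict Ω) :=
      (hv.sub hφ.1.continuous.aestronglyMeasurable).enorm
    rw [← lintegral_add_left' hm]
    refine lintegral_mono fun x => ?_
    dsimp only
    rw [add_sub_add_comm]
    exact enorm_add_le _ _
  · rw [← ENNReal.add_halves ε]
    refine lt_of_le_of_lt ?_ (ENNReal.add_lt_add h2 h4)
    have := lintegral_modular_add_le hΩ hM (G := fun x => c • (G x - gradient φ x))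
      (H := fun x => c • (H x - gradient ψ x))
      ((hG.sub hφ.continuous_gradient.aestronglyMeasurable).const_smul c)
    simp only [smul_smul, ← smul_add, ← add_sub_add_comm] at this
    refine le_trans (le_of_eq (lintegral_congr fun x => ?_)) this
    rw [gradient_add' (hφ.differentiable x) (hψ.differentiable x)]

theorem approxByTest_zero (hM : IsWeakNFunction Ω M) :
    ApproxByTest Ω M (fun _ => 0) (fun _ => 0) := by
  intro c ε hε
  refine ⟨fun _ => 0, ⟨contDiff_const, HasCompactSupport.zero, ?_⟩, by simpa using hε, ?_⟩
  · have : tsupport (fun _ : Eucl n => (0 : ℝ)) = ∅ := tsupport_eq_empty_iff.2 rfl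
    rw [this]
    exact empty_subset _
  · rw [lintegral_congr_ae (g := fun _ => 0)]
    · simpa using hε
    · filter_upwards [hM.zero] with x hx
      simp [hx]

theorem ApproxByTest.sum {ι : Type*} (s : Finset ι) (hΩ : IsOpen Ω) (hM : IsWeakNFunction Ω M)
    {v : ι → Eucl n → ℝ} {G : ι → Eucl n → Eucl n}
    (hv : ∀ i ∈ s, AEStronglyMeasurable (v i) (volume.restrict Ω))
    (hG : ∀ i ∈ s, AEStronglyMeasurable (G i) (volume.restrict Ω))
    (h : ∀ i ∈ s, ApproxByTest Ω M (v i) (G i)) :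
    ApproxByTest Ω M (fun x => ∑ i ∈ s, v i x) (fun x => ∑ i ∈ s, G i x) := by
  classical
  induction s using Finset.induction_on with
  | empty => simpa using approxByTest_zero hM
  | insert i s hi ih =>
    simp only [Finset.sum_insert hi]
    refine ApproxByTest.add hΩ hM (hv i (by simp)) (hG i (by simp)) (h i (by simp)) (ih ?_ ?_ ?_)
    · exact fun j hj => hv j (by simp [hj])
    · exact fun j hj => hG j (by simp [hj])
    · exact fun j hj => h j (by simp [hj])

theorem ApproxByTest.congr {v w : Eucl n → ℝ} {G H : Eucl n → Eucl n}
    (h : ApproxByTest Ω M v G) (hvw : v =ᵐ[volume.restrict Ω] w)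
    (hGH : G =ᵐ[volume.restrict Ω] H) : ApproxByTest Ω M w H := by
  intro c ε hε
  obtain ⟨φ, hφ, h1, h2⟩ := h c ε hε
  refine ⟨φ, hφ, ?_, ?_⟩
  · rwa [lintegral_congr_ae (g := fun x => ‖v x - φ x‖ₑ)]
    filter_upwards [hvw] with x hx
    rw [hx]
  · rwa [lintegral_congr_ae (g := fun x => ENNReal.ofReal (M x (c • (G x - gradient φ x))))]
    filter_upwards [hGH] with x hx
    rw [hx]

/-- The energy of `u₀ + v` is approximated along test functions approximating `v`. -/
theorem iInf_energy_le (hΩ : IsOpen Ω) (hb : Bornology.IsBounded Ω) (hM : IsWeakNFunction Ω M)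
    {F : Eucl n → ℝ → Eucl n → ℝ}
    (hFmeas : ∀ (z : ℝ) (ξ : Eucl n), AEMeasurable (fun x => F x z ξ) (volume.restrict Ω))
    (hFcont : ∀ x ∈ Ω, Continuous fun p : ℝ × Eucl n => F x p.1 p.2) {L : ℝ} (hL : 0 ≤ L)
    (hF : ∀ x ∈ Ω, ∀ (z : ℝ) (ξ : Eucl n), F x z ξ ≤ L * (M x ξ + 1)) {u v : Eucl n → ℝ}
    (hu : MemW11 Ω u) (hv : MemW11 Ω v) (hGu : FiniteModulars Ω M (weakGradient Ω u))
    (hGv : FiniteModulars Ω M (weakGradient Ω v))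
    (happ : ApproxByTest Ω M v (weakGradient Ω v)) :
    (⨅ (φ : Eucl n → ℝ) (_ : IsTestFunction Ω φ), energy Ω F (u + φ)) ≤ energy Ω F (u + v) := by
  set Gu := weakGradient Ω u with hGu_def
  set Gv := weakGradient Ω v with hGv_def
  -- The constant 2 is what the splitting ∇u + ∇φₖ = (∇u + ∇v) - (∇v - ∇φₖ) requires in the majorant
  -- below.
  choose φ hφ h1 h2 using fun k : ℕ => happ 2 ((k : ℝ≥0∞) + 1)⁻¹ (by simp)
  have h0 : Tendsto (fun k : ℕ => ((k : ℝ≥0∞) + 1)⁻¹) atTop (𝓝 0) := by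
    have := (tendsto_add_atTop_iff_nat 1).2 ENNReal.tendsto_inv_nat_nhds_zero
    simpa using this
  have hsmall : ∀ {c : ℕ → ℝ≥0∞}, (∀ k, c k < ((k : ℝ≥0∞) + 1)⁻¹) → Tendsto c atTop (𝓝 0) :=
    fun h => tendsto_of_tendsto_of_tendsto_of_le_of_le tendsto_const_nhds h0
      (fun _ => zero_le) fun k => (h k).le
  set b : ℕ → Eucl n → ℝ≥0∞ := fun k x =>
    ENNReal.ofReal (M x ((2 : ℝ) • (Gv x - gradient (φ k) x))) with hb_def
  have hbm : ∀ k, AEMeasurable (b k) (volume.restrict Ω) := fun k =>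
    hM.aemeasurable_comp ((hGv.1.sub
      (hφ k).continuous_gradient.aestronglyMeasurable).const_smul (2 : ℝ))
  have hdm : ∀ k, AEMeasurable (fun x => ‖v x - φ k x‖ₑ) (volume.restrict Ω) := fun k =>
    (hv.1.aestronglyMeasurable.sub (hφ k).1.continuous.aestronglyMeasurable).enorm
  have hsum : Tendsto (fun k => ∫⁻ x in Ω, (‖v x - φ k x‖ₑ + b k x)) atTop (𝓝 0) := by
    have := (hsmall h1).add (hsmall h2)
    rw [add_zero] at this
    refine this.congr fun k => ?_
    rw [lintegral_add_left' (hdm k)]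
  obtain ⟨σ, hσ, hae⟩ := exists_subseq_ae_tendsto_zero
    (b := fun k x => ‖v x - φ k x‖ₑ + b k x) (fun k => (hdm k).add (hbm k)) hsum
  have hwg : ∀ k, weakGradient Ω (u + φ k) =ᵐ[volume.restrict Ω]
      fun x => Gu x + gradient (φ k) x := fun k =>
    (hu.hasWeakGradient.add hu.1 (hφ k).integrable.integrableOn
      (hφ k).hasZeroExtGradient.hasWeakGradient).weakGradient_ae_eq hΩ
  have hwv : weakGradient Ω (u + v) =ᵐ[volume.restrict Ω] fun x => Gu x + Gv x :=
    (hu.hasWeakGradient.add hu.1 hv.1 hv.hasWeakGradient).weakGradient_ae_eq hΩ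
  have hFc : ∀ᵐ x ∂(volume.restrict Ω), Continuous fun p : ℝ × Eucl n => F x p.1 p.2 := by
    filter_upwards [ae_restrict_mem hΩ.measurableSet] with x hx
    exact hFcont x hx
  -- Pointwise convergence of the integrands comes from continuity of `F` in its last two variables;
  -- the growth bound and convexity of `M x` give an integrable part `a` and a part `b` vanishing in
  -- L¹. Only the upper limit is needed.
  have key := tendsto_lintegral_of_le_add (μ := volume.restrict Ω)
    (f := fun k x => ENNReal.ofReal (F x ((u + φ (σ k)) x) (weakGradient Ω (u + φ (σ k)) x)))
    (b := fun k x => ENNReal.ofReal L * b (σ k) x)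
    (g := fun x => ENNReal.ofReal (F x ((u + v) x) (weakGradient Ω (u + v) x)))
    (a := fun x => ENNReal.ofReal L * (ENNReal.ofReal (M x ((2 : ℝ) • (Gu x + Gv x))) + 1))
    ?_ (fun k => (hbm _).const_mul _) ?_ ?_ ?_ ?_ ?_
  · refine le_trans ?_ key
    have : ∀ k, (⨅ (φ : Eucl n → ℝ) (_ : IsTestFunction Ω φ), energy Ω F (u + φ)) ≤
        energy Ω F (u + φ (σ k)) := fun k => iInf₂_le _ (hφ _)
    rw [← limsup_const (f := (atTop : Filter ℕ))
      (⨅ (φ : Eucl n → ℝ) (_ : IsTestFunction Ω φ), energy Ω F (u + φ))]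
    exact limsup_le_limsup (Eventually.of_forall this)
  · intro k
    refine AEMeasurable.ennreal_ofReal ?_
    refine aemeasurable_caratheodory (E := ℝ × Eucl n) (f := fun x p => F x p.1 p.2)
      (g := fun x => ((u + φ (σ k)) x, weakGradient Ω (u + φ (σ k)) x))
      (fun p => hFmeas p.1 p.2) hFc (AEMeasurable.prodMk ?_ ?_)
    · exact hu.1.aestronglyMeasurable.aemeasurable.add
        (hφ _).1.continuous.measurable.aemeasurable
    · refine AEMeasurable.congr ?_ (hwg _).symm
      exact hGu.1.aemeasurable.add (hφ _).continuous_gradient.measurable.aemeasurable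
  · intro k
    filter_upwards [hwg (σ k), hM.ae_isYoung hΩ, ae_restrict_mem hΩ.measurableSet] with x hx hY hxΩ
    rw [hx, ← mul_add]
    refine (ENNReal.ofReal_le_ofReal (hF x hxΩ _ _)).trans ?_
    rw [ENNReal.ofReal_mul hL]
    gcongr
    rw [ENNReal.ofReal_add (hY.nonneg _) zero_le_one, ENNReal.ofReal_one, add_right_comm]
    gcongr
    have e : Gu x + gradient (φ (σ k)) x = (Gu x + Gv x) + -(Gv x - gradient (φ (σ k)) x) := by
      abel
    rw [e]
    refine (hY.ofReal_add_le _ _).trans ?_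
    rw [smul_neg, hY.even]
  · rw [lintegral_const_mul' _ _ ENNReal.ofReal_ne_top]
    refine ENNReal.mul_ne_top ENNReal.ofReal_ne_top ?_
    rw [lintegral_add_right _ measurable_const]
    refine ENNReal.add_ne_top.2 ⟨(hGu.add hΩ hM hGv).2 2, ?_⟩
    rw [lintegral_const, Measure.restrict_apply_univ, one_mul]
    exact hb.measure_lt_top.ne
  · have hall : ∀ᵐ x ∂(volume.restrict Ω), ∀ k, weakGradient Ω (u + φ k) x =
        Gu x + gradient (φ k) x := ae_all_iff.2 hwg
    filter_upwards [hall, hwv, hae, hFc, hM.ae_tendsto_zero] with x hx1 hx2 hx3 hx4 hx5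
    refine (ENNReal.continuous_ofReal.tendsto _).comp ?_
    simp only [hx1, hx2]
    have t1 : Tendsto (fun k => φ (σ k) x) atTop (𝓝 (v x)) := by
      have : Tendsto (fun k => ‖v x - φ (σ k) x‖ₑ) atTop (𝓝 0) :=
        tendsto_of_tendsto_of_tendsto_of_le_of_le tendsto_const_nhds hx3
          (fun _ => zero_le) fun k => le_self_add
      rw [tendsto_iff_edist_tendsto_0]
      refine this.congr fun k => ?_
      rw [edist_comm, edist_eq_enorm_sub]
    have t2 : Tendsto (fun k => gradient (φ (σ k)) x) atTop (𝓝 (Gv x)) := by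
      have h3 : Tendsto (fun k => b (σ k) x) atTop (𝓝 0) :=
        tendsto_of_tendsto_of_tendsto_of_le_of_le tendsto_const_nhds hx3
          (fun _ => zero_le) fun k => le_add_self
      have h4 := (hx5 _ h3).const_smul (2⁻¹ : ℝ)
      simp only [smul_smul] at h4
      norm_num at h4
      have h5 := h4.const_sub (Gv x)
      simpa using h5
    have t3 : Tendsto (fun k => ((u + φ (σ k)) x, Gu x + gradient (φ (σ k)) x)) atTop
        (𝓝 ((u + v) x, Gu x + Gv x)) :=
      (t1.const_add (u x)).prodMk_nhds (t2.const_add (Gu x))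
    exact (hx4.tendsto _).comp t3
  · filter_upwards [hae] with x hx
    have h3 : Tendsto (fun k => b (σ k) x) atTop (𝓝 0) :=
      tendsto_of_tendsto_of_tendsto_of_le_of_le tendsto_const_nhds hx
        (fun _ => zero_le) fun k => le_add_self
    simpa using ENNReal.Tendsto.const_mul (a := ENNReal.ofReal L) h3
      (Or.inr ENNReal.ofReal_ne_top)
  · have h3 := (hsmall h2).comp hσ.tendsto_atTop
    have h4 := ENNReal.Tendsto.const_mul (a := ENNReal.ofReal L) h3
      (Or.inr ENNReal.ofReal_ne_top)
    rw [mul_zero] at h4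
    refine h4.congr fun k => ?_
    rw [lintegral_const_mul' _ _ ENNReal.ofReal_ne_top]
    rfl

/-! ### Test functions are admissible -/

theorem IsTestFunction.mem_V10E (hΩ : IsOpen Ω) (hM : IsWeakNFunction Ω M) {φ : Eucl n → ℝ}
    (hφ : IsTestFunction Ω φ) : φ ∈ V10E Ω M := by
  have hw := hφ.hasZeroExtGradient.hasWeakGradient
  have hae := hw.weakGradient_ae_eq hΩ
  refine ⟨⟨⟨hφ.integrable.integrableOn, _, hw⟩, fun ε hε => ⟨φ, hφ, ?_⟩⟩, ?_⟩
  · rw [lintegral_congr_ae (g := fun _ => 0) (f := fun x => ‖weakGradient Ω φ x - gradient φ x‖ₑ)]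
    · simpa using hε
    · filter_upwards [hae] with x hx
      simp [hx]
  · obtain ⟨C, hC⟩ := hφ.exists_bound_gradient
    refine MemEM.of_bounded hM (C := C)
      (hφ.continuous_gradient.aestronglyMeasurable.congr hae.symm) ?_
    filter_upwards [hae] with x hx
    rw [hx]
    exact hC x

end Lavrentiev

namespace Lavrentiev

open Filter

/-! ### Essential bounds -/

section Essential

variable {α : Type*} [MeasurableSpace α] {μ : Measure α} {f : α → ℝ}

/-- The reals are only conditionally complete, so an essential bound is meaningful only together
with an almost everywhere bound on the appropriate side. -/
theorem ae_essInf_le_real {c : ℝ} (hc : ∀ᵐ x ∂μ, c ≤ f x) : ∀ᵐ x ∂μ, essInf f μ ≤ f x :=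
  ae_essInf_le ⟨c, hc⟩

theorem ae_le_essSup_real {c : ℝ} (hc : ∀ᵐ x ∂μ, f x ≤ c) : ∀ᵐ x ∂μ, f x ≤ essSup f μ :=
  ae_le_essSup ⟨c, hc⟩

theorem essInf_le_real [NeZero μ] {c d : ℝ} (hc : ∀ᵐ x ∂μ, c ≤ f x) (hd : ∀ᵐ x ∂μ, f x ≤ d) :
    essInf f μ ≤ d := by
  obtain ⟨x, h1, h2⟩ := ((ae_essInf_le_real hc).and hd).exists
  exact h1.trans h2

theorem le_essInf_real [NeZero μ] {c d : ℝ} (hc : ∀ᵐ x ∂μ, c ≤ f x) (hd : ∀ᵐ x ∂μ, f x ≤ d) :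
    c ≤ essInf f μ :=
  le_essInf_of_ae_le c hc (isCoboundedUnder_ge_of_eventually_le (ae μ) hd)

end Essential

/-! ### Jensen's inequality for the non-convex envelopes -/

/-- A continuous convex function is, up to `ε`, supported by an affine function. -/
theorem IsYoung.exists_affine_le {E : Type*} [NormedAddCommGroup E] [NormedSpace ℝ E] {g : E → ℝ}
    (hg : IsYoung g) (z : E) {ε : ℝ} (hε : 0 < ε) :
    ∃ (p : E →L[ℝ] ℝ) (b : ℝ), b ≤ 0 ∧ (∀ ζ, p ζ + b ≤ g ζ) ∧ p z + b = g z - ε := by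
  obtain ⟨p, b, h1, h2⟩ := ConvexOn.exists_affine_le_of_lt (𝕜 := ℝ) (mem_univ z) (sub_lt_self (g z) hε)
    isClosed_univ hg.continuous.continuousOn.lowerSemicontinuousOn hg.convex
  have h3 : ∀ ζ, p ζ + b ≤ g ζ := fun ζ => h1 ⟨ζ, mem_univ ζ⟩
  refine ⟨p, b, ?_, h3, h2⟩
  simpa [hg.zero] using h3 0

/-- Jensen's inequality between a convex function `g` and a family of convex functions that
dominate it only below the level `K`. -/
theorem IsYoung.le_integral_add_one {α E : Type*} [MeasurableSpace α] {μ : Measure α}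
    [NormedAddCommGroup E] [NormedSpace ℝ E] [CompleteSpace E] {g : E → ℝ} (hg : IsYoung g)
    {m : α → E → ℝ} {C K θ : ℝ} (hC : 0 < C) (hK : 0 < K) {w : α → ℝ} {ξ : α → E}
    (hw0 : ∀ y, 0 ≤ w y) (hw : Integrable w μ) (hw1 : ∫ y, w y ∂μ ≤ 1)
    (hξ : Integrable (fun y => w y • ξ y) μ) (ha : Integrable (fun y => w y * m y (ξ y)) μ)
    (hm : ∀ᵐ y ∂μ, w y ≠ 0 → IsYoung (m y) ∧ ∀ ζ, m y (C • ζ) ≤ K → g ζ ≤ m y (C • ζ) + 1)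
    (hθ : ∀ ζ, ‖ζ‖ ≤ θ → g (C⁻¹ • ζ) ≤ K + 1) (hz : ‖∫ y, w y • ξ y ∂μ‖ ≤ θ) :
    g ((2 * C)⁻¹ • ∫ y, w y • ξ y ∂μ) ≤ (∫ y, w y * m y (ξ y) ∂μ) + 1 := by
  set Z := ∫ y, w y • ξ y ∂μ with hZ
  set A := ∫ y, w y * m y (ξ y) ∂μ with hA
  have hC2 : |(2 * C)⁻¹| ≤ C⁻¹ := by
    rw [abs_of_pos (by positivity), mul_inv]
    have : 0 < C⁻¹ := by positivity
    linarith
  -- If the average exceeds the level `K`, the size condition on the mean alone suffices. Otherwise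
  -- `A / K ≤ 1`, which limits the contribution of the points above the level.
  rcases lt_or_ge K A with h | h
  · calc g ((2 * C)⁻¹ • Z) ≤ g (C⁻¹ • Z) := hg.smul_mono hC2 Z
      _ ≤ K + 1 := hθ Z hz
      _ ≤ A + 1 := by linarith
  have hA0 : 0 ≤ A := by
    refine integral_nonneg_of_ae ?_
    filter_upwards [hm] with y hy
    rcases eq_or_ne (w y) 0 with h0 | h0
    · simp [h0]
    · exact mul_nonneg (hw0 y) ((hy h0).1.nonneg _)
  refine le_of_forall_pos_le_add fun ε hε => ?_
  obtain ⟨p, b, hb, hpb, hpz⟩ := hg.exists_affine_le ((2 * C)⁻¹ • Z) hε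
  -- Testing with an affine minorant `p + b` of `g` makes the left side linear in `ξ`, so the
  -- inequality survives integration although the comparison of `g` with `m y` holds only at low
  -- values. The term with `m y (ξ y) / K` pays for the high values.
  have hpt : ∀ᵐ y ∂μ, C⁻¹ * p (w y • ξ y) ≤
      w y * m y (ξ y) + (1 - b) * (w y + w y * m y (ξ y) / K) := by
    filter_upwards [hm] with y hy
    rcases eq_or_ne (w y) 0 with h0 | h0
    · simp [h0]
    obtain ⟨hY, hyK⟩ := hy h0
    have ha0 := hY.nonneg (ξ y)
    have key : C⁻¹ * p (ξ y) ≤ m y (ξ y) + (1 - b) * (1 + m y (ξ y) / K) := by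
      have hcC : ∀ v : E, C • (C⁻¹ • v) = v := fun v => by
        rw [smul_smul, mul_inv_cancel₀ hC.ne', one_smul]
      rcases le_or_gt (m y (ξ y)) K with h1 | h1
      · have h2 := hyK (C⁻¹ • ξ y) (by rwa [hcC])
        have h3 := hpb (C⁻¹ • ξ y)
        rw [hcC] at h2
        rw [map_smul, smul_eq_mul] at h3
        have h4 : 0 ≤ (1 - b) * (m y (ξ y) / K) := by
          have : 0 ≤ 1 - b := by linarith
          positivity
        linarith
      · have ha1 : 0 < m y (ξ y) := hK.trans h1
        -- At a point above the level, `ξ y` is shrunk until `m y` is at most `K`, the comparison is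
        -- applied there, and the resulting inequality is divided by `t`.
        set t := K / m y (ξ y) with ht
        have ht0 : 0 < t := div_pos hK ha1
        have ht1 : t ≤ 1 := (div_le_one ha1).2 h1.le
        have h5 : m y (t • ξ y) ≤ K := by
          have := hY.smul_le ht0.le ht1 (ξ y)
          rwa [ht, div_mul_cancel₀ _ ha1.ne'] at this
        have h2 := hyK (C⁻¹ • t • ξ y) (by rwa [hcC])
        have h3 := hpb (C⁻¹ • t • ξ y)
        rw [hcC] at h2
        rw [map_smul, map_smul, smul_eq_mul, smul_eq_mul] at h3
        have h6 : t * (C⁻¹ * p (ξ y)) ≤ K + 1 - b := by linarith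
        have h7 : C⁻¹ * p (ξ y) ≤ (K + 1 - b) / t := by
          rw [le_div_iff₀ ht0]
          linarith
        have h8 : (K + 1 - b) / t = m y (ξ y) + (1 - b) * (m y (ξ y) / K) := by
          rw [ht]
          field_simp
          ring
        nlinarith
    rw [map_smul, smul_eq_mul]
    have := mul_le_mul_of_nonneg_left key (hw0 y)
    calc C⁻¹ * (w y * p (ξ y)) = w y * (C⁻¹ * p (ξ y)) := by ring
      _ ≤ _ := this
      _ = _ := by ring
  have hint := integral_mono_ae (((p.integrable_comp hξ)).const_mul C⁻¹)
    (ha.add ((hw.add (ha.div_const K)).const_mul (1 - b))) hpt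
  rw [integral_const_mul, integral_add' ha ((hw.add (ha.div_const K)).const_mul (1 - b))] at hint
  rw [p.integral_comp_comm hξ] at hint
  have e2 : ∫ y, ((1 - b) * (w + fun y => w y * m y (ξ y) / K) y) ∂μ =
      (1 - b) * ((∫ y, w y ∂μ) + A / K) := by
    rw [integral_const_mul, integral_add' hw (ha.div_const K), integral_div]
  rw [e2] at hint
  have h9 : A / K ≤ 1 := (div_le_one hK).2 h
  have h10 : (1 - b) * ((∫ y, w y ∂μ) + A / K) ≤ (1 - b) * 2 :=
    mul_le_mul_of_nonneg_left (by linarith) (by linarith)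
  rw [map_smul, smul_eq_mul, mul_inv] at hpz
  -- The extra factor 2 in `(2 * C)⁻¹` enters here: halving turns `(1 - b) * 2` into `1 - b`, and
  -- the constant `b` of the affine minorant cancels, leaving an error of 1.
  have h11 : C⁻¹ * p Z ≤ A + (1 - b) * 2 := hint.trans (by gcongr)
  rw [mul_inv]
  nlinarith

/-! ### The balance condition between pairs of points -/

section Balance

variable {n ℓ : ℕ} {Ω : Set (Eucl n)} {m : Eucl n → Eucl ℓ → ℝ}

/-- The balance condition on a ball, in terms of values at almost all points of the ball. -/
theorem exists_pairwise_balance (hΩ : IsOpen Ω) (hm : IsWeakNFunction Ω m) {C θ : ℝ} (hC : 1 < C)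
    (hθ : 0 < θ) {z : Eucl n} {r : ℝ} (hne : (Metric.ball z r ∩ Ω).Nonempty)
    (hbal : ∀ ξ : Eucl ℓ, lowerEnv Ω (Metric.ball z r) m (C • ξ) ≤
            ⨆ η : Metric.sphere (0 : Eucl ℓ) 1,
              lowerEnv Ω (Metric.ball z r) m (θ • (η : Eucl ℓ)) →
          upperEnv Ω (Metric.ball z r) m ξ ≤ lowerEnv Ω (Metric.ball z r) m (C • ξ) + 1) :
    ∃ (K : ℝ) (A : Set (Eucl n)), 0 < K ∧
      (∀ᵐ x ∂(volume.restrict (Metric.ball z r ∩ Ω)), x ∈ A) ∧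
      (∀ x ∈ A, IsYoung (m x)) ∧
      (∀ x ∈ A, ∀ y ∈ A, ∀ ξ, m y (C • ξ) ≤ K → m x ξ ≤ m y (C • ξ) + 1) ∧
      ∀ x ∈ A, ∀ ξ, ‖ξ‖ ≤ θ → m x (C⁻¹ • ξ) ≤ K + 1 := by
  have hle : volume.restrict (Metric.ball z r ∩ Ω) ≤ volume.restrict Ω :=
    Measure.restrict_mono inter_subset_right le_rfl
  have hY : ∀ᵐ x ∂(volume.restrict (Metric.ball z r ∩ Ω)), IsYoung (m x) :=
    ae_mono hle (hm.ae_isYoung hΩ)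
  -- For `ℓ = 0` the unit sphere is empty and the real supremum over it is 0 by convention, so it
  -- cannot serve as a positive level. Every vector is then zero and `K = 1` works.
  rcases isEmpty_or_nonempty (Metric.sphere (0 : Eucl ℓ) 1) with hemp | hnon
  · have hsub : ∀ ξ : Eucl ℓ, ξ = 0 := by
      intro ξ
      by_contra h
      refine hemp.false ⟨‖ξ‖⁻¹ • ξ, ?_⟩
      rw [mem_sphere_zero_iff_norm, norm_smul, norm_inv, norm_norm,
        inv_mul_cancel₀ (norm_ne_zero_iff.2 h)]
    refine ⟨1, {x | IsYoung (m x)}, one_pos, hY, fun x hx => hx, fun x hx y hy ξ _ => ?_,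
      fun x hx ξ _ => ?_⟩
    · rw [hsub ξ, (show IsYoung (m x) from hx).zero]
      linarith [(show IsYoung (m y) from hy).nonneg (C • 0)]
    · rw [hsub (C⁻¹ • ξ), (show IsYoung (m x) from hx).zero]
      norm_num
  have hnz : NeZero (volume.restrict (Metric.ball z r ∩ Ω)) := by
    refine ⟨fun h => ?_⟩
    rw [Measure.restrict_eq_zero] at h
    exact (Metric.isOpen_ball.inter hΩ).measure_ne_zero volume hne h
  set μ := volume.restrict (Metric.ball z r ∩ Ω) with hμ
  have h0 : ∀ ξ, ∀ᵐ x ∂μ, 0 ≤ m x ξ := fun ξ => hY.mono fun x hx => hx.nonneg ξ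
  have hbd : ∀ R : ℝ, ∃ D : ℝ, 0 ≤ D ∧ ∀ᵐ x ∂μ, ∀ ξ, ‖ξ‖ ≤ R → m x ξ ≤ D := fun R => by
    obtain ⟨D, hD, h⟩ := hm.exists_bound hΩ R
    exact ⟨D, hD, ae_mono hle h⟩
  have hup : ∀ ξ, ∃ D : ℝ, ∀ᵐ x ∂μ, m x ξ ≤ D := fun ξ => by
    obtain ⟨D, -, h⟩ := hbd ‖ξ‖
    exact ⟨D, h.mono fun x hx => hx ξ le_rfl⟩
  set K := ⨆ η : Metric.sphere (0 : Eucl ℓ) 1,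
    lowerEnv Ω (Metric.ball z r) m (θ • (η : Eucl ℓ)) with hKdef
  have hnorm : ∀ η : Metric.sphere (0 : Eucl ℓ) 1, ‖θ • (η : Eucl ℓ)‖ = θ := fun η => by
    rw [norm_smul, mem_sphere_zero_iff_norm.1 η.2, mul_one, Real.norm_of_nonneg hθ.le]
  have hbdd : BddAbove (range fun η : Metric.sphere (0 : Eucl ℓ) 1 =>
      lowerEnv Ω (Metric.ball z r) m (θ • (η : Eucl ℓ))) := by
    obtain ⟨D, -, h⟩ := hbd θ
    refine ⟨D, ?_⟩
    rintro _ ⟨η, rfl⟩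
    exact essInf_le_real (h0 _) (h.mono fun x hx => hx _ (hnorm η).le)
  have hleK : ∀ η : Metric.sphere (0 : Eucl ℓ) 1,
      lowerEnv Ω (Metric.ball z r) m (θ • (η : Eucl ℓ)) ≤ K := fun η => le_ciSup hbdd η
  have hKpos : 0 < K := by
    obtain ⟨m₁, m₂, -, -, -, hpos, -, hb⟩ := hm.bounds
    obtain ⟨η⟩ := hnon
    refine (hpos θ hθ).trans_le (le_trans ?_ (hleK η))
    obtain ⟨D, hD⟩ := hup (θ • (η : Eucl ℓ))
    refine le_essInf_real ?_ hD
    filter_upwards [ae_mono hle hb] with x hx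
    have := (hx (θ • (η : Eucl ℓ))).1
    rwa [hnorm η] at this
  -- Essential bounds hold almost everywhere for each fixed vector. Imposing them on countable dense
  -- sets gives a single null set; continuity of `m x` recovers the other vectors.
  obtain ⟨D, hDc, hDd⟩ := TopologicalSpace.exists_countable_dense (Eucl ℓ)
  obtain ⟨S, hSc, hSd⟩ := TopologicalSpace.exists_countable_dense (Metric.sphere (0 : Eucl ℓ) 1)
  have hlow : ∀ ξ, ∀ᵐ x ∂μ, lowerEnv Ω (Metric.ball z r) m ξ ≤ m x ξ := fun ξ =>
    ae_essInf_le_real (h0 ξ)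
  have hupp : ∀ ξ, ∀ᵐ x ∂μ, m x ξ ≤ upperEnv Ω (Metric.ball z r) m ξ := fun ξ => by
    obtain ⟨c, hc⟩ := hup ξ
    exact ae_le_essSup_real hc
  refine ⟨K, {x | IsYoung (m x) ∧ (∀ ξ ∈ D, lowerEnv Ω (Metric.ball z r) m (C • ξ) ≤ m x (C • ξ) ∧
    m x ξ ≤ upperEnv Ω (Metric.ball z r) m ξ) ∧ ∀ η ∈ S,
      m x (C⁻¹ • θ • (η : Eucl ℓ)) ≤ upperEnv Ω (Metric.ball z r) m (C⁻¹ • θ • (η : Eucl ℓ))},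
    hKpos, ?_, fun x hx => hx.1, ?_, ?_⟩
  · have a1 := (ae_ball_iff hDc).2 fun ξ (_ : ξ ∈ D) => (hlow (C • ξ)).and (hupp ξ)
    have a2 := (ae_ball_iff hSc).2 fun η (_ : η ∈ S) => hupp (C⁻¹ • θ • (η : Eucl ℓ))
    filter_upwards [hY, a1, a2] with x h1 h2 h3
    exact ⟨h1, h2, h3⟩
  · rintro x ⟨hxY, hxD, -⟩ y ⟨hyY, hyD, -⟩ ξ hξ
    have hlt : ∀ ζ, m y (C • ζ) < K → m x ζ ≤ m y (C • ζ) + 1 := by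
      intro ζ hζ
      have hcy : Continuous fun ζ => m y (C • ζ) := hyY.continuous.comp (continuous_const_smul C)
      have hopen : IsOpen {ζ | m y (C • ζ) < K} := isOpen_lt hcy continuous_const
      have hcl : IsClosed {ζ | m x ζ ≤ m y (C • ζ) + 1} :=
        isClosed_le hxY.continuous (hcy.add continuous_const)
      refine hcl.closure_subset_iff.2 ?_ (hDd.open_subset_closure_inter hopen hζ)
      rintro ζ' ⟨h1, h2⟩
      have h3 := (hyD ζ' h2).1
      have h4 := hbal ζ' (h3.trans (le_of_lt h1))
      exact (hxD ζ' h2).2.trans (h4.trans (by linarith))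
    -- The density argument needs the open condition `m y (C • ζ) < K`. Equality with `K` is reached
    -- by scaling with `s < 1` and letting `s` tend to 1.
    have hs : ∀ s ∈ Ioo (0 : ℝ) 1, m x (s • ξ) ≤ m y (C • ξ) + 1 := by
      intro s hs
      have h1 := hyY.smul_le hs.1.le hs.2.le (C • ξ)
      rw [smul_comm] at h1
      have h2 : s * m y (C • ξ) < K :=
        (mul_le_mul_of_nonneg_left hξ hs.1.le).trans_lt (mul_lt_of_lt_one_left hKpos hs.2)
      refine (hlt (s • ξ) (h1.trans_lt h2)).trans ?_
      have := mul_le_of_le_one_left (hyY.nonneg (C • ξ)) hs.2.le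
      linarith
    have ht : Tendsto (fun s : ℝ => m x (s • ξ)) (𝓝[<] 1) (𝓝 (m x ξ)) := by
      have : Continuous fun s : ℝ => m x (s • ξ) := hxY.continuous.comp (by fun_prop)
      have h2 := (this.tendsto 1).mono_left (nhdsWithin_le_nhds (s := Iio 1))
      simpa using h2
    refine le_of_tendsto ht ?_
    filter_upwards [Ioo_mem_nhdsLT (zero_lt_one (α := ℝ))] with s h using hs s h
  · rintro x ⟨hxY, -, hxS⟩ ξ hξ
    -- At the vector `C⁻¹ • θ • η` the premise of the balance condition is true by definition of the
    -- supremum `K`, so the upper envelope there is at most `K + 1`.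
    have hall : ∀ η : Metric.sphere (0 : Eucl ℓ) 1, m x (C⁻¹ • θ • (η : Eucl ℓ)) ≤ K + 1 := by
      intro η
      have hcl : IsClosed {η : Metric.sphere (0 : Eucl ℓ) 1 |
          m x (C⁻¹ • θ • (η : Eucl ℓ)) ≤ K + 1} := by
        refine isClosed_le (hxY.continuous.comp ?_) continuous_const
        exact (continuous_subtype_val.const_smul θ).const_smul C⁻¹
      refine hcl.closure_subset_iff.2 ?_ (hSd η)
      intro η' hη'
      have e : C • (C⁻¹ • θ • (η' : Eucl ℓ)) = θ • (η' : Eucl ℓ) := by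
        rw [smul_smul, mul_inv_cancel₀ (by positivity), one_smul]
      have h1 := hbal (C⁻¹ • θ • (η' : Eucl ℓ)) (by rw [e]; exact hleK η')
      rw [e] at h1
      have h2 := hleK η'
      exact (hxS η' hη').trans (h1.trans (by linarith))
    rcases eq_or_ne ξ 0 with rfl | hne0
    · rw [smul_zero, hxY.zero]
      linarith
    · have hpos : 0 < ‖ξ‖ := norm_pos_iff.2 hne0
      have h1 := hall ⟨‖ξ‖⁻¹ • ξ, by
        rw [mem_sphere_zero_iff_norm, norm_smul, norm_inv, norm_norm, inv_mul_cancel₀ hpos.ne']⟩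
      refine le_trans ?_ h1
      simp only [smul_smul]
      refine hxY.smul_mono ?_ ξ
      have hC0 : 0 < C⁻¹ := by positivity
      rw [abs_of_pos hC0]
      refine le_mul_of_one_le_right hC0.le ?_
      rw [← div_eq_mul_inv]
      exact (one_le_div hpos).2 hξ

/-- The form of the balance condition used for mollification: Jensen's inequality for averages of
moderate size over small balls. -/
theorem BGenPlus.exists_jensen (hΩ : IsOpen Ω) {M : Eucl n → Eucl n → ℝ} {γ : ℝ≥0}
    (hB : BGenPlus Ω M γ) :
    ∃ (C D : ℝ) (Θ : ℝ → ℝ), 0 < C ∧ 0 ≤ D ∧ (∀ r ∈ Ioc (0 : ℝ) 1, 0 < Θ r) ∧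
      ((fun r => (Θ r)⁻¹) =o[𝓝[>] (0 : ℝ)] fun r => r ^ (1 - (γ : ℝ))) ∧
      ∀ r ∈ Ioc (0 : ℝ) 1, ∀ᵐ x ∂(volume.restrict Ω), ∀ (w : Eucl n → ℝ) (ξ : Eucl n → Eucl n),
        (∀ y, 0 ≤ w y) → IntegrableOn w Ω → ∫ y in Ω, w y ≤ 1 →
        (∀ y, w y ≠ 0 → dist y x < r / 2) → AEStronglyMeasurable ξ (volume.restrict Ω) →
        IntegrableOn (fun y => w y • ξ y) Ω → IntegrableOn (fun y => w y * M y (ξ y)) Ω →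
        ‖∫ y in Ω, w y • ξ y‖ ≤ Θ r →
        M x (C⁻¹ • ∫ y in Ω, w y • ξ y) ≤ (∫ y in Ω, w y * M y (ξ y)) + D := by
  obtain ⟨N, ℓ, P, m, C, ϑ, hN, hPs, hPi, hm, hdec, hC, hϑ, ho, hbal⟩ := hB
  have hC0 : 0 < C := by linarith
  set p : (j : Fin N) → (Eucl n →L[ℝ] Eucl (ℓ j)) := fun j => (P j).toContinuousLinearMap with hp
  -- A common bound for the operator norms: dividing `ϑ` by `S` ensures that a mean below the new
  -- threshold has all its components below `ϑ r`.
  set S : ℝ := 1 + ∑ j, ‖p j‖ with hS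
  have hS0 : 0 < S := by positivity
  have hpS : ∀ j, ‖p j‖ ≤ S := fun j => by
    have := Finset.single_le_sum (f := fun j => ‖p j‖) (fun i _ => norm_nonneg _)
      (Finset.mem_univ j)
    linarith
  -- The factor 2 is the loss in Jensen's inequality, and each of the `N` components contributes an
  -- additive error 1.
  refine ⟨2 * C, N, fun r => ϑ r / S, by positivity, by positivity,
    fun r hr => div_pos (hϑ r hr) hS0, ?_, fun r hr => ?_⟩
  · have : (fun r => (ϑ r / S)⁻¹) = fun r => S * (ϑ r)⁻¹ := by
      ext r
      rw [inv_div, div_eq_mul_inv]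
    rw [this]
    exact ho.const_mul_left S
  -- Only balls with centres in a countable dense set are used, so that their exceptional sets form
  -- one null set. A centre within `r / 2` of `x` gives a ball of radius `r` containing every point
  -- within `r / 2` of `x`.
  obtain ⟨Q, hQc, hQd⟩ := TopologicalSpace.exists_countable_dense (Eucl n)
  have hex : ∀ (z : Eucl n) (j : Fin N), ∃ (K : ℝ) (A : Set (Eucl n)), 0 < K ∧
      (∀ᵐ x ∂(volume.restrict Ω), x ∈ Metric.ball z r → x ∈ A) ∧
      (∀ x ∈ A, IsYoung (m j x)) ∧
      (∀ x ∈ A, ∀ y ∈ A, ∀ ξ, m j y (C • ξ) ≤ K → m j x ξ ≤ m j y (C • ξ) + 1) ∧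
      ∀ x ∈ A, ∀ ξ, ‖ξ‖ ≤ ϑ r → m j x (C⁻¹ • ξ) ≤ K + 1 := by
    intro z j
    rcases (Metric.ball z r ∩ Ω).eq_empty_or_nonempty with hemp | hne
    · refine ⟨1, ∅, one_pos, ?_, by simp, by simp, by simp⟩
      filter_upwards [ae_restrict_mem hΩ.measurableSet] with x hx hxz
      exact absurd (mem_inter hxz hx) (by simp [hemp])
    · obtain ⟨K, A, hK, hA, h1, h2, h3⟩ := exists_pairwise_balance hΩ (hm j) hC (hϑ r hr) hne
        (hbal z r hr.1 hr.2 hne j)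
      refine ⟨K, A, hK, ?_, h1, h2, h3⟩
      rw [← Measure.restrict_restrict measurableSet_ball] at hA
      exact (ae_restrict_iff' measurableSet_ball).1 hA
  choose K A hK hA hAY hApair hAθ using hex
  have hall : ∀ᵐ x ∂(volume.restrict Ω), ∀ z ∈ Q, ∀ j, x ∈ Metric.ball z r → x ∈ A z j :=
    (ae_ball_iff hQc).2 fun z _ => ae_all_iff.2 fun j => hA z j
  filter_upwards [hall, ae_restrict_mem hΩ.measurableSet] with x hx hxΩ w ξ hw0 hw hw1 hws hξm
    hξ ha hZ
  obtain ⟨z, hzQ, hzx⟩ := hQd.exists_mem_open (Metric.isOpen_ball (x := x) (ε := r / 2))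
    ⟨x, Metric.mem_ball_self (half_pos hr.1)⟩
  rw [Metric.mem_ball] at hzx
  have hxz : x ∈ Metric.ball z r := by
    rw [Metric.mem_ball, dist_comm]
    linarith [hr.1]
  have hyz : ∀ y, w y ≠ 0 → y ∈ Metric.ball z r := fun y hy => by
    rw [Metric.mem_ball]
    have := dist_triangle_right y z x
    linarith [hws y hy]
  set Z := ∫ y in Ω, w y • ξ y with hZdef
  have hPint : ∀ j, IntegrableOn (fun y => w y • P j (ξ y)) Ω := fun j => by
    have := (p j).integrable_comp hξ
    simp only [map_smul] at this
    exact this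
  have hPZ : ∀ j, ∫ y in Ω, w y • P j (ξ y) = P j Z := fun j => by
    have := (p j).integral_comp_comm hξ
    simp only [map_smul] at this
    exact this
  have hYm : ∀ j, ∀ᵐ y ∂(volume.restrict Ω), IsYoung (m j y) := fun j => (hm j).ae_isYoung hΩ
  -- The summands of `M` are nonnegative, so each is dominated by `M` itself.
  have haj : ∀ j, IntegrableOn (fun y => w y * m j y (P j (ξ y))) Ω := by
    intro j
    refine Integrable.mono' ha ?_ ?_
    · refine hw.aestronglyMeasurable.mul ?_
      refine (aemeasurable_caratheodory (hm j).measurable (hm j).continuous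
        ?_).aestronglyMeasurable
      exact ((p j).continuous.comp_aestronglyMeasurable hξm).aemeasurable
    · filter_upwards [ae_restrict_mem hΩ.measurableSet, ae_all_iff.2 hYm] with y hy hyY
      rw [norm_mul, Real.norm_of_nonneg (hw0 y), Real.norm_of_nonneg ((hyY j).nonneg _),
        hdec y hy]
      refine mul_le_mul_of_nonneg_left ?_ (hw0 y)
      exact Finset.single_le_sum (f := fun j => m j y (P j (ξ y)))
        (fun i _ => (hyY i).nonneg _) (Finset.mem_univ j)
  have hj : ∀ j, m j x (P j ((2 * C)⁻¹ • Z)) ≤ (∫ y in Ω, w y * m j y (P j (ξ y))) + 1 := by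
    intro j
    have := (hAY z j x (hx z hzQ j hxz)).le_integral_add_one (μ := volume.restrict Ω) (m := m j)
      (ξ := fun y => P j (ξ y)) hC0 (hK z j) hw0 hw hw1 (hPint j) (haj j) ?_
      (hAθ z j x (hx z hzQ j hxz)) ?_
    · rwa [hPZ j, ← map_smul] at this
    · filter_upwards [hall] with y hy hwy
      have hyA := hy z hzQ j (hyz y hwy)
      exact ⟨hAY z j y hyA, hApair z j x (hx z hzQ j hxz) y hyA⟩
    · rw [hPZ j]
      calc ‖P j Z‖ ≤ ‖p j‖ * ‖Z‖ := (p j).le_opNorm Z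
        _ ≤ S * (ϑ r / S) := mul_le_mul (hpS j) hZ (norm_nonneg _) hS0.le
        _ = ϑ r := by field_simp
  rw [hdec x hxΩ]
  calc ∑ j, m j x (P j ((2 * C)⁻¹ • Z))
      ≤ ∑ j, ((∫ y in Ω, w y * m j y (P j (ξ y))) + 1) := Finset.sum_le_sum fun j _ => hj j
    _ = (∫ y in Ω, w y * M y (ξ y)) + N := by
        rw [Finset.sum_add_distrib, ← integral_finsetSum _ fun j _ => haj j]
        congr 1
        · refine setIntegral_congr_fun hΩ.measurableSet fun y hy => ?_
          simp only [hdec y hy, Finset.mul_sum]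
        · simp

end Balance

end Lavrentiev

namespace Lavrentiev

open Filter

variable {n : ℕ} {Ω : Set (Eucl n)}

/-! ### Mollification -/

/-- A smooth probability density supported in the ball of radius `2`. -/
structure IsMollifier (k : Eucl n → ℝ) : Prop where
  smooth : ContDiff ℝ ∞ k
  compact : HasCompactSupport k
  nonneg : ∀ x, 0 ≤ k x
  integral_eq : ∫ x, k x = 1
  norm_le : ∀ x, k x ≠ 0 → ‖x‖ ≤ 2

/-- `s⁻ⁿ k(z / s)`. -/
noncomputable def scaledKernel (k : Eucl n → ℝ) (s : ℝ) (z : Eucl n) : ℝ := (s ^ n)⁻¹ * k (s⁻¹ • z)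

namespace IsMollifier

variable {k : Eucl n → ℝ} {s : ℝ}

theorem isTestFunction (hk : IsMollifier k) : IsTestFunction univ k :=
  ⟨hk.smooth, hk.compact, subset_univ _⟩

theorem scaled_isTestFunction (hk : IsMollifier k) (hs : 0 < s) :
    IsTestFunction univ (scaledKernel k s) := by
  refine ⟨contDiff_const.mul (hk.smooth.comp (contDiff_const_smul _)), ?_, subset_univ _⟩
  exact (hk.compact.comp_smul (inv_ne_zero hs.ne')).mul_left

theorem scaled_nonneg (hk : IsMollifier k) (hs : 0 < s) (z : Eucl n) : 0 ≤ scaledKernel k s z :=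
  mul_nonneg (by positivity) (hk.nonneg _)

theorem norm_le_of_scaled_ne_zero (hk : IsMollifier k) (hs : 0 < s) {z : Eucl n}
    (hz : scaledKernel k s z ≠ 0) : ‖z‖ ≤ 2 * s := by
  have := hk.norm_le _ (right_ne_zero_of_mul hz)
  rw [norm_smul, norm_inv, Real.norm_of_nonneg hs.le, inv_mul_le_iff₀ hs] at this
  linarith

theorem integral_scaled (hk : IsMollifier k) (hs : 0 < s) : ∫ z, scaledKernel k s z = 1 := by
  simp only [scaledKernel]
  rw [integral_const_mul, Measure.integral_comp_inv_smul_of_nonneg volume k hs.le, hk.integral_eq]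
  simp [hs.ne']

theorem integral_scaled_sub (hk : IsMollifier k) (hs : 0 < s) (x : Eucl n) :
    ∫ y, scaledKernel k s (x - y) = 1 := by
  rw [integral_sub_left_eq_self, hk.integral_scaled hs]

theorem gradient_scaled (hk : IsMollifier k) (z : Eucl n) :
    gradient (scaledKernel k s) z = ((s ^ n)⁻¹ * s⁻¹) • gradient k (s⁻¹ • z) := by
  have hd : DifferentiableAt ℝ k (s⁻¹ • z) := hk.isTestFunction.differentiable _
  have h1 : HasFDerivAt (fun y : Eucl n => s⁻¹ • y) (s⁻¹ • ContinuousLinearMap.id ℝ (Eucl n)) z :=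
    (hasFDerivAt_id z).const_smul s⁻¹
  have h2 := (hd.hasFDerivAt.comp z h1).const_mul (s ^ n)⁻¹
  have h3 : fderiv ℝ (scaledKernel k s) z =
      (s ^ n)⁻¹ • ((fderiv ℝ k (s⁻¹ • z)).comp (s⁻¹ • ContinuousLinearMap.id ℝ (Eucl n))) :=
    h2.fderiv
  simp only [gradient_eq_toDual_symm]
  rw [h3, ContinuousLinearMap.comp_smul, ContinuousLinearMap.comp_id, smul_smul,
    LinearIsometryEquiv.map_smul]

theorem integral_norm_gradient_scaled (hk : IsMollifier k) (hs : 0 < s) (x : Eucl n) :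
    ∫ y, ‖gradient (scaledKernel k s) (x - y)‖ = s⁻¹ * ∫ z, ‖gradient k z‖ := by
  rw [integral_sub_left_eq_self (fun y => ‖gradient (scaledKernel k s) y‖)]
  simp only [hk.gradient_scaled, norm_smul]
  rw [integral_const_mul,
    Measure.integral_comp_inv_smul_of_nonneg volume (fun z => ‖gradient k z‖) hs.le,
    Real.norm_of_nonneg (by positivity)]
  simp only [finrank_euclideanSpace, Fintype.card_fin, smul_eq_mul]
  field_simp

theorem norm_le_of_gradient_scaled_ne_zero (hk : IsMollifier k) (hs : 0 < s) {z : Eucl n}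
    (hz : gradient (scaledKernel k s) z ≠ 0) : ‖z‖ ≤ 2 * s := by
  have h1 : z ∈ tsupport (scaledKernel k s) :=
    IsTestFunction.tsupport_gradient_subset _ (subset_tsupport _ hz)
  have h2 : tsupport (scaledKernel k s) ⊆ Metric.closedBall 0 (2 * s) := by
    refine closure_minimal (fun y hy => ?_) Metric.isClosed_closedBall
    rw [mem_closedBall_zero_iff]
    exact hk.norm_le_of_scaled_ne_zero hs hy
  simpa using h2 h1

end IsMollifier

theorem IsTestFunction.integral_gradient {φ : Eucl n → ℝ} (hφ : IsTestFunction univ φ) :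
    ∫ x, gradient φ x = 0 := by
  refine ext_inner_left ℝ fun v => ?_
  have i2 := hφ.integrable_gradient
  rw [inner_zero_right, ← integral_inner i2]
  have e1 : ∀ x, inner ℝ v (gradient φ x) = (fun _ => (1 : ℝ)) x * fderiv ℝ φ x v := fun x => by
    rw [inner_gradient_right]; simp
  have j2 := i2.const_inner (𝕜 := ℝ) v
  simp only [e1] at j2 ⊢
  rw [integral_mul_fderiv_eq_neg_fderiv_mul_of_integrable (f := fun _ => (1 : ℝ))]
  · simp
  · simp
  · exact j2
  · simpa using hφ.integrable
  · exact fun x _ => differentiableAt_const _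
  · exact fun x _ => hφ.differentiable x

section

variable {E : Type*} [NormedAddCommGroup E] [NormedSpace ℝ E]

/-- Convolution of `f` with the kernel `k` at scale `s`. -/
noncomputable def mollify (k : Eucl n → ℝ) (s : ℝ) (f : Eucl n → E) (x : Eucl n) : E :=
  ∫ y, scaledKernel k s (x - y) • f y

theorem mollify_indicator (hΩ : IsOpen Ω) (k : Eucl n → ℝ) (s : ℝ) (f : Eucl n → E)
    (x : Eucl n) :
    mollify k s (Ω.indicator f) x = ∫ y in Ω, scaledKernel k s (x - y) • f y := by
  rw [mollify, ← integral_indicator hΩ.measurableSet]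
  refine integral_congr_ae (Eventually.of_forall fun y => ?_)
  by_cases hy : y ∈ Ω <;> simp [hy]

theorem mollify_eq_convolution (k : Eucl n → ℝ) (s : ℝ) (f : Eucl n → E) :
    mollify k s f = convolution f (scaledKernel k s) (ContinuousLinearMap.lsmul ℝ ℝ).flip
      volume := by
  ext x
  simp [mollify, convolution_def]

variable {k : Eucl n → ℝ} {s : ℝ} {f : Eucl n → E}

theorem IsMollifier.continuous_mollify (hk : IsMollifier k) (hs : 0 < s) (hf : Integrable f) :
    Continuous (mollify k s f) := by
  rw [mollify_eq_convolution]
  have := hk.scaled_isTestFunction hs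
  exact this.2.1.continuous_convolution_right _ hf.locallyIntegrable this.1.continuous

theorem IsMollifier.integrable_kernel_smul (hk : IsMollifier k) (hs : 0 < s)
    (hf : Integrable f) (x : Eucl n) : Integrable fun y => scaledKernel k s (x - y) • f y := by
  have hT := hk.scaled_isTestFunction hs
  obtain ⟨C, hC⟩ := hT.exists_bound
  have := integrableOn_smul_of_bound (S := univ) (f := fun y => scaledKernel k s (x - y))
    hf.integrableOn (hT.1.continuous.comp (by fun_prop)) ⟨C, fun y => hC _⟩
  simpa using this

/-- Mollification is a contraction of `L¹`. -/
theorem IsMollifier.lintegral_mollify_le (hk : IsMollifier k) (hs : 0 < s)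
    (hf : Integrable f) : ∫⁻ x, ‖mollify k s f x‖ₑ ≤ ∫⁻ x, ‖f x‖ₑ := by
  have hT := hk.scaled_isTestFunction hs
  calc ∫⁻ x, ‖mollify k s f x‖ₑ
      ≤ ∫⁻ x, ∫⁻ y, ‖scaledKernel k s (x - y)‖ₑ * ‖f y‖ₑ := by
        refine lintegral_mono fun x => (enorm_integral_le_lintegral_enorm _).trans_eq ?_
        simp only [enorm_smul]
    _ = ∫⁻ y, ∫⁻ x, ‖scaledKernel k s (x - y)‖ₑ * ‖f y‖ₑ := by
        refine lintegral_lintegral_swap ?_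
        have hc : Continuous fun p : Eucl n × Eucl n => scaledKernel k s (p.1 - p.2) :=
          hT.1.continuous.comp (by fun_prop)
        exact hc.enorm.measurable.aemeasurable.mul hf.aestronglyMeasurable.comp_snd.enorm
    _ = ∫⁻ y, ‖f y‖ₑ := by
        refine lintegral_congr fun y => ?_
        rw [lintegral_mul_const' _ _ enorm_ne_top]
        have : ∫⁻ x, ‖scaledKernel k s (x - y)‖ₑ = 1 := by
          rw [lintegral_sub_right_eq_self (fun x => ‖scaledKernel k s x‖ₑ),
            ← ofReal_integral_norm_eq_lintegral_enorm hT.integrable]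
          have : ∀ x, ‖scaledKernel k s x‖ = scaledKernel k s x := fun x =>
            Real.norm_of_nonneg (hk.scaled_nonneg hs x)
          simp only [this, hk.integral_scaled hs, ENNReal.ofReal_one]
        rw [this, one_mul]

theorem IsMollifier.norm_mollify_sub_le [CompleteSpace E] (hk : IsMollifier k) (hs : 0 < s)
    (hf : Integrable f)
    (x : Eucl n) {ε : ℝ} (hε : ∀ y, ‖x - y‖ ≤ 2 * s → ‖f y - f x‖ ≤ ε) :
    ‖mollify k s f x - f x‖ ≤ ε := by
  have hT := hk.scaled_isTestFunction hs
  have hTx : Integrable fun y => scaledKernel k s (x - y) := hT.integrable.comp_sub_left x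
  have e : mollify k s f x - f x = ∫ y, scaledKernel k s (x - y) • (f y - f x) := by
    simp only [smul_sub]
    rw [integral_sub (hk.integrable_kernel_smul hs hf x) (hTx.smul_const _), integral_smul_const,
      hk.integral_scaled_sub hs, one_smul, mollify]
  rw [e]
  calc ‖∫ y, scaledKernel k s (x - y) • (f y - f x)‖
      ≤ ∫ y, scaledKernel k s (x - y) * ε := by
        refine norm_integral_le_of_norm_le (hTx.mul_const ε) (Eventually.of_forall fun y => ?_)
        rw [norm_smul, Real.norm_of_nonneg (hk.scaled_nonneg hs _)]
        rcases eq_or_ne (scaledKernel k s (x - y)) 0 with h0 | h0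
        · simp [h0]
        · exact mul_le_mul_of_nonneg_left (hε y (hk.norm_le_of_scaled_ne_zero hs h0))
            (hk.scaled_nonneg hs _)
    _ = ε := by rw [integral_mul_const, hk.integral_scaled_sub hs, one_mul]

/-- Convergence of mollifications of continuous functions with compact support. -/
theorem IsMollifier.tendsto_mollify_of_continuous [CompleteSpace E] (hk : IsMollifier k)
    {g : Eucl n → E}
    (hg : Continuous g) (hgc : HasCompactSupport g) :
    Tendsto (fun s => ∫⁻ x, ‖mollify k s g x - g x‖ₑ) (𝓝[>] 0) (𝓝 0) := by
  have hgi : Integrable g := hg.integrable_of_hasCompactSupport hgc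
  have huc : UniformContinuous g := hgc.uniformContinuous_of_continuous hg
  -- For `s < 1` the kernel reaches at most distance `2 * s < 2`, so outside this compact set both
  -- `g` and its mollification vanish.
  set S := Metric.cthickening 2 (tsupport g) with hS
  have hSc : IsCompact S := IsCompact.cthickening hgc
  set V := volume S with hV
  have hVtop : V ≠ ⊤ := hSc.measure_lt_top.ne
  rw [ENNReal.tendsto_nhds_zero]
  intro ε hε
  obtain ⟨δ, hδ, hδε⟩ : ∃ δ : ℝ, 0 < δ ∧ ENNReal.ofReal δ * V ≤ ε := by
    rcases eq_or_ne ε ⊤ with rfl | hεt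
    · exact ⟨1, one_pos, le_top⟩
    · refine ⟨(ε / (V + 1)).toReal, ?_, ?_⟩
      · refine ENNReal.toReal_pos (ENNReal.div_pos hε.ne' (by simp [hVtop])).ne' ?_
        exact (ENNReal.div_lt_top hεt (by simp)).ne
      · rw [ENNReal.ofReal_toReal (ENNReal.div_lt_top hεt (by simp)).ne]
        calc ε / (V + 1) * V ≤ ε / (V + 1) * (V + 1) := by gcongr; exact le_self_add
          _ ≤ ε := (ENNReal.div_mul_cancel (by simp) (by simp [hVtop])).le
  obtain ⟨η, hη, hηδ⟩ := Metric.uniformContinuous_iff.1 huc δ hδ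
  have hev : ∀ᶠ s : ℝ in 𝓝[>] 0, s ∈ Ioo 0 (min 1 (η / 2)) :=
    Ioo_mem_nhdsGT (lt_min one_pos (half_pos hη))
  filter_upwards [hev] with s hs
  have hs1 : s < 1 := hs.2.trans_le (min_le_left _ _)
  have hs2 : 2 * s < η := by
    have := hs.2.trans_le (min_le_right _ _)
    linarith
  refine le_trans ?_ hδε
  calc ∫⁻ x, ‖mollify k s g x - g x‖ₑ
      ≤ ∫⁻ x, S.indicator (fun _ => ENNReal.ofReal δ) x := by
        refine lintegral_mono fun x => ?_
        by_cases hx : x ∈ S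
        · rw [indicator_of_mem hx, ← ofReal_norm]
          refine ENNReal.ofReal_le_ofReal (hk.norm_mollify_sub_le hs.1 hgi x fun y hy => ?_)
          rw [← dist_eq_norm]
          refine (hηδ ?_).le
          rw [dist_comm, dist_eq_norm]
          linarith
        · rw [indicator_of_notMem hx]
          have h0 : ∀ y, ‖x - y‖ ≤ 2 * s → g y = 0 := fun y hy => by
            by_contra h
            refine hx (Metric.mem_cthickening_of_dist_le x y 2 _ (subset_tsupport _ h) ?_)
            rw [dist_eq_norm]
            linarith
          have := hk.norm_mollify_sub_le hs.1 hgi x (ε := 0) fun y hy => by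
            rw [h0 y hy, h0 x (by simp [hs.1.le]), sub_zero, norm_zero]
          rw [← ofReal_norm]
          simpa using this
    _ = ENNReal.ofReal δ * V := by
        rw [lintegral_indicator_const hSc.isClosed.measurableSet]

/-- Mollifications converge in `L¹`. -/
theorem IsMollifier.tendsto_mollify [CompleteSpace E] (hk : IsMollifier k) (hf : Integrable f) :
    Tendsto (fun s => ∫⁻ x, ‖mollify k s f x - f x‖ₑ) (𝓝[>] 0) (𝓝 0) := by
  rw [ENNReal.tendsto_nhds_zero]
  intro ε hε
  have hε3 : ε / 3 ≠ 0 := (ENNReal.div_pos hε.ne' (by simp)).ne'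
  obtain ⟨g, hgc, hfg, hg, hgi⟩ := hf.exists_hasCompactSupport_lintegral_sub_le hε3
  have hev := (ENNReal.tendsto_nhds_zero.1 (hk.tendsto_mollify_of_continuous hg hgc)) (ε / 3)
    (pos_iff_ne_zero.2 hε3)
  filter_upwards [hev, self_mem_nhdsWithin] with s h1 hs
  have hs0 : 0 < s := hs
  have hfgi : Integrable fun x => f x - g x := hf.sub hgi
  have e : ∀ x, mollify k s f x - f x =
      mollify k s (fun y => f y - g y) x + ((mollify k s g x - g x) - (f x - g x)) := by
    intro x
    have : mollify k s (fun y => f y - g y) x = mollify k s f x - mollify k s g x := by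
      simp only [mollify, smul_sub]
      exact integral_sub (hk.integrable_kernel_smul hs0 hf x) (hk.integrable_kernel_smul hs0 hgi x)
    rw [this]
    abel
  have m1 : AEMeasurable (fun x => ‖mollify k s (fun y => f y - g y) x‖ₑ) :=
    (hk.continuous_mollify hs0 hfgi).enorm.measurable.aemeasurable
  have m2 : AEMeasurable (fun x => ‖mollify k s g x - g x‖ₑ) :=
    ((hk.continuous_mollify hs0 hgi).sub hg).enorm.measurable.aemeasurable
  calc ∫⁻ x, ‖mollify k s f x - f x‖ₑ
      ≤ ∫⁻ x, (‖mollify k s (fun y => f y - g y) x‖ₑ +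
          (‖mollify k s g x - g x‖ₑ + ‖f x - g x‖ₑ)) := by
        refine lintegral_mono fun x => ?_
        rw [e x]
        refine (enorm_add_le _ _).trans ?_
        gcongr
        exact enorm_sub_le
    _ = (∫⁻ x, ‖mollify k s (fun y => f y - g y) x‖ₑ) +
          ((∫⁻ x, ‖mollify k s g x - g x‖ₑ) + ∫⁻ x, ‖f x - g x‖ₑ) := by
        rw [lintegral_add_left' m1, lintegral_add_left' m2]
    _ ≤ ε / 3 + (ε / 3 + ε / 3) := by
        gcongr
        exact (hk.lintegral_mollify_le hs0 hfgi).trans hfg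
    _ = ε := by rw [← add_assoc, ENNReal.add_thirds]

end

/-! ### Mollification of Sobolev functions -/

section

variable {k : Eucl n → ℝ} {s : ℝ} {f : Eucl n → ℝ} {G : Eucl n → Eucl n}

theorem IsMollifier.contDiff_mollify (hk : IsMollifier k) (hs : 0 < s) (hf : Integrable f) :
    ContDiff ℝ ∞ (mollify k s f) := by
  rw [mollify_eq_convolution]
  have := hk.scaled_isTestFunction hs
  exact this.2.1.contDiff_convolution_right _ hf.locallyIntegrable this.1

theorem gradient_comp_sub_left {g : Eucl n → ℝ} (hg : Differentiable ℝ g) (x y : Eucl n) :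
    gradient (fun y => g (x - y)) y = -gradient g (x - y) := by
  have h : HasFDerivAt (fun y => g (x - y)) _ y :=
    (hg (x - y)).hasFDerivAt.comp y ((hasFDerivAt_id y).const_sub x)
  simp only [gradient_eq_toDual_symm]
  rw [h.fderiv, ContinuousLinearMap.comp_neg, ContinuousLinearMap.comp_id, map_neg]

/-- The derivative falls on the kernel, so integrability of `f` is enough. -/
theorem IsMollifier.gradient_mollify_eq (hk : IsMollifier k) (hs : 0 < s) (hf : Integrable f)
    (x : Eucl n) :
    gradient (mollify k s f) x = ∫ y, f y • gradient (scaledKernel k s) (x - y) := by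
  have hT := hk.scaled_isTestFunction hs
  have hi : Integrable fun y => f y • gradient (scaledKernel k s) (x - y) := by
    obtain ⟨C, hC⟩ := hT.exists_bound_gradient
    have := integrableOn_smul_of_bound' (S := univ)
      (K := fun y => gradient (scaledKernel k s) (x - y)) hf.integrableOn
      (hT.continuous_gradient.comp (by fun_prop)) ⟨C, fun y => hC _⟩
    simpa using this
  refine ext_inner_right ℝ fun v => ?_
  rw [inner_gradient_left, real_inner_comm, ← integral_inner hi, mollify_eq_convolution,
    (hT.2.1.hasFDerivAt_convolution_right _ hf.locallyIntegrable (hT.1.of_le (by simp)) x).fderiv,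
    convolution_precompR_apply _ hf.locallyIntegrable (hT.2.1.fderiv ℝ)
      (hT.1.continuous_fderiv (by simp)), convolution_def]
  refine integral_congr_ae (Eventually.of_forall fun y => ?_)
  simp only [inner_smul_right, inner_gradient_right]
  simp [mul_comm]

/-- Mollification commutes with the gradient. -/
theorem HasZeroExtGradient.gradient_mollify (hΩ : IsOpen Ω) (hf : HasZeroExtGradient Ω f G)
    (hk : IsMollifier k) (hs : 0 < s) (x : Eucl n) :
    gradient (mollify k s (Ω.indicator f)) x = mollify k s (Ω.indicator G) x := by
  have hT := hk.scaled_isTestFunction hs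
  rw [hk.gradient_mollify_eq hs (hf.1.integrable_indicator hΩ.measurableSet),
    mollify_indicator hΩ]
  have hψ : IsTestFunction univ fun y => scaledKernel k s (x - y) :=
    ⟨hT.1.comp (by fun_prop), hT.2.1.comp_homeomorph (Homeomorph.subLeft x), subset_univ _⟩
  have h1 := hf.2.2 _ hψ
  simp only [gradient_comp_sub_left hT.differentiable, smul_neg, integral_neg, neg_inj] at h1
  rw [← h1, ← integral_indicator hΩ.measurableSet]
  refine integral_congr_ae (Eventually.of_forall fun y => ?_)
  by_cases hy : y ∈ Ω <;> simp [hy]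

/-- The size of the gradient of the mollification of a Hölder function. -/
theorem IsMollifier.norm_gradient_mollify_le (hk : IsMollifier k) (hs : 0 < s)
    (hf : Integrable f) {A γ : ℝ≥0} (hA : HolderWith A γ f) (x : Eucl n) :
    ‖gradient (mollify k s f) x‖ ≤ A * (2 * s) ^ (γ : ℝ) * (s⁻¹ * ∫ z, ‖gradient k z‖) := by
  have hT := hk.scaled_isTestFunction hs
  have hgi : Integrable fun y => gradient (scaledKernel k s) (x - y) :=
    hT.integrable_gradient.comp_sub_left x
  have h0 : ∫ y, gradient (scaledKernel k s) (x - y) = 0 := by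
    rw [integral_sub_left_eq_self (gradient (scaledKernel k s)), hT.integral_gradient]
  have hi : Integrable fun y => f y • gradient (scaledKernel k s) (x - y) := by
    obtain ⟨C, hC⟩ := hT.exists_bound_gradient
    have := integrableOn_smul_of_bound' (S := univ)
      (K := fun y => gradient (scaledKernel k s) (x - y)) hf.integrableOn
      (hT.continuous_gradient.comp (by fun_prop)) ⟨C, fun y => hC _⟩
    simpa using this
  -- The gradient of the kernel has integral zero, so `f x` may be subtracted. The Hölder bound then
  -- gains s^γ against the factor s⁻¹ from scaling.
  have e : gradient (mollify k s f) x =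
      ∫ y, (f y - f x) • gradient (scaledKernel k s) (x - y) := by
    simp only [sub_smul]
    rw [integral_sub (g := fun y => f x • gradient (scaledKernel k s) (x - y)) hi
      (hgi.smul (f x)), integral_smul, h0, smul_zero, sub_zero,
      hk.gradient_mollify_eq hs hf]
  rw [e, ← hk.integral_norm_gradient_scaled hs x, ← integral_const_mul]
  refine norm_integral_le_of_norm_le (hgi.norm.const_mul _) (Eventually.of_forall fun y => ?_)
  rw [norm_smul]
  rcases eq_or_ne (gradient (scaledKernel k s) (x - y)) 0 with hz | hz
  · simp [hz]
  · have hxy := hk.norm_le_of_gradient_scaled_ne_zero hs hz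
    gcongr
    rw [← dist_eq_norm]
    refine (hA.dist_le y x).trans ?_
    rw [dist_comm, dist_eq_norm]
    gcongr

end

end Lavrentiev

namespace Lavrentiev

open Filter

variable {n : ℕ} {Ω : Set (Eucl n)} {M : Eucl n → Eucl n → ℝ}

/-! ### Modular convergence of mollifications under the balance condition. -/

theorem FiniteModulars.integrableOn (hΩ : IsOpen Ω) (hM : IsWeakNFunction Ω M)
    {G : Eucl n → Eucl n} (hG : FiniteModulars Ω M G) (c : ℝ) :
    IntegrableOn (fun y => M y (c • G y)) Ω := by
  have h1 : AEStronglyMeasurable (fun y => M y (c • G y)) (volume.restrict Ω) :=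
    (aemeasurable_caratheodory hM.measurable hM.continuous
      (hG.1.const_smul c).aemeasurable).aestronglyMeasurable
  refine (lintegral_ofReal_ne_top_iff_integrable h1 ?_).1 (hG.2 c)
  filter_upwards [hM.ae_isYoung hΩ] with x hx
  exact hx.nonneg _

/-- Eventual smallness of `s^(γ-1)` compared with the threshold of the balance condition. -/
theorem eventually_rpow_le_threshold {Θ : ℝ → ℝ} {γ : ℝ≥0} (hΘ : ∀ r ∈ Ioc (0 : ℝ) 1, 0 < Θ r)
    (ho : (fun r => (Θ r)⁻¹) =o[𝓝[>] (0 : ℝ)] fun r => r ^ (1 - (γ : ℝ))) {T : ℝ} (hT : 0 ≤ T) :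
    ∀ᶠ s in 𝓝[>] (0 : ℝ), 5 * s ≤ 1 ∧ T * ((2 * s) ^ (γ : ℝ) * s⁻¹) ≤ Θ (5 * s) := by
  -- The radius is `r = 5 * s` because the kernel reaches `2 * s`, which must be less than `r / 2`.
  have h5 : Tendsto (fun s : ℝ => 5 * s) (𝓝[>] 0) (𝓝[>] 0) := by
    refine tendsto_nhdsWithin_iff.2 ⟨?_, ?_⟩
    · have : Tendsto (fun s : ℝ => 5 * s) (𝓝 0) (𝓝 (5 * 0)) := tendsto_id.const_mul 5
      rw [mul_zero] at this
      exact this.mono_left nhdsWithin_le_nhds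
    · filter_upwards [self_mem_nhdsWithin] with s hs
      have : (0 : ℝ) < s := hs
      exact mem_Ioi.2 (by positivity)
  have hT' : 0 < T * 5 + 1 := by positivity
  have h1 := h5.eventually (ho.def (inv_pos.2 hT'))
  have h2 : ∀ᶠ s in 𝓝[>] (0 : ℝ), s ∈ Ioo (0 : ℝ) (1 / 5) := Ioo_mem_nhdsGT (by norm_num)
  filter_upwards [h1, h2] with s hs hs2
  have hs0 : 0 < s := hs2.1
  have hr1 : 5 * s ≤ 1 := by linarith [hs2.2]
  refine ⟨hr1, ?_⟩
  set r := 5 * s with hr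
  have hr0 : 0 < r := by positivity
  have hΘr := hΘ r ⟨hr0, hr1⟩
  rw [Real.norm_of_nonneg (by positivity), Real.norm_of_nonneg (by positivity)] at hs
  have h3 : T * 5 + 1 ≤ Θ r * r ^ (1 - (γ : ℝ)) := by
    rw [inv_le_iff_one_le_mul₀ hΘr] at hs
    have := mul_le_mul_of_nonneg_left hs hT'.le
    rw [mul_one] at this
    refine this.trans_eq ?_
    field_simp
  have h4 : (2 * s) ^ (γ : ℝ) ≤ r ^ (γ : ℝ) :=
    Real.rpow_le_rpow (by positivity) (by rw [hr]; linarith) γ.2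
  have h5 : s⁻¹ = 5 * r⁻¹ := by rw [hr]; field_simp
  have h6 : r ^ (1 - (γ : ℝ)) * (r ^ (γ : ℝ) * r⁻¹) = 1 := by
    rw [← mul_assoc, ← Real.rpow_add hr0, sub_add_cancel, Real.rpow_one,
      mul_inv_cancel₀ hr0.ne']
  calc T * ((2 * s) ^ (γ : ℝ) * s⁻¹) ≤ T * (r ^ (γ : ℝ) * s⁻¹) := by gcongr
    _ = (T * 5) * (r ^ (γ : ℝ) * r⁻¹) := by rw [h5]; ring
    _ ≤ (Θ r * r ^ (1 - (γ : ℝ))) * (r ^ (γ : ℝ) * r⁻¹) := by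
        refine mul_le_mul_of_nonneg_right (by linarith) (by positivity)
    _ = Θ r := by rw [mul_assoc, h6, mul_one]

/-- Under the balance condition, mollification approximates a function that is Hölder continuous
on `ℝⁿ` after extension by zero, provided the mollified functions have compact support in `Ω`. -/
theorem HasZeroExtGradient.approxByTest (hΩ : IsOpen Ω) (hb : Bornology.IsBounded Ω)
    (hM : IsWeakNFunction Ω M) {γ : ℝ≥0} (hB : BGenPlus Ω M γ)
    {f : Eucl n → ℝ} {G : Eucl n → Eucl n} (hf : HasZeroExtGradient Ω f G)
    (hG : FiniteModulars Ω M G) {A : ℝ≥0} (hA : HolderWith A γ (Ω.indicator f))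
    {k : Eucl n → ℝ} (hk : IsMollifier k) {s₀ : ℝ} (hs₀ : 0 < s₀)
    (hsupp : ∀ s ∈ Ioo 0 s₀, ∃ K, IsCompact K ∧ K ⊆ Ω ∧ ∀ x ∉ K, ∀ y ∈ Ω, f y ≠ 0 →
      scaledKernel k s (x - y) = 0) : ApproxByTest Ω M f G := by
  intro c ε hε
  obtain ⟨C, D, Θ, hC, hD, hΘ, ho, hJ⟩ := hB.exists_jensen hΩ
  set f' := Ω.indicator f with hf'
  set G' := Ω.indicator G with hG'
  have hfi : Integrable f' := hf.1.integrable_indicator hΩ.measurableSet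
  have hGi : Integrable G' := hf.2.1.integrable_indicator hΩ.measurableSet
  -- The factor 2 comes from splitting off `c • G`, and `C` compensates the `C⁻¹` in Jensen's
  -- inequality.
  set H : Eucl n → ℝ := fun y => M y ((2 * c * C) • G y) with hH
  have hHi : IntegrableOn H Ω := hG.integrableOn hΩ hM _
  set H' := Ω.indicator H with hH'
  have hHi' : Integrable H' := hHi.integrable_indicator hΩ.measurableSet
  set T := |2 * c| * C * A * ∫ z, ‖gradient k z‖ with hT
  have hT0 : 0 ≤ T := by
    have : 0 ≤ ∫ z, ‖gradient k z‖ := integral_nonneg fun _ => norm_nonneg _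
    positivity
  have hev : ∀ᶠ s in 𝓝[>] (0 : ℝ), s ∈ Ioo 0 s₀ ∧
      5 * s ≤ 1 ∧ T * ((2 * s) ^ (γ : ℝ) * s⁻¹) ≤ Θ (5 * s) :=
    Filter.Eventually.and (Ioo_mem_nhdsGT hs₀)
      (eventually_rpow_le_threshold hΘ ho hT0)
  obtain ⟨σ, hσ, hσp⟩ := exists_seq_forall_of_frequently hev.frequently
  have hσ0 : ∀ i, 0 < σ i := fun i => (hσp i).1.1
  have hφ : ∀ i, IsTestFunction Ω (mollify k (σ i) f') := by
    intro i
    obtain ⟨K, hK, hKΩ, hK0⟩ := hsupp (σ i) (hσp i).1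
    have hz : ∀ x ∉ K, mollify k (σ i) f' x = 0 := by
      intro x hx
      refine integral_eq_zero_of_ae (Eventually.of_forall fun y => ?_)
      by_cases hy : y ∈ Ω
      · rcases eq_or_ne (f y) 0 with h0 | h0
        · simp [hf', hy, h0]
        · simp [hK0 x hx y hy h0]
      · simp [hf', hy]
    have hts : tsupport (mollify k (σ i) f') ⊆ K :=
      closure_minimal (fun x hx => by_contra fun h => hx (hz x h)) hK.isClosed
    exact ⟨hk.contDiff_mollify (hσ0 i) hfi, hK.of_isClosed_subset (isClosed_tsupport _) hts,
      hts.trans hKΩ⟩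
  have hgrad : ∀ i x, gradient (mollify k (σ i) f') x = mollify k (σ i) G' x := fun i x =>
    hf.gradient_mollify hΩ hk (hσ0 i) x
  have hrestrict : ∀ {E : Type} [NormedAddCommGroup E] [NormedSpace ℝ E] [CompleteSpace E]
      {u : Eucl n → E}, IntegrableOn u Ω →
      Tendsto (fun i => ∫⁻ x in Ω, ‖mollify k (σ i) (Ω.indicator u) x - u x‖ₑ) atTop (𝓝 0) := by
    intro E _ _ _ u hu
    have := (hk.tendsto_mollify (hu.integrable_indicator hΩ.measurableSet)).comp hσ
    refine tendsto_of_tendsto_of_tendsto_of_le_of_le tendsto_const_nhds this (fun _ => zero_le)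
      fun i => ?_
    refine le_trans (le_of_eq ?_) (setLIntegral_le_lintegral Ω _)
    refine setLIntegral_congr_fun hΩ.measurableSet fun x hx => ?_
    simp only [indicator_of_mem hx]
  have hmH : ∀ i, AEMeasurable (fun x => ‖mollify k (σ i) H' x - H x‖ₑ) (volume.restrict Ω) :=
    fun i => ((hk.continuous_mollify (hσ0 i) hHi').aestronglyMeasurable.sub
      hHi.aestronglyMeasurable).enorm
  have hmG : ∀ i, AEMeasurable (fun x => ‖mollify k (σ i) G' x - G x‖ₑ) (volume.restrict Ω) :=
    fun i => ((hk.continuous_mollify (hσ0 i) hGi).aestronglyMeasurable.sub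
      hG.1).enorm
  have hsum : Tendsto (fun i => ∫⁻ x in Ω, (‖mollify k (σ i) G' x - G x‖ₑ +
      ‖mollify k (σ i) H' x - H x‖ₑ)) atTop (𝓝 0) := by
    have := (hrestrict hf.2.1).add (hrestrict hHi)
    rw [add_zero] at this
    refine this.congr fun i => ?_
    rw [lintegral_add_left' (hmG i)]
  -- One subsequence serves two purposes: convergence of the gradients makes the integrand tend to
  -- zero, and convergence of the mollifications of `H` makes the variable part of the majorant tend
  -- to zero.
  obtain ⟨τ, hτ, hae⟩ := exists_subseq_ae_tendsto_zero
    (b := fun i x => ‖mollify k (σ i) G' x - G x‖ₑ + ‖mollify k (σ i) H' x - H x‖ₑ)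
    (fun i => (hmG i).add (hmH i)) hsum
  have key := tendsto_lintegral_of_le_add (μ := volume.restrict Ω)
    (f := fun i x => ENNReal.ofReal (M x (c • (G x - gradient (mollify k (σ (τ i)) f') x))))
    (b := fun i x => ‖mollify k (σ (τ i)) H' x - H x‖ₑ) (g := fun _ => 0)
    (a := fun x => ENNReal.ofReal (M x ((2 * c) • G x)) +
      (ENNReal.ofReal (H x) + ENNReal.ofReal D)) ?_ (fun i => hmH _) ?_ ?_ ?_ ?_ ?_
  · rw [lintegral_zero] at key
    have e1 := eventually_lt_of_limsup_lt (key.trans_lt hε)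
    have e2 := ((hrestrict hf.1).comp hτ.tendsto_atTop).eventually_lt_const hε
    obtain ⟨i, h1, h2⟩ := (e1.and e2).exists
    refine ⟨_, hφ (τ i), ?_, h1⟩
    refine lt_of_le_of_lt (le_of_eq ?_) h2
    exact lintegral_congr fun x => enorm_sub_rev _ _
  · intro i
    exact hM.aemeasurable_comp ((hG.1.sub
      (hφ _).continuous_gradient.aestronglyMeasurable).const_smul c)
  · intro i
    have hr : 5 * σ (τ i) ∈ Ioc (0 : ℝ) 1 := ⟨by linarith [hσ0 (τ i)], (hσp (τ i)).2.1⟩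
    filter_upwards [hJ _ hr, hM.ae_isYoung hΩ, ae_restrict_mem hΩ.measurableSet]
      with x hx hY hxΩ
    set s := σ (τ i) with hs
    have hs0 : 0 < s := hσ0 _
    have hT' := hk.scaled_isTestFunction hs0
    set w : Eucl n → ℝ := fun y => scaledKernel k s (x - y) with hw
    have hwi : Integrable w := hT'.integrable.comp_sub_left x
    have hZ : ∫ y in Ω, w y • ((2 * c * C) • G y) =
        (2 * c * C) • gradient (mollify k s f') x := by
      rw [hgrad, mollify_indicator hΩ, ← integral_smul]
      refine integral_congr_ae (Eventually.of_forall fun y => ?_)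
      simp only [smul_smul, hw]
      rw [mul_comm]
    have h1 := hx w (fun y => (2 * c * C) • G y) (fun y => hk.scaled_nonneg hs0 _)
      hwi.integrableOn ?_ ?_ (AEStronglyMeasurable.const_smul hG.1 (2 * c * C)) ?_ ?_ ?_
    · have hcomb : M x (c • (G x - gradient (mollify k s f') x)) ≤
          M x ((2 * c) • G x) + (mollify k s H' x + D) := by
        have e : c • (G x - gradient (mollify k s f') x) =
            c • G x + -(c • gradient (mollify k s f') x) := by
          rw [smul_sub, sub_eq_add_neg]
        rw [e]
        refine (hY.add_le' _ _).trans ?_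
        rw [smul_neg, hY.even, smul_smul, smul_smul]
        have e2 : C⁻¹ • ∫ y in Ω, w y • ((2 * c * C) • G y) =
            (2 * c) • gradient (mollify k s f') x := by
          rw [hZ, smul_smul]
          congr 1
          field_simp
        rw [e2] at h1
        have e3 : mollify k s H' x = ∫ y in Ω, w y * M y ((2 * c * C) • G y) := by
          rw [mollify_indicator hΩ]
          rfl
        rw [e3]
        exact add_le_add le_rfl h1
      refine (ENNReal.ofReal_le_ofReal hcomb).trans ?_
      rw [add_assoc, add_assoc]
      refine ENNReal.ofReal_add_le.trans (add_le_add le_rfl ?_)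
      refine ENNReal.ofReal_add_le.trans ?_
      rw [add_comm (ENNReal.ofReal D), ← add_assoc]
      refine add_le_add ?_ le_rfl
      have : mollify k s H' x = H x + (mollify k s H' x - H x) := by ring
      rw [this]
      refine ENNReal.ofReal_add_le.trans ?_
      rw [add_sub_cancel_left]
      exact add_le_add le_rfl (Real.ofReal_le_enorm _)
    · calc ∫ y in Ω, w y ≤ ∫ y, w y :=
            setIntegral_le_integral hwi (Eventually.of_forall fun y => hk.scaled_nonneg hs0 _)
        _ = 1 := hk.integral_scaled_sub hs0 x
    · intro y hy
      have := hk.norm_le_of_scaled_ne_zero hs0 hy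
      rw [dist_comm, dist_eq_norm]
      linarith
    · have h0 : IntegrableOn (fun y => (2 * c * C) • G y) Ω :=
        Integrable.smul (2 * c * C) hf.2.1
      have h2 := hk.integrable_kernel_smul hs0 (h0.integrable_indicator hΩ.measurableSet) x
      refine (h2.integrableOn (s := Ω)).congr_fun (fun y hy => ?_) hΩ.measurableSet
      simp only [indicator_of_mem hy, hw]
    · have h2 := hk.integrable_kernel_smul hs0 hHi' x
      refine (h2.integrableOn (s := Ω)).congr_fun (fun y hy => ?_) hΩ.measurableSet
      simp only [hH', indicator_of_mem hy, hw, hH, smul_eq_mul]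
    · rw [hZ, norm_smul]
      refine le_trans ?_ (hσp (τ i)).2.2
      have h2 := hk.norm_gradient_mollify_le hs0 hfi hA x
      calc ‖2 * c * C‖ * ‖gradient (mollify k s f') x‖
          ≤ ‖2 * c * C‖ * (A * (2 * s) ^ (γ : ℝ) * (s⁻¹ * ∫ z, ‖gradient k z‖)) := by gcongr
        _ = T * ((2 * s) ^ (γ : ℝ) * s⁻¹) := by
            rw [norm_mul, Real.norm_eq_abs, Real.norm_of_nonneg hC.le, hT]
            ring
  · have m1 : AEMeasurable (fun x => ENNReal.ofReal (M x ((2 * c) • G x)))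
        (volume.restrict Ω) := hM.aemeasurable_comp (hG.1.const_smul (2 * c))
    rw [lintegral_add_left' m1, lintegral_add_right _ measurable_const, lintegral_const,
      Measure.restrict_apply_univ]
    exact ENNReal.add_ne_top.2 ⟨hG.2 _, ENNReal.add_ne_top.2 ⟨hG.2 _,
      ENNReal.mul_ne_top ENNReal.ofReal_ne_top hb.measure_lt_top.ne⟩⟩
  · filter_upwards [hae, hM.ae_isYoung hΩ] with x hx hY
    have h1 : Tendsto (fun i => ‖mollify k (σ (τ i)) G' x - G x‖ₑ) atTop (𝓝 0) :=
      tendsto_of_tendsto_of_tendsto_of_le_of_le tendsto_const_nhds hx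
        (fun _ => zero_le) fun i => le_self_add
    have h2 : Tendsto (fun i => gradient (mollify k (σ (τ i)) f') x) atTop (𝓝 (G x)) := by
      rw [tendsto_iff_edist_tendsto_0]
      refine h1.congr fun i => ?_
      rw [edist_eq_enorm_sub, hgrad]
    have h3 : Tendsto (fun i => c • (G x - gradient (mollify k (σ (τ i)) f') x)) atTop
        (𝓝 0) := by
      simpa using (h2.const_sub (G x)).const_smul c
    have h4 := (ENNReal.continuous_ofReal.tendsto _).comp ((hY.continuous.tendsto _).comp h3)
    rw [hY.zero, ENNReal.ofReal_zero] at h4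
    exact h4
  · filter_upwards [hae] with x hx
    exact tendsto_of_tendsto_of_tendsto_of_le_of_le tendsto_const_nhds hx
      (fun _ => zero_le) fun i => le_add_self
  · exact (hrestrict hHi).comp hτ.tendsto_atTop

end Lavrentiev

namespace Lavrentiev

open Filter

variable {n : ℕ} {Ω : Set (Eucl n)}

/-! ### Boundary charts -/

/-- A boundary chart: near `p`, the set `Ω` is `{h > 0}` for a Lipschitz function `h` that grows
with unit speed in the direction of the unit vector `e`. -/
structure IsBoundaryChart (Ω : Set (Eucl n)) (p e : Eucl n) (h : Eucl n → ℝ) (K : ℝ≥0) (r : ℝ) :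
    Prop where
  norm_e : ‖e‖ = 1
  lipschitz : LipschitzWith K h
  shift : ∀ (x : Eucl n) (t : ℝ), h (x + t • e) = h x + t
  pos : 0 < r
  zero : h p = 0
  mem_iff : ∀ x ∈ Metric.ball p r, x ∈ Ω ↔ 0 < h x

/-- Take h(x) = ⟨x, e⟩ - g(x). Its value at `p` is not positive because `p` lies outside the open
set Ω, and not negative because a neighbourhood of `p` would then miss Ω. -/
theorem IsBoundedLipschitzDomain.exists_chart (hΩ : IsBoundedLipschitzDomain Ω) {p : Eucl n}
    (hp : p ∈ frontier Ω) : ∃ e h K r, IsBoundaryChart Ω p e h K r := by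
  obtain ⟨e, g, K, r, he, hg, hge, hr, hΩr⟩ := hΩ.2.2.2 p hp
  have hinner : LipschitzWith 1 fun x : Eucl n => inner ℝ x e := by
    refine LipschitzWith.of_dist_le_mul fun x y => ?_
    rw [Real.dist_eq, ← inner_sub_left, NNReal.coe_one, one_mul, dist_eq_norm]
    refine (abs_real_inner_le_norm _ _).trans ?_
    rw [he, mul_one]
  have hmem : ∀ x ∈ Metric.ball p r, x ∈ Ω ↔ 0 < inner ℝ x e - g x := by
    intro x hx
    have : x ∈ Ω ∩ Metric.ball p r ↔ x ∈ {x | g x < inner ℝ x e} ∩ Metric.ball p r := by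
      rw [hΩr]
    simp only [mem_inter_iff, hx, and_true, mem_ofPred_eq] at this
    rw [this, sub_pos]
  have hlip := hinner.sub hg
  refine ⟨e, fun x => inner ℝ x e - g x, 1 + K, r, he, hlip, fun x t => ?_, hr, ?_, hmem⟩
  · rw [hge, inner_add_left, real_inner_smul_left, real_inner_self_eq_norm_sq, he]
    ring
  · refine le_antisymm ?_ ?_
    · have h1 : p ∉ Ω := fun h => hp.2 (by rwa [hΩ.1.interior_eq])
      exact not_lt.1 fun h => h1 ((hmem p (Metric.mem_ball_self hr)).2 h)
    · by_contra! hcon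
      have hopen : IsOpen ({x : Eucl n | inner ℝ x e - g x < 0} ∩ Metric.ball p r) :=
        (isOpen_lt hlip.continuous continuous_const).inter Metric.isOpen_ball
      obtain ⟨y, hy, hyΩ⟩ := mem_closure_iff.1 (frontier_subset_closure hp) _ hopen
        ⟨hcon, Metric.mem_ball_self hr⟩
      exact absurd ((hmem y hy.2).1 hyΩ) (not_lt.2 (le_of_lt hy.1))

namespace IsBoundaryChart

variable {p e : Eucl n} {h : Eucl n → ℝ} {K : ℝ≥0} {r : ℝ}

theorem shift_sub (hc : IsBoundaryChart Ω p e h K r) (x : Eucl n) (t : ℝ) :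
    h (x - t • e) = h x - t := by
  rw [sub_eq_add_neg, ← neg_smul, hc.shift]
  ring

/-- The distance to `p` in the directions orthogonal to `e`. -/
noncomputable def tangential (p e x : Eucl n) : ℝ :=
  ‖(x - p) - inner ℝ (x - p) e • e‖

theorem continuous_tangential : Continuous (tangential p e) := by
  unfold tangential
  fun_prop

theorem tangential_shift (hc : IsBoundaryChart Ω p e h K r) (x : Eucl n) (t : ℝ) :
    tangential p e (x + t • e) = tangential p e x := by
  have e1 : x + t • e - p = (x - p) + t • e := by abel
  rw [tangential, tangential, e1, inner_add_left, real_inner_smul_left,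
    real_inner_self_eq_norm_sq, hc.norm_e]
  congr 1
  rw [one_pow, mul_one, add_smul]
  abel

/-- Split `x - p` into a part orthogonal to `e` and a multiple of `e`. The multiple is the
difference of `h` at `x` and at the foot point, where `h` is controlled by the Lipschitz bound. -/
theorem dist_le (hc : IsBoundaryChart Ω p e h K r) (x : Eucl n) :
    dist x p ≤ tangential p e x + |h x| + K * tangential p e x := by
  set u := (x - p) - inner ℝ (x - p) e • e with hu
  set a := inner ℝ (x - p) e with ha
  have h1 : x = (p + u) + a • e := by rw [hu]; abel
  have h2 : h x = h (p + u) + a := by conv_lhs => rw [h1, hc.shift]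
  have h3 : |h (p + u)| ≤ K * ‖u‖ := by
    have := hc.lipschitz.dist_le_mul (p + u) p
    rw [Real.dist_eq, hc.zero, sub_zero, dist_eq_norm, add_sub_cancel_left] at this
    exact this
  have h4 : |a| ≤ |h x| + K * ‖u‖ := by
    have : a = h x - h (p + u) := by rw [h2]; ring
    rw [this]
    exact (abs_sub _ _).trans (by gcongr)
  have h5 : x - p = u + a • e := by rw [hu]; abel
  rw [dist_eq_norm, h5]
  refine (norm_add_le _ _).trans ?_
  rw [norm_smul, hc.norm_e, mul_one, Real.norm_eq_abs]
  have : tangential p e x = ‖u‖ := rfl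
  rw [this]
  linarith

/-- The part of `Ω` near `p` of height at most `t` over the boundary. -/
def layer (p e : Eucl n) (h : Eucl n → ℝ) (σ t : ℝ) : Set (Eucl n) :=
  {x | tangential p e x < σ ∧ 0 < h x ∧ h x ≤ t}

theorem measurableSet_layer (hc : IsBoundaryChart Ω p e h K r) (σ t : ℝ) :
    MeasurableSet (layer p e h σ t) :=
  (isOpen_lt continuous_tangential continuous_const).measurableSet.inter
    ((isOpen_lt continuous_const hc.lipschitz.continuous).measurableSet.inter
      (isClosed_le hc.lipschitz.continuous continuous_const).measurableSet)

theorem mem_ball_of_tangential_lt (hc : IsBoundaryChart Ω p e h K r) {σ ρ : ℝ}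
    (hσ : (2 + K) * σ ≤ ρ) {x : Eucl n} (hx : tangential p e x < σ) (hhx : |h x| ≤ σ) :
    x ∈ Metric.ball p ρ := by
  have h1 := hc.dist_le x
  have h2 : K * tangential p e x ≤ K * σ := by gcongr
  rw [Metric.mem_ball]
  nlinarith

theorem layer_subset (hc : IsBoundaryChart Ω p e h K r) {σ t : ℝ} (hσ : (2 + K) * σ ≤ r)
    (ht : t ≤ σ) : layer p e h σ t ⊆ Ω := by
  rintro x ⟨h1, h2, h3⟩
  have hb := hc.mem_ball_of_tangential_lt hσ h1 (by rw [abs_of_pos h2]; linarith)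
  exact (hc.mem_iff x hb).2 h2

/-- The slice between heights `N * t` and `(N + 1) * t` is a translate along `e` of a part of the
lowest layer. The estimate serves as a lower bound, linear in the thickness, for the volume of thin
layers. -/
theorem volume_layer_le (hc : IsBoundaryChart Ω p e h K r) (σ : ℝ) (t : ℝ) (N : ℕ) :
    volume (layer p e h σ (N * t)) ≤ N * volume (layer p e h σ t) := by
  induction N with
  | zero =>
    have : layer p e h σ ((0 : ℕ) * t) = ∅ := by
      ext x
      simp only [layer, mem_ofPred_eq, mem_empty_iff_false, iff_false]
      rintro ⟨-, h1, h2⟩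
      simp only [Nat.cast_zero, zero_mul] at h2
      linarith
    rw [this]
    simp
  | succ N ih =>
    have hsub : layer p e h σ ((N + 1 : ℕ) * t) ⊆ layer p e h σ (N * t) ∪
        (fun x => x + -((N * t) • e)) ⁻¹' layer p e h σ t := by
      rintro x ⟨h1, h2, h3⟩
      rcases le_or_gt (h x) (N * t) with h4 | h4
      · exact Or.inl ⟨h1, h2, h4⟩
      · refine Or.inr ⟨?_, ?_, ?_⟩
        · rw [← neg_smul, hc.tangential_shift]
          exact h1
        · rw [← neg_smul, hc.shift]
          linarith
        · rw [← neg_smul, hc.shift]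
          push_cast at h3
          linarith
    refine (measure_mono hsub).trans ((measure_union_le _ _).trans ?_)
    rw [measure_preimage_add_right, Nat.cast_add, Nat.cast_one, add_mul, one_mul]
    gcongr

theorem volume_layer_pos (hc : IsBoundaryChart Ω p e h K r) {σ : ℝ} (hσ : 0 < σ) :
    0 < volume (layer p e h σ σ) := by
  have hopen : IsOpen {x | tangential p e x < σ ∧ 0 < h x ∧ h x < σ} :=
    (isOpen_lt continuous_tangential continuous_const).inter
      ((isOpen_lt continuous_const hc.lipschitz.continuous).inter
        (isOpen_lt hc.lipschitz.continuous continuous_const))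
  have hne : {x | tangential p e x < σ ∧ 0 < h x ∧ h x < σ}.Nonempty := by
    refine ⟨p + (σ / 2) • e, ?_, ?_, ?_⟩
    · rw [hc.tangential_shift]
      simpa [tangential] using hσ
    · rw [hc.shift, hc.zero]
      linarith
    · rw [hc.shift, hc.zero]
      linarith
  exact (hopen.measure_pos volume hne).trans_le
    (measure_mono fun x hx => ⟨hx.1, hx.2.1, hx.2.2.le⟩)

/-- A Poincaré inequality on the boundary layer for test functions. -/
theorem lintegral_layer_le (hc : IsBoundaryChart Ω p e h K r) {σ t : ℝ} (hσ : (2 + K) * σ ≤ r)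
    (ht0 : 0 ≤ t) (ht : t ≤ σ) {φ : Eucl n → ℝ} (hφ : IsTestFunction Ω φ) :
    ∫⁻ x in layer p e h σ t, ‖φ x‖ₑ ≤
      ENNReal.ofReal t * ∫⁻ x in layer p e h σ t, ‖gradient φ x‖ₑ := by
  set S := layer p e h σ t with hS
  have hSm : MeasurableSet S := hc.measurableSet_layer σ t
  have hout : ∀ x, tangential p e x < σ → h x ≤ 0 → -σ ≤ h x → x ∉ Ω := by
    intro x h1 h2 h3 hx
    have hb := hc.mem_ball_of_tangential_lt hσ h1 (abs_le.2 ⟨h3, by linarith⟩)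
    exact absurd ((hc.mem_iff x hb).1 hx) (not_lt.2 h2)
  have hgc := hφ.continuous_gradient
  have hpt : ∀ x ∈ S, ‖φ x‖ₑ ≤ ∫⁻ τ in Ioc 0 t, ‖gradient φ (x - τ • e)‖ₑ := by
    rintro x ⟨h1, h2, h3⟩
    -- Descending by `t` from a point of height at most `t` leaves Ω but stays in the chart ball, so
    -- `φ x` is the integral of its derivative along that segment.
    have hz : φ (x - t • e) = 0 := by
      refine hφ.eq_zero (hout _ ?_ ?_ ?_)
      · rw [sub_eq_add_neg, ← neg_smul, hc.tangential_shift]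
        exact h1
      · rw [hc.shift_sub]
        linarith
      · rw [hc.shift_sub]
        linarith
    have hder : ∀ τ : ℝ, HasDerivAt (fun τ => φ (x - τ • e)) (fderiv ℝ φ (x - τ • e) (-e)) τ := by
      intro τ
      have h4 : HasDerivAt (fun τ : ℝ => x - τ • e) (-e) τ := by
        have := ((hasDerivAt_id τ).smul_const e).const_sub x
        simpa using this
      exact (hφ.differentiable _).hasFDerivAt.comp_hasDerivAt τ h4
    have hcont : Continuous fun τ : ℝ => fderiv ℝ φ (x - τ • e) (-e) := by
      have := hφ.1.continuous_fderiv (by simp)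
      exact (this.comp (by fun_prop)).clm_apply continuous_const
    have hint := intervalIntegral.integral_eq_sub_of_hasDerivAt (fun τ _ => hder τ)
      (hcont.intervalIntegrable 0 t)
    rw [hz, zero_smul, sub_zero, zero_sub, intervalIntegral.integral_of_le ht0] at hint
    have : φ x = -∫ τ in Ioc 0 t, fderiv ℝ φ (x - τ • e) (-e) := by rw [hint, neg_neg]
    rw [this, enorm_neg]
    refine (enorm_integral_le_lintegral_enorm _).trans (lintegral_mono fun τ => ?_)
    rw [← ofReal_norm, ← ofReal_norm]
    refine ENNReal.ofReal_le_ofReal (((fderiv ℝ φ (x - τ • e)).le_opNorm _).trans ?_)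
    rw [norm_neg, hc.norm_e, mul_one, norm_gradient]
  calc ∫⁻ x in S, ‖φ x‖ₑ
      ≤ ∫⁻ x in S, ∫⁻ τ in Ioc 0 t, ‖gradient φ (x - τ • e)‖ₑ := setLIntegral_mono' hSm hpt
    _ = ∫⁻ τ in Ioc 0 t, ∫⁻ x in S, ‖gradient φ (x - τ • e)‖ₑ := by
        refine lintegral_lintegral_swap ?_
        have : Continuous fun q : Eucl n × ℝ => gradient φ (q.1 - q.2 • e) :=
          hgc.comp (by fun_prop)
        exact this.enorm.measurable.aemeasurable
    _ ≤ ∫⁻ _ in Ioc 0 t, ∫⁻ x in S, ‖gradient φ x‖ₑ := by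
        -- A downward translate of the layer lies in the layer except for points of nonpositive
        -- height, which are outside Ω, where the gradient vanishes.
        refine setLIntegral_mono' measurableSet_Ioc fun τ hτ => ?_
        rw [← lintegral_indicator hSm, ← lintegral_indicator hSm,
          ← lintegral_add_right_eq_self _ (τ • e)]
        refine lintegral_mono fun x => ?_
        by_cases hx : x + τ • e ∈ S
        · rw [indicator_of_mem hx, add_sub_cancel_right]
          by_cases hxS : x ∈ S
          · rw [indicator_of_mem hxS]
          · obtain ⟨h1, h2, h3⟩ := hx
            rw [hc.tangential_shift] at h1
            rw [hc.shift] at h2 h3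
            have h4 : h x ≤ 0 := not_lt.1 fun h5 => hxS ⟨h1, h5, by linarith [hτ.1]⟩
            rw [hφ.gradient_eq_zero (hout x h1 h4 (by linarith [hτ.2])), enorm_zero]
            exact zero_le
        · rw [indicator_of_notMem hx]
          exact zero_le
    _ = ENNReal.ofReal t * ∫⁻ x in S, ‖gradient φ x‖ₑ := by
        rw [setLIntegral_const, Real.volume_Ioc, sub_zero, mul_comm]

theorem lintegral_layer_le_of_zeroTrace (hc : IsBoundaryChart Ω p e h K r) {σ t : ℝ}
    (hσ : (2 + K) * σ ≤ r) (ht0 : 0 ≤ t) (ht : t ≤ σ) {v : Eucl n → ℝ} {G : Eucl n → Eucl n}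
    (hv : HasZeroTraceGradient Ω v G) :
    ∫⁻ x in layer p e h σ t, ‖v x‖ₑ ≤
      ENNReal.ofReal t * ∫⁻ x in layer p e h σ t, ‖G x‖ₑ := by
  obtain ⟨-, hG, φ, hφ, h1, h2⟩ := hv
  set S := layer p e h σ t with hS
  have hSΩ : S ⊆ Ω := hc.layer_subset hσ ht
  have hlim : Tendsto (fun k => (∫⁻ x in Ω, ‖φ k x - v x‖ₑ) + ENNReal.ofReal t *
      ((∫⁻ x in S, ‖G x‖ₑ) + ∫⁻ x in Ω, ‖gradient (φ k) x - G x‖ₑ)) atTop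
      (𝓝 (0 + ENNReal.ofReal t * ((∫⁻ x in S, ‖G x‖ₑ) + 0))) :=
    h1.add (ENNReal.Tendsto.const_mul (h2.const_add _) (Or.inr ENNReal.ofReal_ne_top))
  rw [zero_add, add_zero] at hlim
  refine ge_of_tendsto hlim (Eventually.of_forall fun k => ?_)
  have m1 : Measurable fun x => ‖φ k x‖ₑ := (hφ k).1.continuous.enorm.measurable
  have m2 : Measurable fun x => ‖gradient (φ k) x‖ₑ := (hφ k).continuous_gradient.enorm.measurable
  calc ∫⁻ x in S, ‖v x‖ₑ ≤ ∫⁻ x in S, (‖φ k x - v x‖ₑ + ‖φ k x‖ₑ) := by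
        refine lintegral_mono fun x => ?_
        have : v x = φ k x - (φ k x - v x) := by ring
        conv_lhs => rw [this]
        rw [add_comm]
        exact enorm_sub_le
    _ = (∫⁻ x in S, ‖φ k x - v x‖ₑ) + ∫⁻ x in S, ‖φ k x‖ₑ := lintegral_add_right _ m1
    _ ≤ (∫⁻ x in Ω, ‖φ k x - v x‖ₑ) + ENNReal.ofReal t * ∫⁻ x in S, ‖gradient (φ k) x‖ₑ :=
        add_le_add (lintegral_mono_set hSΩ) (hc.lintegral_layer_le hσ ht0 ht (hφ k))
    _ ≤ (∫⁻ x in Ω, ‖φ k x - v x‖ₑ) + ENNReal.ofReal t *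
      ((∫⁻ x in S, ‖G x‖ₑ) + ∫⁻ x in Ω, ‖gradient (φ k) x - G x‖ₑ) := by
        gcongr
        have m3 : AEMeasurable (fun x => ‖G x‖ₑ) (volume.restrict S) :=
          (hG.mono_set hSΩ).aestronglyMeasurable.enorm
        calc ∫⁻ x in S, ‖gradient (φ k) x‖ₑ
            ≤ ∫⁻ x in S, (‖G x‖ₑ + ‖gradient (φ k) x - G x‖ₑ) := by
              refine lintegral_mono fun x => ?_
              have : gradient (φ k) x = G x + (gradient (φ k) x - G x) := by abel
              conv_lhs => rw [this]
              exact enorm_add_le _ _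
          _ = (∫⁻ x in S, ‖G x‖ₑ) + ∫⁻ x in S, ‖gradient (φ k) x - G x‖ₑ :=
              lintegral_add_left' m3 _
          _ ≤ _ := add_le_add le_rfl (lintegral_mono_set hSΩ)

/-- A function with zero trace is not bounded away from zero near a boundary point. -/
theorem not_forall_le_of_zeroTrace (hc : IsBoundaryChart Ω p e h K r) {v : Eucl n → ℝ}
    {G : Eucl n → Eucl n} (hv : HasZeroTraceGradient Ω v G) {c ρ : ℝ} (hc0 : 0 < c)
    (hρ : 0 < ρ) : ∃ y ∈ Ω ∩ Metric.ball p ρ, |v y| < c := by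
  by_contra! hcon
  set σ := min r ρ / (2 + K) with hσdef
  have hK : (0 : ℝ) < 2 + K := by positivity
  have hσ0 : 0 < σ := div_pos (lt_min hc.pos hρ) hK
  have hσr : (2 + K) * σ ≤ r := by
    rw [hσdef, mul_div_cancel₀ _ hK.ne']
    exact min_le_left _ _
  have hσρ : (2 + K) * σ ≤ ρ := by
    rw [hσdef, mul_div_cancel₀ _ hK.ne']
    exact min_le_right _ _
  set L : ℕ → Set (Eucl n) := fun N => layer p e h σ (σ / (N + 1)) with hL
  have hL1 : ∀ N : ℕ, σ / (N + 1) ≤ σ := fun N =>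
    div_le_self hσ0.le (by have : (0 : ℝ) ≤ N := N.cast_nonneg; linarith)
  have hLΩ : ∀ N, L N ⊆ Ω := fun N => hc.layer_subset hσr (hL1 N)
  have hLball : ∀ N, L N ⊆ Metric.ball p ρ := fun N x hx =>
    hc.mem_ball_of_tangential_lt hσρ hx.1 (by
      rw [abs_of_pos hx.2.1]
      exact hx.2.2.trans (hL1 N))
  -- If |v| ≥ c near `p`, the Poincaré inequality on the layer of thickness σ/(N + 1) bounds `c`
  -- times its volume from above. Multiplying by `N + 1` restores the volume of the full layer on
  -- the left and leaves σ times the integral of |G| over the thin layer, which tends to zero.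
  have hkey : ∀ N, ENNReal.ofReal c * volume (layer p e h σ σ) ≤
      ENNReal.ofReal σ * ∫⁻ x in L N, ‖G x‖ₑ := by
    intro N
    have hN : (0 : ℝ) < N + 1 := by positivity
    have h1 := hc.volume_layer_le σ (σ / (N + 1)) (N + 1)
    have e1 : ((N + 1 : ℕ) : ℝ) * (σ / (N + 1)) = σ := by
      push_cast
      field_simp
    rw [e1] at h1
    have h2 := hc.lintegral_layer_le_of_zeroTrace hσr (div_pos hσ0 hN).le (hL1 N) hv
    have h3 : ENNReal.ofReal c * volume (L N) ≤ ∫⁻ x in L N, ‖v x‖ₑ := by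
      rw [← setLIntegral_const]
      refine setLIntegral_mono' (hc.measurableSet_layer _ _) fun x hx => ?_
      rw [← ofReal_norm]
      exact ENNReal.ofReal_le_ofReal (hcon x ⟨hLΩ N hx, hLball N hx⟩)
    calc ENNReal.ofReal c * volume (layer p e h σ σ)
        ≤ ENNReal.ofReal c * ((N + 1 : ℕ) * volume (L N)) := by gcongr
      _ = (N + 1 : ℕ) * (ENNReal.ofReal c * volume (L N)) := by ring
      _ ≤ (N + 1 : ℕ) * (ENNReal.ofReal (σ / (N + 1)) * ∫⁻ x in L N, ‖G x‖ₑ) := by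
          exact mul_le_mul_right (h3.trans h2) _
      _ = ENNReal.ofReal σ * ∫⁻ x in L N, ‖G x‖ₑ := by
          rw [← mul_assoc, ← ENNReal.ofReal_natCast, ← ENNReal.ofReal_mul (by positivity), e1]
  have hvol : Tendsto (fun N => volume (L N)) atTop (𝓝 0) := by
    have hanti : Antitone L := by
      intro N N' hN x hx
      refine ⟨hx.1, hx.2.1, hx.2.2.trans ?_⟩
      gcongr
    have h1 := tendsto_measure_iInter_atTop (μ := volume)
      (fun N => (hc.measurableSet_layer σ (σ / (N + 1 : ℕ))).nullMeasurableSet) ?_ ?_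
    rotate_left
    · intro N N' hN x hx
      have := @hanti N N' hN x
      simp only [Nat.cast_add, Nat.cast_one] at hx ⊢
      exact this hx
    · refine ⟨0, ((measure_mono ?_).trans_lt (Metric.isBounded_ball (x := p) (r := ρ)
        |>.measure_lt_top)).ne⟩
      have := hLball 0
      simp only [hL, Nat.cast_zero] at this
      simpa using this
    have h2 : ⋂ N : ℕ, layer p e h σ (σ / (N + 1 : ℕ)) = ∅ := by
      refine eq_empty_of_forall_notMem fun x hx => ?_
      rw [mem_iInter] at hx
      have h3 : 0 < h x := (hx 0).2.1
      obtain ⟨N, hN⟩ := exists_nat_gt (σ / h x)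
      have h4 := (hx N).2.2
      rw [div_lt_iff₀ h3] at hN
      rw [le_div_iff₀ (by positivity)] at h4
      push_cast at h4
      nlinarith
    rw [h2, measure_empty] at h1
    simp only [Nat.cast_add, Nat.cast_one] at h1
    exact h1
  have hvolΩ : Tendsto (fun N => (volume.restrict Ω) (L N)) atTop (𝓝 0) := by
    refine tendsto_of_tendsto_of_tendsto_of_le_of_le tendsto_const_nhds hvol (fun _ => zero_le)
      fun N => Measure.restrict_apply_le _ _
  have hint := tendsto_setLIntegral_zero (μ := volume.restrict Ω) (f := fun x => ‖G x‖ₑ)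
    hv.2.1.2.ne hvolΩ
  have e2 : ∀ N, (volume.restrict Ω).restrict (L N) = volume.restrict (L N) := fun N => by
    rw [Measure.restrict_restrict (hc.measurableSet_layer _ _), inter_eq_left.2 (hLΩ N)]
  simp only [e2] at hint
  have hlim := ENNReal.Tendsto.const_mul (a := ENNReal.ofReal σ) hint
    (Or.inr ENNReal.ofReal_ne_top)
  rw [mul_zero] at hlim
  have hle := ge_of_tendsto hlim (Eventually.of_forall hkey)
  have hpos : 0 < ENNReal.ofReal c * volume (layer p e h σ σ) :=
    ENNReal.mul_pos (ENNReal.ofReal_pos.2 hc0).ne' (hc.volume_layer_pos hσ0).ne'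
  exact absurd hle (not_le.2 hpos)

end IsBoundaryChart

/-- Hölder continuous functions with zero trace vanish at the boundary. -/
theorem HasZeroTraceGradient.abs_le_dist_rpow (hΩ : IsBoundedLipschitzDomain Ω) {v : Eucl n → ℝ}
    {G : Eucl n → Eucl n} (hv : HasZeroTraceGradient Ω v G) {C γ : ℝ≥0}
    (hC : HolderOnWith C γ v Ω) {p x : Eucl n} (hp : p ∈ frontier Ω) (hx : x ∈ Ω) :
    |v x| ≤ C * dist x p ^ (γ : ℝ) := by
  by_contra! hlt
  obtain ⟨e, h, K, r, hc⟩ := hΩ.exists_chart hp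
  have hcont : Continuous fun y => |v x| - C * dist x y ^ (γ : ℝ) := by
    refine continuous_const.sub (continuous_const.mul ?_)
    exact (continuous_const.dist continuous_id).rpow_const fun _ => Or.inr γ.2
  set c := (|v x| - C * dist x p ^ (γ : ℝ)) / 2 with hcdef
  have hc0 : 0 < c := by
    rw [hcdef]
    linarith
  have hev : ∀ᶠ y in 𝓝 p, c < |v x| - C * dist x y ^ (γ : ℝ) :=
    (hcont.tendsto p).eventually_const_lt (by rw [hcdef]; linarith)
  obtain ⟨ρ, hρ, hball⟩ := Metric.eventually_nhds_iff_ball.1 hev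
  -- The gap in the assumed strict inequality leaves room for both the small value of `v` at `y` and
  -- the replacement of `p` by `y` in the distance.
  obtain ⟨y, ⟨hyΩ, hyρ⟩, hy⟩ := hc.not_forall_le_of_zeroTrace hv hc0 hρ
  have h1 := hball y hyρ
  have h2 := hC.dist_le hx hyΩ
  rw [Real.dist_eq] at h2
  have h3 : |v x| ≤ |v x - v y| + |v y| := by
    have := abs_add_le (v x - v y) (v y)
    rwa [sub_add_cancel] at this
  linarith

theorem holderWith_of_dist_le {X Y : Type*} [PseudoMetricSpace X] [PseudoMetricSpace Y] {C γ : ℝ≥0}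
    {f : X → Y} (h : ∀ x y, dist (f x) (f y) ≤ C * dist x y ^ (γ : ℝ)) : HolderWith C γ f := by
  intro x y
  rw [edist_dist, edist_dist, ENNReal.ofReal_rpow_of_nonneg dist_nonneg γ.coe_nonneg,
    ← ENNReal.ofReal_coe_nnreal, ← ENNReal.ofReal_mul C.coe_nonneg]
  exact ENNReal.ofReal_le_ofReal (h x y)

/-- The extension by zero of a Hölder continuous function with zero trace. -/
theorem HasZeroTraceGradient.holderWith_indicator (hΩ : IsBoundedLipschitzDomain Ω)
    {v : Eucl n → ℝ} {G : Eucl n → Eucl n} (hv : HasZeroTraceGradient Ω v G) {C γ : ℝ≥0}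
    (hγ : 0 < γ) (hC : HolderOnWith C γ v Ω) : HolderWith C γ (Ω.indicator v) := by
  have hin : ∀ x ∈ Ω, ∀ y ∉ Ω, |v x| ≤ C * dist x y ^ (γ : ℝ) := by
    intro x hx y hy
    -- By connectedness the segment from Ω to its complement meets the boundary, at a point no
    -- farther from `x` than `y` is.
    obtain ⟨b, hb, hbf⟩ : (segment ℝ x y ∩ frontier Ω).Nonempty := by
      by_contra hne
      have hnf : ∀ b ∈ segment ℝ x y, b ∉ frontier Ω := fun b hb hbf => hne ⟨b, hb, hbf⟩
      rw [hΩ.1.frontier_eq] at hnf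
      obtain ⟨b, -, h1, h2⟩ := (convex_segment x y).isPreconnected Ω (closure Ω)ᶜ hΩ.1
        isClosed_closure.isOpen_compl
        (fun b hb => or_iff_not_imp_left.2 fun h1 h2 => hnf b hb ⟨h2, h1⟩)
        ⟨x, left_mem_segment ℝ x y, hx⟩
        ⟨y, right_mem_segment ℝ x y, fun h1 => hnf y (right_mem_segment ℝ x y) ⟨h1, hy⟩⟩
      exact h2 (subset_closure h1)
    refine (hv.abs_le_dist_rpow hΩ hC hbf hx).trans ?_
    gcongr
    have := dist_add_dist_of_mem_segment hb
    linarith [dist_nonneg (x := b) (y := y)]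
  have hreal : ∀ x y, dist (Ω.indicator v x) (Ω.indicator v y) ≤ C * dist x y ^ (γ : ℝ) := by
    intro x y
    by_cases hx : x ∈ Ω <;> by_cases hy : y ∈ Ω
    · simpa [hx, hy] using hC.dist_le hx hy
    · simpa [hx, hy] using hin x hx y hy
    · simpa [hx, hy, dist_comm] using hin y hy x hx
    · simp only [indicator_of_notMem hx, indicator_of_notMem hy, dist_self]
      positivity
  exact holderWith_of_dist_le hreal

end Lavrentiev

namespace Lavrentiev

open Filter

variable {n : ℕ} {Ω : Set (Eucl n)} {M : Eucl n → Eucl n → ℝ}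

/-! ### Localization -/

/-- Test the identity for `v` with `ζ * ψ` and use the product rule for smooth functions. -/
theorem HasZeroExtGradient.mul_testFunction {v : Eucl n → ℝ} {G : Eucl n → Eucl n}
    (hv : HasZeroExtGradient Ω v G) {ζ : Eucl n → ℝ} (hζ : IsTestFunction univ ζ) :
    HasZeroExtGradient Ω (fun x => ζ x * v x) (fun x => ζ x • G x + v x • gradient ζ x) := by
  have i1 : IntegrableOn (fun x => ζ x • G x) Ω :=
    integrableOn_smul_of_bound hv.2.1 hζ.1.continuous hζ.exists_bound
  have i2 : IntegrableOn (fun x => v x • gradient ζ x) Ω :=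
    integrableOn_smul_of_bound' hv.1 hζ.continuous_gradient hζ.exists_bound_gradient
  refine ⟨integrableOn_smul_of_bound (E := ℝ) hv.1 hζ.1.continuous hζ.exists_bound,
    i1.add i2, fun ψ hψ => ?_⟩
  have hζψ : IsTestFunction univ fun x => ζ x * ψ x := hζ.mul hψ
  have h1 := hv.2.2 _ hζψ
  have e1 : ∀ x, v x • gradient (fun y => ζ y * ψ y) x =
      (ζ x * v x) • gradient ψ x + ψ x • v x • gradient ζ x := fun x => by
    rw [gradient_mul' (hζ.differentiable x) (hψ.differentiable x), smul_add, smul_smul,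
      smul_smul, smul_smul, mul_comm (v x), mul_comm (v x)]
  have j1 : IntegrableOn (fun x => (ζ x * v x) • gradient ψ x) Ω :=
    integrableOn_smul_of_bound' (integrableOn_smul_of_bound (E := ℝ) hv.1 hζ.1.continuous
      hζ.exists_bound) hψ.continuous_gradient hψ.exists_bound_gradient
  have j2 : IntegrableOn (fun x => ψ x • v x • gradient ζ x) Ω :=
    integrableOn_smul_of_bound i2 hψ.1.continuous hψ.exists_bound
  have j3 : IntegrableOn (fun x => ψ x • ζ x • G x) Ω :=
    integrableOn_smul_of_bound i1 hψ.1.continuous hψ.exists_bound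
  simp only [e1] at h1
  rw [integral_add j1 j2] at h1
  simp only [smul_add]
  rw [integral_add j3 j2]
  have e2 : ∫ x in Ω, (ζ x * ψ x) • G x = ∫ x in Ω, ψ x • ζ x • G x := by
    refine integral_congr_ae (Eventually.of_forall fun x => ?_)
    simp only [smul_smul, mul_comm]
  rw [e2] at h1
  rw [neg_add, ← h1]
  abel

/-- The extra term from the product rule is bounded because `v` is. This is where localization needs
boundedness. -/
theorem FiniteModulars.localize (hΩ : IsOpen Ω) (hb : Bornology.IsBounded Ω)
    (hM : IsWeakNFunction Ω M) {v : Eucl n → ℝ} {G : Eucl n → Eucl n}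
    (hv : IntegrableOn v Ω) {B : ℝ} (hB : ∀ x ∈ Ω, |v x| ≤ B) (hG : FiniteModulars Ω M G)
    {ζ : Eucl n → ℝ} (hζ : IsTestFunction univ ζ) :
    FiniteModulars Ω M (fun x => ζ x • G x + v x • gradient ζ x) := by
  obtain ⟨C, hC⟩ := hζ.exists_bound
  obtain ⟨D, hD⟩ := hζ.exists_bound_gradient
  refine FiniteModulars.add hΩ hM
    (hG.bdd_smul hΩ hM hζ.1.continuous.aestronglyMeasurable hC) ?_
  refine FiniteModulars.of_bounded hΩ hb hM (C := B * D)
    (hv.aestronglyMeasurable.smul hζ.continuous_gradient.aestronglyMeasurable) ?_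
  filter_upwards [ae_restrict_mem hΩ.measurableSet] with x hx
  rw [norm_smul]
  have h1 : ‖v x‖ ≤ B := hB x hx
  exact mul_le_mul h1 (hD x) (norm_nonneg _) ((norm_nonneg _).trans h1)

/-- The Lipschitz bound serves distances up to 1, and the sup bound larger distances. -/
theorem IsTestFunction.exists_holder {ζ : Eucl n → ℝ} (hζ : IsTestFunction univ ζ) {γ : ℝ≥0}
    (hγ : γ ≤ 1) : ∃ C : ℝ, 0 ≤ C ∧ ∀ x y, |ζ x - ζ y| ≤ C * dist x y ^ (γ : ℝ) := by
  obtain ⟨Z, hZ⟩ := hζ.exists_bound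
  obtain ⟨D, hD⟩ := hζ.exists_bound_gradient
  have hZ0 : 0 ≤ Z := (norm_nonneg _).trans (hZ 0)
  have hD0 : 0 ≤ D := (norm_nonneg _).trans (hD 0)
  refine ⟨D + 2 * Z, by positivity, fun x y => ?_⟩
  have hγ1 : (γ : ℝ) ≤ 1 := by exact_mod_cast hγ
  rcases le_or_gt (dist x y) 1 with h | h
  · have h1 : |ζ x - ζ y| ≤ D * dist x y := by
      rw [dist_eq_norm, ← Real.norm_eq_abs]
      refine Convex.norm_image_sub_le_of_norm_fderiv_le (𝕜 := ℝ) (s := univ)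
        (fun z _ => hζ.differentiable z) (fun z _ => ?_) convex_univ (mem_univ _) (mem_univ _)
      rw [← norm_gradient]
      exact hD z
    have h2 : dist x y ≤ dist x y ^ (γ : ℝ) := by
      rcases dist_nonneg (x := x) (y := y) |>.eq_or_lt with h0 | h0
      · rw [← h0]
        positivity
      · calc dist x y = dist x y ^ (1 : ℝ) := (Real.rpow_one _).symm
          _ ≤ dist x y ^ (γ : ℝ) := Real.rpow_le_rpow_of_exponent_ge h0 h hγ1
    have h3 : 0 ≤ dist x y ^ (γ : ℝ) := by positivity
    nlinarith
  · have h1 : |ζ x - ζ y| ≤ 2 * Z := by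
      have := (norm_sub_le (ζ x) (ζ y)).trans (add_le_add (hZ x) (hZ y))
      rw [← Real.norm_eq_abs]
      linarith
    have h2 : 1 ≤ dist x y ^ (γ : ℝ) := Real.one_le_rpow h.le γ.coe_nonneg
    nlinarith

theorem holderWith_indicator_mul {v : Eucl n → ℝ} {A γ : ℝ≥0} (hγ : γ ≤ 1)
    (hA : HolderWith A γ (Ω.indicator v)) {B : ℝ} (hB : ∀ x ∈ Ω, |v x| ≤ B)
    {ζ : Eucl n → ℝ} (hζ : IsTestFunction univ ζ) :
    ∃ A' : ℝ≥0, HolderWith A' γ (Ω.indicator fun x => ζ x * v x) := by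
  obtain ⟨Z, hZ⟩ := hζ.exists_bound
  obtain ⟨C, hC0, hC⟩ := hζ.exists_holder hγ
  have hZ0 : 0 ≤ Z := (norm_nonneg _).trans (hZ 0)
  have hw : ∀ x, |Ω.indicator v x| ≤ |B| := by
    intro x
    by_cases hx : x ∈ Ω
    · rw [indicator_of_mem hx]
      exact (hB x hx).trans (le_abs_self B)
    · rw [indicator_of_notMem hx, abs_zero]
      exact abs_nonneg B
  refine ⟨⟨Z * A + |B| * C, by positivity⟩, holderWith_of_dist_le fun x y => ?_⟩
  have e : ∀ x, Ω.indicator (fun x => ζ x * v x) x = ζ x * Ω.indicator v x := fun x => by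
    by_cases hx : x ∈ Ω <;> simp [hx]
  rw [e, e, Real.dist_eq]
  have h1 := hA.dist_le x y
  rw [Real.dist_eq] at h1
  have h2 : ζ x * Ω.indicator v x - ζ y * Ω.indicator v y =
      ζ x * (Ω.indicator v x - Ω.indicator v y) + Ω.indicator v y * (ζ x - ζ y) := by ring
  rw [h2]
  refine (abs_add_le _ _).trans ?_
  rw [abs_mul, abs_mul]
  have h3 : |ζ x| * |Ω.indicator v x - Ω.indicator v y| ≤ Z * (A * dist x y ^ (γ : ℝ)) :=
    mul_le_mul (hZ x) h1 (abs_nonneg _) hZ0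
  have h4 : |Ω.indicator v y| * |ζ x - ζ y| ≤ |B| * (C * dist x y ^ (γ : ℝ)) :=
    mul_le_mul (hw y) (hC x y) (abs_nonneg _) (abs_nonneg _)
  calc _ ≤ Z * (A * dist x y ^ (γ : ℝ)) + |B| * (C * dist x y ^ (γ : ℝ)) := add_le_add h3 h4
    _ = (Z * A + |B| * C) * dist x y ^ (γ : ℝ) := by ring

/-! ### Mollification that moves supports into the domain -/

/-- A bump of radius `κ` centred at `e` instead of the origin: mollification at scale `s` then
translates by `s • e` up to an error `s * κ`. -/
theorem exists_mollifier (e : Eucl n) (he : ‖e‖ ≤ 1) {κ : ℝ} (hκ : 0 < κ) (hκ1 : κ ≤ 1) :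
    ∃ k : Eucl n → ℝ, IsMollifier k ∧ ∀ z, k z ≠ 0 → ‖z - e‖ ≤ κ := by
  set b : ContDiffBump e := ⟨κ / 2, κ, by positivity, by linarith⟩ with hb
  have hsupp : ∀ z, b.normed volume z ≠ 0 → ‖z - e‖ < κ := fun z hz => by
    have : z ∈ Function.support (b.normed volume) := hz
    rw [b.support_normed_eq, Metric.mem_ball, dist_eq_norm] at this
    exact this
  refine ⟨b.normed volume, ⟨b.contDiff_normed, b.hasCompactSupport_normed,
    fun x => b.nonneg_normed x, b.integral_normed, fun z hz => ?_⟩, fun z hz => (hsupp z hz).le⟩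
  have h1 := hsupp z hz
  have h2 : ‖z‖ ≤ ‖z - e‖ + ‖e‖ := by
    have := norm_add_le (z - e) e
    rwa [sub_add_cancel] at this
  linarith

/-- Near every point of the closure there is a mollifier that maps functions supported near the
point to functions with compact support in `Ω`. -/
theorem IsBoundedLipschitzDomain.exists_local_mollifier (hΩ : IsBoundedLipschitzDomain Ω)
    {p : Eucl n} (hp : p ∈ closure Ω) : ∃ (ρ : ℝ) (k : Eucl n → ℝ), 0 < ρ ∧ IsMollifier k ∧
      ∀ s ∈ Ioo 0 ρ, ∃ K, IsCompact K ∧ K ⊆ Ω ∧ ∀ x ∉ K, ∀ y ∈ Ω, y ∈ Metric.ball p ρ →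
        scaledKernel k s (x - y) = 0 := by
  by_cases hpΩ : p ∈ Ω
  · obtain ⟨r, hr, hball⟩ := Metric.isOpen_iff.1 hΩ.1 p hpΩ
    obtain ⟨k, hk, -⟩ := exists_mollifier (0 : Eucl n) (by simp) one_pos le_rfl
    refine ⟨r / 4, k, by positivity, hk, fun s hs => ⟨Metric.closedBall p (3 * (r / 4)),
      isCompact_closedBall _ _, (Metric.closedBall_subset_ball (by linarith)).trans hball,
      fun x hx y _ hy => ?_⟩⟩
    by_contra h
    refine hx ?_
    have h1 := hk.norm_le_of_scaled_ne_zero hs.1 h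
    rw [← dist_eq_norm] at h1
    rw [Metric.mem_closedBall]
    rw [Metric.mem_ball] at hy
    have h2 := dist_triangle x y p
    linarith [hs.2]
  · have hpf : p ∈ frontier Ω := by
      rw [hΩ.1.frontier_eq]
      exact ⟨hp, hpΩ⟩
    obtain ⟨e, h, L, r, hc⟩ := hΩ.exists_chart hpf
    have hL : (0 : ℝ) < 2 * (1 + L) := by positivity
    have hκ1 : (2 * (1 + (L : ℝ)))⁻¹ ≤ 1 := by
      refine inv_le_one_of_one_le₀ ?_
      have : (0 : ℝ) ≤ L := L.coe_nonneg
      linarith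
    -- With κ = (2(1 + L))⁻¹, the height grows by `s` under the translation and the spread of the
    -- kernel costs at most L s κ ≤ s/2, so a net gain of at least `s / 2` remains.
    obtain ⟨k, hk, hke⟩ := exists_mollifier e hc.norm_e.le (inv_pos.2 hL) hκ1
    have hr := hc.pos
    -- A point within `r / 4` of `p` is moved by at most `2 * s < r / 2`, so everything stays in the
    -- closed ball of radius `3 * (r / 4)`, inside the chart.
    refine ⟨r / 4, k, by positivity, hk, fun s hs =>
      ⟨Metric.closedBall p (3 * (r / 4)) ∩ {x | s / 2 ≤ h x},
      (isCompact_closedBall _ _).inter_right (isClosed_le continuous_const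
        hc.lipschitz.continuous), ?_, fun x hx y hyΩ hy => ?_⟩⟩
    · rintro x ⟨hx1, hx2⟩
      refine (hc.mem_iff x (Metric.closedBall_subset_ball (by linarith) hx1)).2 ?_
      have : s / 2 ≤ h x := hx2
      linarith [hs.1]
    · by_contra hne
      have hs0 : 0 < s := hs.1
      refine hx ⟨?_, ?_⟩
      · have h1 := hk.norm_le_of_scaled_ne_zero hs0 hne
        rw [← dist_eq_norm] at h1
        rw [Metric.mem_closedBall]
        rw [Metric.mem_ball] at hy
        have h2 := dist_triangle x y p
        linarith [hs.2]
      · have hy0 : 0 < h y :=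
          (hc.mem_iff y (Metric.ball_subset_ball (by linarith) hy)).1 hyΩ
        have h1 := hke _ (right_ne_zero_of_mul hne)
        have h2 : dist x (y + s • e) ≤ s * (2 * (1 + (L : ℝ)))⁻¹ := by
          have e1 : x - (y + s • e) = s • (s⁻¹ • (x - y) - e) := by
            rw [smul_sub, smul_smul, mul_inv_cancel₀ hs0.ne', one_smul]
            abel
          rw [dist_eq_norm, e1, norm_smul, Real.norm_of_nonneg hs0.le]
          gcongr
        have h3 := hc.lipschitz.dist_le_mul x (y + s • e)
        rw [Real.dist_eq, hc.shift] at h3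
        have h4 : L * (s * (2 * (1 + (L : ℝ)))⁻¹) ≤ s / 2 := by
          have : (L : ℝ) * (2 * (1 + (L : ℝ)))⁻¹ ≤ 1 / 2 := by
            rw [← div_eq_mul_inv, div_le_div_iff₀ hL two_pos]
            linarith
          nlinarith
        have h5 : |h x - (h y + s)| ≤ s / 2 := h3.trans (le_trans (by gcongr) h4)
        have h6 := (abs_le.1 h5).1
        show s / 2 ≤ h x
        linarith

/-- A finite smooth partition of unity on a compact set subordinate to a family of balls. -/
theorem exists_finite_partition {S : Set (Eucl n)} (hS : IsCompact S) {ρ : Eucl n → ℝ}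
    (hρ : ∀ p ∈ S, 0 < ρ p) : ∃ (t : Finset (Eucl n)) (ζ : Eucl n → Eucl n → ℝ),
      (∀ p ∈ t, p ∈ S) ∧ (∀ p ∈ t, IsTestFunction univ (ζ p)) ∧
      (∀ p ∈ t, ∀ x, ζ p x ≠ 0 → x ∈ Metric.ball p (ρ p)) ∧ ∀ x ∈ S, ∑ p ∈ t, ζ p x = 1 := by
  obtain ⟨t, htS, hcover⟩ := hS.elim_nhds_subcover (fun p => Metric.ball p (ρ p))
    (fun p hp => Metric.ball_mem_nhds p (hρ p hp))
  obtain ⟨f, hf⟩ := SmoothPartitionOfUnity.exists_isSubordinate (modelWithCornersSelf ℝ (Eucl n))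
    hS.isClosed (fun p : t => Metric.ball (p : Eucl n) (ρ p)) (fun _ => Metric.isOpen_ball)
    (by simpa [iUnion_subtype] using hcover)
  classical
  refine ⟨t, fun p => if hp : p ∈ t then f ⟨p, hp⟩ else 0, htS, fun p hp => ?_,
    fun p hp x hx => ?_, fun x hx => ?_⟩
  · simp only [hp, dite_true]
    have hts := hf ⟨p, hp⟩
    refine ⟨(f ⟨p, hp⟩).contMDiff.contDiff, ?_, subset_univ _⟩
    exact (isCompact_closedBall p (ρ p)).of_isClosed_subset (isClosed_tsupport _)
      (hts.trans Metric.ball_subset_closedBall)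
  · simp only [hp, dite_true] at hx
    exact hf ⟨p, hp⟩ (subset_tsupport _ hx)
  · have h1 := f.sum_eq_one hx
    rw [finsum_eq_sum_of_fintype] at h1
    rw [← h1, ← Finset.sum_coe_sort t]
    refine Finset.sum_congr rfl fun p _ => ?_
    simp

/-- Approximation of bounded functions whose extension by zero is Hölder continuous. -/
theorem HasZeroExtGradient.approxByTest_of_holder (hΩ : IsBoundedLipschitzDomain Ω)
    (hM : IsWeakNFunction Ω M) {γ : ℝ≥0} (hγ : γ ≤ 1) (hB : BGenPlus Ω M γ) {v : Eucl n → ℝ}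
    {G : Eucl n → Eucl n} (hv : HasZeroExtGradient Ω v G) (hG : FiniteModulars Ω M G)
    {A : ℝ≥0} (hA : HolderWith A γ (Ω.indicator v)) {B : ℝ} (hvB : ∀ x ∈ Ω, |v x| ≤ B) :
    ApproxByTest Ω M v G := by
  have hb := hΩ.2.2.1
  have hloc : ∀ p : Eucl n, ∃ (ρ : ℝ) (k : Eucl n → ℝ), p ∈ closure Ω → (0 < ρ ∧ IsMollifier k ∧
      ∀ s ∈ Ioo 0 ρ, ∃ K, IsCompact K ∧ K ⊆ Ω ∧ ∀ x ∉ K, ∀ y ∈ Ω, y ∈ Metric.ball p ρ →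
        scaledKernel k s (x - y) = 0) := by
    intro p
    by_cases hp : p ∈ closure Ω
    · obtain ⟨ρ, k, h⟩ := hΩ.exists_local_mollifier hp
      exact ⟨ρ, k, fun _ => h⟩
    · exact ⟨0, 0, fun h => absurd h hp⟩
  choose ρ k hρk using hloc
  obtain ⟨t, ζ, htS, hζ, hζs, hζ1⟩ := exists_finite_partition
    (Metric.isCompact_of_isClosed_isBounded isClosed_closure hb.closure) fun p hp => (hρk p hp).1
  have happ : ∀ p ∈ t, ApproxByTest Ω M (fun x => ζ p x * v x)
      (fun x => ζ p x • G x + v x • gradient (ζ p) x) := by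
    intro p hp
    obtain ⟨hρ, hk, hK⟩ := hρk p (htS p hp)
    obtain ⟨A', hA'⟩ := holderWith_indicator_mul hγ hA hvB (hζ p hp)
    refine (hv.mul_testFunction (hζ p hp)).approxByTest hΩ.1 hb hM hB
      (hG.localize hΩ.1 hb hM hv.1 hvB (hζ p hp)) hA' hk hρ fun s hs => ?_
    obtain ⟨K, hKc, hKΩ, hK0⟩ := hK s hs
    exact ⟨K, hKc, hKΩ, fun x hx y hy hne =>
      hK0 x hx y hy (hζs p hp y (left_ne_zero_of_mul hne))⟩
  have hsum := ApproxByTest.sum t hΩ.1 hM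
    (fun p hp => (hv.mul_testFunction (hζ p hp)).1.aestronglyMeasurable)
    (fun p hp => (hv.mul_testFunction (hζ p hp)).2.1.aestronglyMeasurable) happ
  refine hsum.congr ?_ ?_
  · filter_upwards [ae_restrict_mem hΩ.1.measurableSet] with x hx
    rw [← Finset.sum_mul, hζ1 x (subset_closure hx), one_mul]
  · filter_upwards [ae_restrict_mem hΩ.1.measurableSet] with x hx
    -- The partition sums to the constant 1 on a neighbourhood of each point of the open set Ω, so
    -- the gradients of the cut-offs cancel.
    have hg : ∑ p ∈ t, gradient (ζ p) x = 0 := by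
      have h1 : (fun y => ∑ p ∈ t, ζ p y) =ᶠ[𝓝 x] fun _ => (1 : ℝ) := by
        filter_upwards [hΩ.1.mem_nhds hx] with y hy
        exact hζ1 y (subset_closure hy)
      have h2 := h1.fderiv_eq (𝕜 := ℝ)
      rw [fderiv_fun_sum fun p hp => (hζ p hp).differentiable x] at h2
      simp only [gradient_eq_toDual_symm]
      rw [← map_sum, h2]
      simp
    rw [Finset.sum_add_distrib, ← Finset.sum_smul, ← Finset.smul_sum, hg, smul_zero, add_zero,
      hζ1 x (subset_closure hx), one_smul]

end Lavrentiev

namespace Lavrentiev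

open Filter

variable {n : ℕ} {Ω : Set (Eucl n)} {M : Eucl n → Eucl n → ℝ}

/-! ### Truncation -/

/-- A smooth truncation of `t` at the level `m`. -/
noncomputable def sinTrunc (m t : ℝ) : ℝ := m * Real.sin (t / m)

theorem hasDerivAt_sinTrunc {m : ℝ} (hm : 0 < m) (t : ℝ) :
    HasDerivAt (sinTrunc m) (Real.cos (t / m)) t := by
  have h1 : HasDerivAt (fun t : ℝ => t / m) (1 / m) t := (hasDerivAt_id t).div_const m
  have h2 := ((Real.hasDerivAt_sin (t / m)).comp t h1).const_mul m
  have e : m * (Real.cos (t / m) * (1 / m)) = Real.cos (t / m) := by field_simp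
  rwa [e] at h2

theorem contDiff_sinTrunc (m : ℝ) : ContDiff ℝ ∞ (sinTrunc m) :=
  contDiff_const.mul (Real.contDiff_sin.comp (contDiff_id.div_const m))

theorem abs_sinTrunc_le {m : ℝ} (hm : 0 < m) (t : ℝ) : |sinTrunc m t| ≤ m := by
  rw [sinTrunc, abs_mul, abs_of_pos hm]
  exact mul_le_of_le_one_right hm.le (Real.abs_sin_le_one _)

theorem abs_sinTrunc_sub_le {m : ℝ} (hm : 0 < m) (s t : ℝ) :
    |sinTrunc m s - sinTrunc m t| ≤ |s - t| := by
  have := Convex.norm_image_sub_le_of_norm_hasDerivWithin_le (s := univ) (C := 1) (x := t) (y := s)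
    (fun x _ => (hasDerivAt_sinTrunc hm x).hasDerivWithinAt)
    (fun x _ => by
      rw [Real.norm_eq_abs]
      exact Real.abs_cos_le_one _) convex_univ (mem_univ _) (mem_univ _)
  simpa using this

theorem sinTrunc_zero (m : ℝ) : sinTrunc m 0 = 0 := by simp [sinTrunc]

theorem tendsto_div_natCast_succ (t : ℝ) :
    Tendsto (fun N : ℕ => t / ((N : ℝ) + 1)) atTop (𝓝 0) := by
  have := (tendsto_add_atTop_iff_nat 1).2 (tendsto_const_div_atTop_nhds_zero_nat t)
  simpa using this

theorem tendsto_cos_div (t : ℝ) :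
    Tendsto (fun N : ℕ => Real.cos (t / ((N : ℝ) + 1))) atTop (𝓝 1) := by
  have := (Real.continuous_cos.tendsto 0).comp (tendsto_div_natCast_succ t)
  rwa [Real.cos_zero] at this

theorem tendsto_sinTrunc (t : ℝ) :
    Tendsto (fun N : ℕ => sinTrunc ((N : ℝ) + 1) t) atTop (𝓝 t) := by
  have h := ((Real.continuous_sinc.tendsto 0).comp (tendsto_div_natCast_succ t)).const_mul t
  rw [Real.sinc_zero, mul_one] at h
  refine h.congr fun N => ?_
  have hm : (N : ℝ) + 1 ≠ 0 := by positivity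
  rcases eq_or_ne t 0 with rfl | ht
  · simp [sinTrunc]
  · rw [Function.comp_apply, Real.sinc_of_ne_zero (div_ne_zero ht hm), sinTrunc]
    field_simp

theorem IsTestFunction.sinTrunc_comp {φ : Eucl n → ℝ} (hφ : IsTestFunction Ω φ) (m : ℝ) :
    IsTestFunction Ω (fun x => sinTrunc m (φ x)) := by
  have hs : tsupport (fun x => sinTrunc m (φ x)) ⊆ tsupport φ := by
    refine closure_mono fun x hx => ?_
    rw [Function.mem_support] at hx ⊢
    intro h
    exact hx (by rw [h, sinTrunc_zero])
  exact ⟨(contDiff_sinTrunc m).comp hφ.1, hφ.2.1.of_isClosed_subset (isClosed_tsupport _) hs,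
    hs.trans hφ.2.2⟩

theorem IsTestFunction.gradient_sinTrunc {φ : Eucl n → ℝ} (hφ : IsTestFunction Ω φ) {m : ℝ}
    (hm : 0 < m) (x : Eucl n) :
    gradient (fun x => sinTrunc m (φ x)) x = Real.cos (φ x / m) • gradient φ x := by
  have h : HasFDerivAt (fun x => sinTrunc m (φ x)) (Real.cos (φ x / m) • fderiv ℝ φ x) x :=
    (hasDerivAt_sinTrunc hm (φ x)).comp_hasFDerivAt x (hφ.differentiable x).hasFDerivAt
  simp only [gradient_eq_toDual_symm]
  rw [h.fderiv, LinearIsometryEquiv.map_smul]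

/-- Composition with the sine keeps test functions smooth and compactly supported, since it fixes 0.
In the gradient, cos(φ/m)(∇φ - G) tends to zero in L¹ because the cosine is bounded, and (cos(φ/m) -
cos(v/m))G does so by dominated convergence along an almost everywhere convergent subsequence. -/
theorem HasZeroTraceGradient.sinTrunc_comp {v : Eucl n → ℝ} {G : Eucl n → Eucl n}
    (hv : HasZeroTraceGradient Ω v G) {m : ℝ} (hm : 0 < m) :
    HasZeroTraceGradient Ω (fun x => sinTrunc m (v x)) (fun x => Real.cos (v x / m) • G x) := by
  obtain ⟨hvi, hG, φ, hφ, h1, h2⟩ := hv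
  have hcm : AEStronglyMeasurable (fun x => Real.cos (v x / m)) (volume.restrict Ω) :=
    (Real.continuous_cos.comp (continuous_id.div_const m)).comp_aestronglyMeasurable
      hvi.aestronglyMeasurable
  have hvm : ∀ k, AEMeasurable (fun x => ‖φ k x - v x‖ₑ) (volume.restrict Ω) := fun k =>
    ((hφ k).1.continuous.aestronglyMeasurable.sub hvi.aestronglyMeasurable).enorm
  obtain ⟨σ, hσ, hae⟩ := exists_subseq_ae_tendsto_zero hvm h1
  refine ⟨?_, ?_, fun k x => sinTrunc m (φ (σ k) x),
    fun k => (hφ _).sinTrunc_comp m, ?_, ?_⟩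
  · refine Integrable.mono hvi ((contDiff_sinTrunc m).continuous.comp_aestronglyMeasurable
      hvi.aestronglyMeasurable) (Eventually.of_forall fun x => ?_)
    have := abs_sinTrunc_sub_le hm (v x) 0
    simpa [sinTrunc_zero] using this
  · refine Integrable.mono hG (hcm.smul hG.aestronglyMeasurable) (Eventually.of_forall fun x => ?_)
    rw [norm_smul]
    exact mul_le_of_le_one_left (norm_nonneg _) (Real.abs_cos_le_one _)
  · refine tendsto_of_tendsto_of_tendsto_of_le_of_le tendsto_const_nhds
      (h1.comp hσ.tendsto_atTop) (fun _ => zero_le) fun k => lintegral_mono fun x => ?_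
    rw [← ofReal_norm, ← ofReal_norm]
    exact ENNReal.ofReal_le_ofReal (abs_sinTrunc_sub_le hm _ _)
  · simp only [(hφ _).gradient_sinTrunc hm]
    have hdm : ∀ k, AEMeasurable (fun x => ‖Real.cos (φ (σ k) x / m) - Real.cos (v x / m)‖ₑ *
        ‖G x‖ₑ) (volume.restrict Ω) := fun k => by
      refine AEMeasurable.mul ?_ hG.aestronglyMeasurable.enorm
      refine AEStronglyMeasurable.enorm (AEStronglyMeasurable.sub ?_ hcm)
      exact (Real.continuous_cos.comp ((hφ _).1.continuous.div_const m)).aestronglyMeasurable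
    have l1 : Tendsto (fun k => ∫⁻ x in Ω, ‖Real.cos (φ (σ k) x / m) - Real.cos (v x / m)‖ₑ *
        ‖G x‖ₑ) atTop (𝓝 (∫⁻ _ in Ω, 0)) := by
      refine tendsto_lintegral_of_dominated_convergence' (fun x => 2 * ‖G x‖ₑ) hdm
        (fun k => Eventually.of_forall fun x => ?_) ?_ ?_
      · refine mul_le_mul' ?_ le_rfl
        rw [← ofReal_norm, ← ENNReal.ofReal_ofNat]
        refine ENNReal.ofReal_le_ofReal ((norm_sub_le _ _).trans ?_)
        have a1 := Real.abs_cos_le_one (φ (σ k) x / m)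
        have a2 := Real.abs_cos_le_one (v x / m)
        rw [Real.norm_eq_abs, Real.norm_eq_abs]
        linarith
      · rw [lintegral_const_mul' _ _ (by simp)]
        exact ENNReal.mul_ne_top (by simp) hG.2.ne
      · filter_upwards [hae] with x hx
        have t1 : Tendsto (fun k => φ (σ k) x) atTop (𝓝 (v x)) := by
          rw [tendsto_iff_edist_tendsto_0]
          refine hx.congr fun k => ?_
          rw [edist_eq_enorm_sub]
        have t2 : Tendsto (fun k => Real.cos (φ (σ k) x / m)) atTop
            (𝓝 (Real.cos (v x / m))) :=
          (Real.continuous_cos.tendsto _).comp (t1.div_const m)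
        have t3 := (t2.sub_const (Real.cos (v x / m))).enorm
        rw [sub_self, enorm_zero] at t3
        have t4 := ENNReal.Tendsto.mul_const (b := ‖G x‖ₑ) t3 (Or.inr enorm_ne_top)
        rwa [zero_mul] at t4
    rw [lintegral_zero] at l1
    have l2 := (h2.comp hσ.tendsto_atTop).add l1
    rw [add_zero] at l2
    refine tendsto_of_tendsto_of_tendsto_of_le_of_le tendsto_const_nhds l2 (fun _ => zero_le)
      fun k => ?_
    dsimp only [Function.comp_apply]
    rw [← lintegral_add_right' _ (hdm k)]
    refine lintegral_mono fun x => ?_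
    have e : Real.cos (φ (σ k) x / m) • gradient (φ (σ k)) x - Real.cos (v x / m) • G x =
        Real.cos (φ (σ k) x / m) • (gradient (φ (σ k)) x - G x) +
          (Real.cos (φ (σ k) x / m) - Real.cos (v x / m)) • G x := by
      rw [smul_sub, sub_smul]
      abel
    rw [e]
    refine (enorm_add_le _ _).trans ?_
    rw [enorm_smul, enorm_smul]
    gcongr
    rw [← ofReal_norm, Real.norm_eq_abs]
    exact mul_le_of_le_one_left zero_le
      (by simpa using ENNReal.ofReal_le_ofReal (Real.abs_cos_le_one (φ (σ k) x / m)))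

/-! ### Density of test functions among functions with zero trace. -/

/-- At exponent 0 the Hölder condition only bounds the oscillation, which brings bounded functions
under the same approximation theorem. The power is 1 even at distance 0. -/
theorem holderWith_zero_of_abs_le {w : Eucl n → ℝ} {B : ℝ≥0} (hB : ∀ x, |w x| ≤ B) :
    HolderWith (2 * B) 0 w := by
  refine holderWith_of_dist_le fun x y => ?_
  rw [NNReal.coe_zero, Real.rpow_zero, mul_one, Real.dist_eq]
  refine (abs_sub _ _).trans ?_
  push_cast
  linarith [hB x, hB y]

/-- Approximation of arbitrary functions with zero trace in the case `γ = 0`. -/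
theorem HasZeroTraceGradient.approxByTest (hΩ : IsBoundedLipschitzDomain Ω)
    (hM : IsWeakNFunction Ω M) (hB : BGenPlus Ω M 0) {v : Eucl n → ℝ}
    {G : Eucl n → Eucl n} (hv : HasZeroTraceGradient Ω v G) (hG : FiniteModulars Ω M G) :
    ApproxByTest Ω M v G := by
  have hvm := hv.1.aestronglyMeasurable
  have hcm : ∀ m : ℝ, AEStronglyMeasurable (fun x => Real.cos (v x / m)) (volume.restrict Ω) :=
    fun m => (Real.continuous_cos.comp (continuous_id.div_const m)).comp_aestronglyMeasurable hvm
  have hpos : ∀ N : ℕ, (0 : ℝ) < (N : ℝ) + 1 := fun N => by positivity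
  refine ApproxByTest.of_approx hΩ.1 hM hvm hG.1 fun c ε hε => ?_
  have l1 : Tendsto (fun N : ℕ => ∫⁻ x in Ω, ‖v x - sinTrunc ((N : ℝ) + 1) (v x)‖ₑ) atTop
      (𝓝 (∫⁻ _ in Ω, 0)) := by
    refine tendsto_lintegral_of_dominated_convergence' (fun x => 2 * ‖v x‖ₑ) (fun N => ?_)
      (fun N => Eventually.of_forall fun x => ?_) ?_ ?_
    · exact (hvm.sub ((contDiff_sinTrunc _).continuous.comp_aestronglyMeasurable hvm)).enorm
    · beta_reduce
      rw [two_mul]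
      refine enorm_sub_le.trans ?_
      gcongr
      rw [← ofReal_norm, ← ofReal_norm]
      refine ENNReal.ofReal_le_ofReal ?_
      have := abs_sinTrunc_sub_le (hpos N) (v x) 0
      simpa [sinTrunc_zero] using this
    · rw [lintegral_const_mul' _ _ (by simp)]
      exact ENNReal.mul_ne_top (by simp) hv.1.2.ne
    · refine Eventually.of_forall fun x => ?_
      have := ((tendsto_sinTrunc (v x)).const_sub (v x)).enorm
      simpa using this
  -- The gradient error is (1 - cos(v/m))G with coefficient in [0, 2], so all its modulars are
  -- dominated by a finite modular of `G`.
  have l2 : Tendsto (fun N : ℕ => ∫⁻ x in Ω, ENNReal.ofReal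
      (M x (c • (G x - Real.cos (v x / ((N : ℝ) + 1)) • G x)))) atTop (𝓝 (∫⁻ _ in Ω, 0)) := by
    refine tendsto_lintegral_of_dominated_convergence'
      (fun x => ENNReal.ofReal (M x ((2 * |c|) • G x))) (fun N => ?_)
      (fun N => ?_) (hG.2 _) ?_
    · exact hM.aemeasurable_comp ((hG.1.sub ((hcm _).smul hG.1)).const_smul c)
    · filter_upwards [hM.ae_isYoung hΩ.1] with x hx
      have e : c • (G x - Real.cos (v x / ((N : ℝ) + 1)) • G x) =
          (c * (1 - Real.cos (v x / ((N : ℝ) + 1)))) • G x := by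
        rw [mul_smul, sub_smul, one_smul]
      rw [e]
      refine ENNReal.ofReal_le_ofReal (hx.smul_mono ?_ _)
      rw [abs_mul, mul_comm]
      gcongr
      have a1 := abs_le.1 (Real.abs_cos_le_one (v x / ((N : ℝ) + 1)))
      rw [abs_le]
      constructor <;> linarith [a1.1, a1.2]
    · filter_upwards [hM.ae_isYoung hΩ.1] with x hx
      have t1 : Tendsto (fun N : ℕ => c • (G x - Real.cos (v x / ((N : ℝ) + 1)) • G x)) atTop
          (𝓝 0) := by
        have := (((tendsto_cos_div (v x)).smul_const (G x)).const_sub (G x)).const_smul c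
        simpa using this
      have t2 := (ENNReal.continuous_ofReal.tendsto _).comp ((hx.continuous.tendsto _).comp t1)
      rw [hx.zero, ENNReal.ofReal_zero] at t2
      exact t2
  rw [lintegral_zero] at l1 l2
  obtain ⟨N, h1, h2⟩ := ((l1.eventually_lt_const hε).and (l2.eventually_lt_const hε)).exists
  have hT := hv.sinTrunc_comp (hpos N)
  refine ⟨_, _, hT.1.aestronglyMeasurable, hT.2.1.aestronglyMeasurable, ?_, h1, h2⟩
  have hbd : ∀ x, |sinTrunc ((N : ℝ) + 1) (v x)| ≤ (N : ℝ) + 1 := fun x =>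
    abs_sinTrunc_le (hpos N) _
  refine hT.hasZeroExtGradient.approxByTest_of_holder hΩ hM zero_le hB
    (hG.bdd_smul hΩ.1 hM (hcm _) fun x => Real.abs_cos_le_one _)
    (A := 2 * ((N : ℝ≥0) + 1)) (holderWith_zero_of_abs_le fun x => ?_) fun x _ => hbd x
  push_cast
  by_cases hx : x ∈ Ω
  · rw [indicator_of_mem hx]
    exact hbd x
  · rw [indicator_of_notMem hx, abs_zero]
    positivity

/-- Approximation of Hölder continuous functions with zero trace. -/
theorem HasZeroTraceGradient.approxByTest_of_holder (hΩ : IsBoundedLipschitzDomain Ω)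
    (hM : IsWeakNFunction Ω M) {γ : ℝ≥0} (hγ0 : 0 < γ) (hγ : γ ≤ 1) (hB : BGenPlus Ω M γ)
    {v : Eucl n → ℝ} {G : Eucl n → Eucl n} (hv : HasZeroTraceGradient Ω v G)
    (hG : FiniteModulars Ω M G) (hvγ : v ∈ HolderSpace Ω γ) : ApproxByTest Ω M v G := by
  obtain ⟨C, hC⟩ := hvγ
  obtain ⟨x₀, hx₀⟩ := hΩ.2.1.nonempty
  -- A Hölder function on a bounded set is bounded, so no truncation is needed.
  refine hv.hasZeroExtGradient.approxByTest_of_holder hΩ hM hγ hB hG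
    (hv.holderWith_indicator hΩ hγ0 hC)
    (B := |v x₀| + C * Metric.diam Ω ^ (γ : ℝ)) fun x hx => ?_
  have h1 := hC.dist_le hx hx₀
  rw [Real.dist_eq] at h1
  have h2 : dist x x₀ ^ (γ : ℝ) ≤ Metric.diam Ω ^ (γ : ℝ) :=
    Real.rpow_le_rpow dist_nonneg (Metric.dist_le_diam_of_mem hΩ.2.2.1 hx hx₀) γ.coe_nonneg
  have h3 := abs_add_le (v x - v x₀) (v x₀)
  rw [sub_add_cancel] at h3
  have h4 : (C : ℝ) * dist x x₀ ^ (γ : ℝ) ≤ C * Metric.diam Ω ^ (γ : ℝ) := by gcongr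
  linarith

theorem IsTestFunction.mem_holderSpace {φ : Eucl n → ℝ} (hφ : IsTestFunction Ω φ) {γ : ℝ≥0}
    (hγ : γ ≤ 1) : φ ∈ HolderSpace Ω γ := by
  obtain ⟨C, hC0, hC⟩ := (hφ.mono (subset_univ Ω)).exists_holder hγ
  have h : HolderWith ⟨C, hC0⟩ γ φ := holderWith_of_dist_le fun x y => by
    rw [Real.dist_eq]
    exact hC x y
  exact ⟨⟨C, hC0⟩, h.holderOnWith Ω⟩

end Lavrentiev

/-! ### Absence of the Lavrentiev gap. -/

theorem mainTheorem5 (n : ℕ) (hn : 1 ≤ n)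
    (Ω : Set (Eucl n)) (hΩ : IsBoundedLipschitzDomain Ω)
    (M : Eucl n → Eucl n → ℝ) (hM : IsWeakNFunction Ω M)
    (hMcont : ContinuousOn (fun p : Eucl n × Eucl n => M p.1 p.2) (Ω ×ˢ univ))
    (F : Eucl n → ℝ → Eucl n → ℝ)
    (hFmeas : ∀ (z : ℝ) (ξ : Eucl n), AEMeasurable (fun x => F x z ξ) (volume.restrict Ω))
    (hFcont : ∀ x ∈ Ω, Continuous fun p : ℝ × Eucl n => F x p.1 p.2)
    (ν β L : ℝ) (hν₀ : 0 < ν) (hν₁ : ν < 1) (hβ₀ : 0 < β) (hβ₁ : β < 1) (hL : 1 < L)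
    (hF : ∀ x ∈ Ω, ∀ (z : ℝ) (ξ : Eucl n),
      ν * M x (β • ξ) ≤ F x z ξ ∧ F x z ξ ≤ L * (M x ξ + 1)) :
    (∀ u₀ ∈ V1E Ω M, BGenPlus Ω M 0 →
      (⨅ v ∈ V10E Ω M, energy Ω F (u₀ + v)) =
        (⨅ (φ : Eucl n → ℝ) (_ : IsTestFunction Ω φ), energy Ω F (u₀ + φ))) ∧
    (∀ γ : ℝ≥0, 0 < γ → γ ≤ 1 → ∀ u₀ ∈ V1E Ω M ∩ HolderSpace Ω γ, BGenPlus Ω M γ →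
      (⨅ v ∈ V10E Ω M ∩ HolderSpace Ω γ, energy Ω F (u₀ + v)) =
        (⨅ (φ : Eucl n → ℝ) (_ : IsTestFunction Ω φ), energy Ω F (u₀ + φ))) := by
  have hb := hΩ.2.2.1
  -- Both parts reduce to modular approximation of the competitor `v`; the boundary datum enters
  -- only through its finite modulars.
  have key : ∀ u₀ ∈ V1E Ω M, ∀ v ∈ V10E Ω M, ApproxByTest Ω M v (weakGradient Ω v) →
      (⨅ (φ : Eucl n → ℝ) (_ : IsTestFunction Ω φ), energy Ω F (u₀ + φ)) ≤
        energy Ω F (u₀ + v) := fun u₀ hu v hv happ =>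
    iInf_energy_le hΩ.1 hb hM hFmeas hFcont (by linarith) (fun x hx z ξ => (hF x hx z ξ).2)
      hu.1 hv.1.1 (hu.2.finiteModulars hΩ.1 hb hM) (hv.2.finiteModulars hΩ.1 hb hM) happ
  refine ⟨fun u₀ hu hB => le_antisymm ?_ ?_, fun γ hγ0 hγ u₀ hu hB => le_antisymm ?_ ?_⟩
  · exact le_iInf₂ fun φ hφ => iInf₂_le φ (hφ.mem_V10E hΩ.1 hM)
  · refine le_iInf₂ fun v hv => key u₀ hu v hv ?_
    exact hv.1.hasZeroTraceGradient.approxByTest hΩ hM hB (hv.2.finiteModulars hΩ.1 hb hM)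
  · exact le_iInf₂ fun φ hφ => iInf₂_le φ ⟨hφ.mem_V10E hΩ.1 hM, hφ.mem_holderSpace hγ⟩
  · refine le_iInf₂ fun v hv => key u₀ hu.1 v hv.1 ?_
    exact hv.1.1.hasZeroTraceGradient.approxByTest_of_holder hΩ hM hγ0 hγ hB
      (hv.1.2.finiteModulars hΩ.1 hb hM) hv.2
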